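/- Let $\mathbb{T}=\mathbb{R}/\mathbb{Z}$ be the one-dimensional torus with Lebesgue measure. For all integers $k,l\ge 0$ let $\phi_{k,l}\in C^\infty(\mathbb{T}^2)$ be nonnegative, with $\phi_{0,l}\equiv 0$, and assume that there is $C_1<\infty$ such that $\phi_{k,l}(u,v)\le C_1k$ for all $k,l\ge 0$ and $u,v\in\mathbb{T}$. Let $\psi\in C^\infty(\mathbb{T})$ with $\psi(u)>0$ for all $u\in\mathbb{T}$. (i) There is exactly one family $\rho_{t,k}\in C(\mathbb{T})$, $t\in[0,\infty)$, $k\ge 0$, such that for all $t\ge 0$ and $u\in\mathbb{T}$ (with the right derivative at $t=0$) $$\begin{aligned}\frac{d}{dt}\rho_{t,k}(u)=&-\rho_{t,k}(u)\sum_{l=0}^\infty\int_{\mathbb{T}}\phi_{k,l}(u,v)\rho_{t,l}(v)\,dv-\rho_{t,k}(u)\sum_{l=1}^\infty\int_{\mathbb{T}}\phi_{l,k}(v,u)\rho_{t,l}(v)\,dv\\&+\rho_{t,k-1}(u)\sum_{l=1}^\infty\int_{\mathbb{T}}\phi_{l,k-1}(v,u)\rho_{t,l}(v)\,dv+\rho_{t,k+1}(u)\sum_{l=0}^\infty\int_{\mathbb{T}}\phi_{k+1,l}(u,v)\rho_{t,l}(v)\,dv\qquad(k\ge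 1),\end{aligned}$$ $$\frac{d}{dt}\rho_{t,0}(u)=\rho_{t,1}(u)\sum_{l=0}^\infty\int_{\mathbb{T}}\phi_{1,l}(u,v)\rho_{t,l}(v)\,dv-\rho_{t,0}(u)\sum_{l=1}^\infty\int_{\mathbb{T}}\phi_{l,0}(v,u)\rho_{t,l}(v)\,dv,$$ $$\rho_{0,k}(u)=e^{-\psi(u)}\frac{\psi(u)^k}{k!}\qquad(k\ge 0),$$ and such that $\rho_{t,k}(u)\ge 0$ and $\sum_{l\ge 0}\rho_{t,l}(u)=1$ for all $t\ge 0$, $k\ge 0$, $u\in\mathbb{T}$, and for every $T>0$ $$\sup_{0\le t\le T,\,u\in\mathbb{T}}\ \sum_{l=0}^\infty l^r\rho_{t,l}(u)<\infty\quad(r=1,2),\qquad \limsup_{M\to\infty}\frac1M\log\sup_{u\in\mathbb{T},\,0\le t\le T}\Big(\sum_{l=M}^\infty l\,\rho_{t,l}(u)\Big)=-\infty .$$ (ii) For each $N\ge 1$ let $(\eta^N_t)_{t\ge 0}$ be a continuous-time (càdlàg) Markov process on $\{0,1,2,\dots\}^N$ with generator $$\mathcal{L}_Nf(\eta)=\frac1N\sum_{i=1}^N\sum_{j\ne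 i}\phi_{\eta(i),\eta(j)}\left(\tfrac iN,\tfrac jN\right)\left(f(\eta^{(i,j)})-f(\eta)\right),$$ where $\eta^{(i,j)}$ is obtained from $\eta$ by moving one particle from $i$ to $j$, and suppose that $\eta^N_0(1),\dots,\eta^N_0(N)$ are independent, $\eta^N_0(i)$ being Poisson distributed with parameter $\psi(i/N)$. Let $\rho$ be the family in (i). Then for all $t\ge 0$, $k\ge 0$ and $f\in C(\mathbb{T})$, as $N\to\infty$, $$\mu^N_{t,k}(f):=\frac1N\sum_{i=1}^N 1_{\{\eta^N_t(i)=k\}}f(i/N)\ \longrightarrow\ \int_{\mathbb{T}}\rho_{t,k}(u)f(u)\,du\quad\text{in probability.}$$ -/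

import Mathlib

open MeasureTheory ProbabilityTheory Filter Topology
open scoped NNReal ENNReal

namespace MeanField

noncomputable section

/-! Functions on the torus `𝕋 = ℝ / ℤ` are functions on `UnitAddCircle`, which carries its
normalized Lebesgue measure as `volume`. -/

/-- `ψ ∈ C^∞(𝕋)`: the associated `1`-periodic function on `ℝ` is smooth. -/
def SmoothOnTorus (ψ : UnitAddCircle → ℝ) : Prop :=
  ContDiff ℝ ((⊤ : ℕ∞) : WithTop ℕ∞) fun x : ℝ => ψ (x : UnitAddCircle)

/-- `g ∈ C^∞(𝕋²)`: the associated function on `ℝ²`, periodic in each variable, is smooth. -/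
def SmoothOnTorus₂ (g : UnitAddCircle → UnitAddCircle → ℝ) : Prop :=
  ContDiff ℝ ((⊤ : ℕ∞) : WithTop ℕ∞) fun p : ℝ × ℝ => g (p.1 : UnitAddCircle) (p.2 : UnitAddCircle)

/-- A family of jump rates `φ k l (u, v)`, for jumps from a position `u` carrying `k` particles
to a position `v` carrying `l` particles, without a bound on the number of particles. -/
structure IsRateFamily (φ : ℕ → ℕ → UnitAddCircle → UnitAddCircle → ℝ) : Prop where
  smooth : ∀ k l, SmoothOnTorus₂ (φ k l)
  nonneg : ∀ k l u v, 0 ≤ φ k l u v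
  zero : ∀ l u v, φ 0 l u v = 0

/-- Linear growth of the rates: `φ k l (u, v) ≤ C₁ k` for some finite constant `C₁`. -/
def LinearGrowth (φ : ℕ → ℕ → UnitAddCircle → UnitAddCircle → ℝ) : Prop :=
  ∃ C₁ : ℝ, ∀ k l u v, φ k l u v ≤ C₁ * k

/-! ### The particle system -/

/-- The `N` positions `1/N, 2/N, …, N/N` on the torus; the index `i : Fin N` stands for the
position number `i + 1`. -/
def site (N : ℕ) (i : Fin N) : UnitAddCircle :=
  (((i : ℕ) + 1 : ℝ) / N : ℝ)

/-- The configuration `η^(i,j)`: one particle is moved from `i` to `j`. It is used for `i ≠ j`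
only, and with a nonzero rate only if `1 ≤ η i`. -/
def moveParticle {N : ℕ} (η : Fin N → ℕ) (i j : Fin N) : Fin N → ℕ :=
  Function.update (Function.update η i (η i - 1)) j (η j + 1)

/-- The generator
`L f η = (1/N) ∑_i ∑_{j ≠ i} φ_{η(i), η(j)}(i/N, j/N) (f(η^(i,j)) - f(η))`. -/
def generator (N : ℕ) (φ : ℕ → ℕ → UnitAddCircle → UnitAddCircle → ℝ)
    (f : (Fin N → ℕ) → ℝ) (η : Fin N → ℕ) : ℝ :=
  (1 / (N : ℝ)) * ∑ i : Fin N, ∑ j ∈ Finset.univ.erase i,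
    φ (η i) (η j) (site N i) (site N j) * (f (moveParticle η i j) - f η)

/-- The process `f(X_t) - f(X_0) - ∫₀ᵗ L f(X_s) ds`. -/
def dynkinProcess {Ω : Type*} (N : ℕ) (φ : ℕ → ℕ → UnitAddCircle → UnitAddCircle → ℝ)
    (X : ℝ≥0 → Ω → (Fin N → ℕ)) (f : (Fin N → ℕ) → ℝ) (t : ℝ≥0) (ω : Ω) : ℝ :=
  f (X t ω) - f (X 0 ω) - ∫ s in (0 : ℝ)..t, generator N φ f (X s.toNNReal ω)

/-- `X` is a càdlàg process on the countable state space `ℕ^N` which solves the martingale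
problem for the generator, with the finitely supported functions as test functions. As a jump
preserves the number of particles, the generator maps finitely supported functions to finitely
supported functions and splits into blocks acting on the finite sets of configurations with a
given number of particles; hence the solutions are exactly the continuous-time Markov chains with
this generator. -/
structure IsMarkovProcess {Ω : Type*} [MeasurableSpace Ω] (P : Measure Ω) (N : ℕ)
    (φ : ℕ → ℕ → UnitAddCircle → UnitAddCircle → ℝ) (X : ℝ≥0 → Ω → (Fin N → ℕ)) : Prop where
  right_continuous : ∀ ω t, ContinuousWithinAt (fun s => X s ω) (Set.Ici t) t
  left_limits : ∀ ω t, ∃ η, Tendsto (fun s => X s ω) (𝓝[<] t) (𝓝 η)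
  martingale : ∃ ℱ : Filtration ℝ≥0 (inferInstance : MeasurableSpace Ω),
    (∀ t, Measurable[ℱ t] (X t)) ∧
    ∀ f : (Fin N → ℕ) → ℝ, (Function.support f).Finite →
      Martingale (dynkinProcess N φ X f) ℱ P

/-- The law on `ℕ^N` under which the coordinates are independent, the `i`-th one being Poisson
with parameter `ψ(i/N)` (used for `ψ > 0`). -/
def productPoisson (N : ℕ) (ψ : UnitAddCircle → ℝ) : Measure (Fin N → ℕ) :=
  Measure.pi fun i => poissonMeasure (ψ (site N i)).toNNReal

/-- `μ_k(f) = (1/N) ∑_i 1_{η(i) = k} f(i/N)`. -/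
def empirical {N : ℕ} (η : Fin N → ℕ) (k : ℕ) (f : UnitAddCircle → ℝ) : ℝ :=
  (1 / (N : ℝ)) * ∑ i : Fin N, if η i = k then f (site N i) else 0

/-! ### The mean field equation

For `r : ℕ → C(𝕋)`, `r l v` is the density of positions with `l` particles at `v`. -/

/-- `∑_{l ≥ 0} ∫ φ_{k,l}(u, v) r_l(v) dv`. -/
def departureRate (φ : ℕ → ℕ → UnitAddCircle → UnitAddCircle → ℝ)
    (r : ℕ → C(UnitAddCircle, ℝ)) (k : ℕ) (u : UnitAddCircle) : ℝ :=
  ∑' l : ℕ, ∫ v, φ k l u v * r l v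

/-- `∑_{l ≥ 1} ∫ φ_{l,k}(v, u) r_l(v) dv`. -/
def arrivalRate (φ : ℕ → ℕ → UnitAddCircle → UnitAddCircle → ℝ)
    (r : ℕ → C(UnitAddCircle, ℝ)) (k : ℕ) (u : UnitAddCircle) : ℝ :=
  ∑' l : ℕ, ∫ v, φ (l + 1) k v u * r (l + 1) v

/-- The right-hand side of the mean field equation, for `k = 0` and for `k ≥ 1`. -/
def meanFieldRHS (φ : ℕ → ℕ → UnitAddCircle → UnitAddCircle → ℝ)
    (r : ℕ → C(UnitAddCircle, ℝ)) : ℕ → UnitAddCircle → ℝ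
  | 0, u => r 1 u * departureRate φ r 1 u - r 0 u * arrivalRate φ r 0 u
  | k + 1, u =>
      - r (k + 1) u * departureRate φ r (k + 1) u
      - r (k + 1) u * arrivalRate φ r (k + 1) u
      + r k u * arrivalRate φ r k u
      + r (k + 2) u * departureRate φ r (k + 2) u

/-- `ρ` is a solution on `[0, ∞)` of the mean field equation with Poisson initial data, under the
constraints of positivity, mass one, bounded first and second moments, and superexponentially
small tails. The derivative at `t = 0` is the right derivative. Under the constraints all series
in the equation converge; the series of nonnegative terms in the last two constraints and their
suprema are taken in `[0, ∞]`, and `log 0 = -∞` in the last one. -/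
structure IsMeanFieldSolution (φ : ℕ → ℕ → UnitAddCircle → UnitAddCircle → ℝ)
    (ψ : UnitAddCircle → ℝ) (ρ : ℝ≥0 → ℕ → C(UnitAddCircle, ℝ)) : Prop where
  equation : ∀ (t : ℝ≥0) (k : ℕ) (u : UnitAddCircle),
    HasDerivWithinAt (fun s : ℝ => ρ s.toNNReal k u) (meanFieldRHS φ (ρ t) k u) (Set.Ici 0) t
  initial : ∀ (k : ℕ) (u : UnitAddCircle),
    ρ 0 k u = Real.exp (- ψ u) * ψ u ^ k / (k.factorial : ℝ)
  nonneg : ∀ (t : ℝ≥0) (k : ℕ) (u : UnitAddCircle), 0 ≤ ρ t k u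
  mass : ∀ (t : ℝ≥0) (u : UnitAddCircle), HasSum (fun l => ρ t l u) 1
  moments : ∀ T : ℝ≥0, ∀ r ∈ ({1, 2} : Set ℕ),
    (⨆ (t : ℝ≥0) (_ : t ≤ T) (u : UnitAddCircle),
      ∑' l : ℕ, ENNReal.ofReal ((l : ℝ) ^ r * ρ t l u)) < ∞
  tails : ∀ T : ℝ≥0,
    limsup (fun M : ℕ => (((1 / (M : ℝ) : ℝ) : EReal) *
      ENNReal.log (⨆ (t : ℝ≥0) (_ : t ≤ T) (u : UnitAddCircle),
        ∑' l : {l : ℕ // M ≤ l}, ENNReal.ofReal ((l : ℝ) * ρ t l u)))) atTop = ⊥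

end

end MeanField

namespace MeanField

/-! Everything rests on one competition. Levels below `K` jump at rate at most `C * K`, so the
equation restricted to these levels is Lipschitz with a constant of order `K`, up to an error
governed by the first moment beyond `K`. Gronwall turns this into (tail at `K`) times `exp (c * K *
T)`, which tends to zero as soon as the tail decays faster than every exponential.

Uniqueness is this estimate applied to two solutions: `BoundedRates.sum_abs_meanFieldRHS_sub_le`,
`sum_abs_le_of_sum_abs_deriv_le`, `BoundedRates.sum_abs_sub_le`.

For existence, the equation without levels above `K` is an ordinary differential equation with
quadratic right-hand side in `C(𝕋)^(K+1)`. Clipping makes the vector field bounded and Lipschitz,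
and positivity together with mass at most one shows afterwards that the clipping is inactive
(`exists_isTruncatedSolution`). Linear growth bounds the arrival rate at every site by `C` times the
spatial mean density, which grows at most exponentially in time. Each site thus gains particles at a
bounded rate, and every exponential moment is bounded uniformly in the truncation
(`IsTruncatedSolution.expMomentBound`). The competition above then makes the truncated solutions
Cauchy, along with their time derivatives, and the limit solves the full equation (`exists_limit`,
`exists_isRegularSolution`). By uniqueness, every solution in the sense of the theorem has these
exponential moments.

For the particle system, the torus is cut into cells by a partition of unity so fine that the rates
with indices below `K` are almost constant on pairs of cells. The weights of level `k` in cell `c`,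
for the particles and for `ρ`, then follow nearly the same finite-dimensional quadratic flow
(`cellDrift`). Their `ℓ¹` distance, smoothed to `∑ √(β² + x²)`, is inserted directly into the
forward equation. Its curvature contributes only order `1 / (β N)`, because a jump moves the weights
by order `1 / N`, so fluctuations need no separate treatment
(`IsLocalization.generator_smoothDist_le`, `IsRegularSolution.blockExp_smoothDist_le`). The argument
is run on the block of configurations with at most `M * N` particles: it is finite and invariant,
exponential moments propagate on it, and its complement has small probability for large `M`. The
parameters are chosen in the order `M`, `K`, `δ`, and finally `N → ∞` with `β = 1 / √N`. -/

instance isProbabilityMeasure_unitAddCircle :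
    IsProbabilityMeasure (volume : Measure UnitAddCircle) :=
  ⟨UnitAddCircle.measure_univ⟩

/-! ### Rates, profiles, and bounds for the departure and arrival rates -/

/-- A rate family with linear growth, for an explicit constant. -/
structure BoundedRates (φ : ℕ → ℕ → UnitAddCircle → UnitAddCircle → ℝ) (C : ℝ) : Prop
    extends IsRateFamily φ where
  const_nonneg : 0 ≤ C
  le : ∀ k l u v, φ k l u v ≤ C * k

/-- Nonnegative functions with total mass at most one and first moment at most `m`. -/
structure IsProfile (m : ℝ) (r : ℕ → C(UnitAddCircle, ℝ)) : Prop where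
  nonneg : ∀ k u, 0 ≤ r k u
  mass_le : ∀ n u, ∑ k ∈ Finset.range n, r k u ≤ 1
  moment_le : ∀ n u, ∑ k ∈ Finset.range n, (k : ℝ) * r k u ≤ m

/-- The first moment beyond level `K` is at most `τ`. -/
def TailBound (K : ℕ) (τ : ℝ) (r : ℕ → C(UnitAddCircle, ℝ)) : Prop :=
  ∀ n u, ∑ k ∈ Finset.Ico K n, (k : ℝ) * r k u ≤ τ

theorem exists_boundedRates {φ : ℕ → ℕ → UnitAddCircle → UnitAddCircle → ℝ}
    (hφ : IsRateFamily φ) (hB : LinearGrowth φ) : ∃ C, BoundedRates φ C := by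
  obtain ⟨C, hC⟩ := hB
  refine ⟨C, { hφ with const_nonneg := ?_, le := hC }⟩
  have := (hφ.nonneg 1 0 0 0).trans (hC 1 0 0 0)
  simpa using this

theorem SmoothOnTorus.continuous {ψ : UnitAddCircle → ℝ} (hψ : SmoothOnTorus ψ) :
    Continuous ψ :=
  (QuotientAddGroup.isOpenQuotientMap_mk.isQuotientMap.continuous_iff).2 (ContDiff.continuous hψ)

theorem SmoothOnTorus₂.continuous {g : UnitAddCircle → UnitAddCircle → ℝ}
    (hg : SmoothOnTorus₂ g) : Continuous fun p : UnitAddCircle × UnitAddCircle => g p.1 p.2 := by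
  have hq : IsOpenQuotientMap
      (Prod.map (QuotientAddGroup.mk : ℝ → UnitAddCircle) (QuotientAddGroup.mk : ℝ → UnitAddCircle)) :=
    QuotientAddGroup.isOpenQuotientMap_mk.prodMap QuotientAddGroup.isOpenQuotientMap_mk
  exact (hq.isQuotientMap.continuous_iff).2 (ContDiff.continuous hg)

theorem integrable_of_continuous {f : UnitAddCircle → ℝ} (hf : Continuous f) :
    Integrable f volume :=
  hf.integrable_of_hasCompactSupport (HasCompactSupport.of_compactSpace f)

theorem integral_le_of_le {f : UnitAddCircle → ℝ} (hf : Continuous f) {b : ℝ} (h : ∀ v, f v ≤ b) :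
    ∫ v, f v ≤ b := by
  simpa using integral_mono (integrable_of_continuous hf) (integrable_const b) h

theorem sum_integral_le {s : Finset ℕ} {g : ℕ → UnitAddCircle → ℝ} (hg : ∀ l, Continuous (g l))
    {b : ℝ} (h : ∀ v, ∑ l ∈ s, g l v ≤ b) : ∑ l ∈ s, ∫ v, g l v ≤ b := by
  rw [← integral_finsetSum s fun l _ => integrable_of_continuous (hg l)]
  exact integral_le_of_le (continuous_finsetSum s fun l _ => hg l) h

theorem tsum_sub_sum_mem {a : ℕ → ℝ} {K : ℕ} {τ : ℝ} (ha : ∀ l, 0 ≤ a l)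
    (h : ∀ n, ∑ l ∈ Finset.Ico K n, a l ≤ τ) :
    Summable a ∧ 0 ≤ ∑' l, a l - ∑ l ∈ Finset.range K, a l ∧
      ∑' l, a l - ∑ l ∈ Finset.range K, a l ≤ τ := by
  have hshift : ∀ n, ∑ i ∈ Finset.range n, a (i + K) ≤ τ := fun n => by
    have := h (K + n)
    rw [Finset.sum_Ico_eq_sum_range] at this
    simpa [add_comm] using this
  have hs : Summable fun i => a (i + K) :=
    summable_of_sum_range_le (fun i => ha _) hshift
  have hs' : Summable a := (summable_nat_add_iff K).1 hs
  have heq := hs'.sum_add_tsum_nat_add K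
  refine ⟨hs', ?_, ?_⟩
  · have : 0 ≤ ∑' i, a (i + K) := tsum_nonneg fun i => ha _
    linarith
  · have : ∑' i, a (i + K) ≤ τ := Real.tsum_le_of_sum_range_le (fun i => ha _) hshift
    linarith

theorem IsProfile.const_nonneg {m : ℝ} {r : ℕ → C(UnitAddCircle, ℝ)} (hr : IsProfile m r) :
    0 ≤ m := by simpa using hr.moment_le 0 0

theorem TailBound.nonneg {K : ℕ} {τ : ℝ} {r : ℕ → C(UnitAddCircle, ℝ)} (h : TailBound K τ r) :
    0 ≤ τ := by simpa using h 0 0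

/-- Above level `K ≥ 1` mass is dominated by first moment, so a single tail quantity controls both.
-/
theorem TailBound.sum_le {K : ℕ} {τ m : ℝ} {r : ℕ → C(UnitAddCircle, ℝ)} (h : TailBound K τ r)
    (hr : IsProfile m r) (hK : 1 ≤ K) (n : ℕ) (u : UnitAddCircle) :
    ∑ k ∈ Finset.Ico K n, r k u ≤ τ := by
  refine le_trans (Finset.sum_le_sum fun k hk => ?_) (h n u)
  have : (1 : ℝ) ≤ k := by exact_mod_cast hK.trans (Finset.mem_Ico.1 hk).1
  nlinarith [hr.nonneg k u]

theorem TailBound.level_le {K : ℕ} {τ : ℝ} {r : ℕ → C(UnitAddCircle, ℝ)} (h : TailBound K τ r)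
    (u : UnitAddCircle) : (K : ℝ) * r K u ≤ τ := by
  simpa using h (K + 1) u

section Rates

variable {φ : ℕ → ℕ → UnitAddCircle → UnitAddCircle → ℝ} {C : ℝ} (hφ : BoundedRates φ C)
  {r r' : ℕ → C(UnitAddCircle, ℝ)} {m τ : ℝ} {K : ℕ}
include hφ

theorem BoundedRates.continuous₂ (k l : ℕ) :
    Continuous fun p : UnitAddCircle × UnitAddCircle => φ k l p.1 p.2 :=
  (hφ.smooth k l).continuous

theorem BoundedRates.continuous_right (k l : ℕ) (u : UnitAddCircle) : Continuous (φ k l u) :=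
  (hφ.continuous₂ k l).comp (Continuous.prodMk_right u)

theorem BoundedRates.continuous_left (k l : ℕ) (v : UnitAddCircle) :
    Continuous fun u => φ k l u v :=
  (hφ.continuous₂ k l).comp (Continuous.prodMk_left v)

theorem BoundedRates.abs_rate_le (k l : ℕ) (u v : UnitAddCircle) : |φ k l u v| ≤ C * k := by
  rw [abs_of_nonneg (hφ.nonneg k l u v)]
  exact hφ.le k l u v

theorem BoundedRates.continuous_departureTerm (k l : ℕ) (u : UnitAddCircle)
    (g : C(UnitAddCircle, ℝ)) : Continuous fun v => φ k l u v * g v :=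
  (hφ.continuous_right k l u).mul g.continuous

theorem BoundedRates.continuous_arrivalTerm (k l : ℕ) (u : UnitAddCircle)
    (g : C(UnitAddCircle, ℝ)) : Continuous fun v => φ l k v u * g v :=
  (hφ.continuous_left l k u).mul g.continuous

/-- The bound `C * k` on the rate does not depend on the target level `l`, so the remainder is
governed by the mass beyond `K`. -/
theorem BoundedRates.departure_split (hr : IsProfile m r) (hτ : TailBound K τ r) (hK : 1 ≤ K)
    (k : ℕ) (u : UnitAddCircle) :
    Summable (fun l => ∫ v, φ k l u v * r l v) ∧
    0 ≤ departureRate φ r k u - ∑ l ∈ Finset.range K, ∫ v, φ k l u v * r l v ∧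
      departureRate φ r k u - ∑ l ∈ Finset.range K, ∫ v, φ k l u v * r l v ≤ C * k * τ := by
  have hC : 0 ≤ C * k := mul_nonneg hφ.const_nonneg k.cast_nonneg
  refine tsum_sub_sum_mem
    (fun l => integral_nonneg fun v => mul_nonneg (hφ.nonneg _ _ _ _) (hr.nonneg l v)) fun n => ?_
  refine sum_integral_le (fun l => hφ.continuous_departureTerm k l u (r l)) fun v => ?_
  calc ∑ l ∈ Finset.Ico K n, φ k l u v * r l v
      ≤ ∑ l ∈ Finset.Ico K n, C * k * r l v :=
        Finset.sum_le_sum fun l _ => mul_le_mul_of_nonneg_right (hφ.le k l u v) (hr.nonneg l v)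
    _ = C * k * ∑ l ∈ Finset.Ico K n, r l v := by rw [Finset.mul_sum]
    _ ≤ C * k * τ := mul_le_mul_of_nonneg_left (hτ.sum_le hr hK n v) hC

theorem BoundedRates.departure_mem (hr : IsProfile m r) (k : ℕ) (u : UnitAddCircle) :
    0 ≤ departureRate φ r k u ∧ departureRate φ r k u ≤ C * k := by
  have hC : 0 ≤ C * k := mul_nonneg hφ.const_nonneg k.cast_nonneg
  have hnn : ∀ l, 0 ≤ ∫ v, φ k l u v * r l v := fun l =>
    integral_nonneg fun v => mul_nonneg (hφ.nonneg _ _ _ _) (hr.nonneg l v)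
  refine ⟨tsum_nonneg hnn, Real.tsum_le_of_sum_range_le hnn fun n =>
    sum_integral_le (fun l => hφ.continuous_departureTerm k l u (r l)) fun v => ?_⟩
  calc ∑ l ∈ Finset.range n, φ k l u v * r l v
      ≤ ∑ l ∈ Finset.range n, C * k * r l v :=
        Finset.sum_le_sum fun l _ => mul_le_mul_of_nonneg_right (hφ.le k l u v) (hr.nonneg l v)
    _ = C * k * ∑ l ∈ Finset.range n, r l v := by rw [Finset.mul_sum]
    _ ≤ C * k * 1 := mul_le_mul_of_nonneg_left (hr.mass_le n v) hC
    _ = C * k := mul_one _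

theorem BoundedRates.departure_zero (u : UnitAddCircle) : departureRate φ r 0 u = 0 := by
  simp [departureRate, hφ.zero]

/-- The arrival rate as a series over all levels. -/
theorem BoundedRates.arrivalRate_eq (hr : IsProfile m r) (k : ℕ) (u : UnitAddCircle) :
    arrivalRate φ r k u = ∑' l, ∫ v, φ l k v u * r l v := by
  have hnn : ∀ l, 0 ≤ ∫ v, φ l k v u * r l v := fun l =>
    integral_nonneg fun v => mul_nonneg (hφ.nonneg _ _ _ _) (hr.nonneg l v)
  have hs : Summable fun l => ∫ v, φ l k v u * r l v := by
    refine summable_of_sum_range_le (c := C * m) hnn fun n =>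
      sum_integral_le (fun l => hφ.continuous_arrivalTerm k l u (r l)) fun v => ?_
    calc ∑ l ∈ Finset.range n, φ l k v u * r l v
        ≤ ∑ l ∈ Finset.range n, C * (l * r l v) := Finset.sum_le_sum fun l _ => by
          have := mul_le_mul_of_nonneg_right (hφ.le l k v u) (hr.nonneg l v)
          linarith
      _ = C * ∑ l ∈ Finset.range n, l * r l v := by rw [Finset.mul_sum]
      _ ≤ C * m := mul_le_mul_of_nonneg_left (hr.moment_le n v) hφ.const_nonneg
  rw [hs.tsum_eq_zero_add]
  simp [arrivalRate, hφ.zero]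

/-- Here the rate `φ l k` may grow like `l`, the summation index, so the remainder needs the first
moment beyond `K`; in return the bound is uniform in `k`. -/
theorem BoundedRates.arrival_split (hr : IsProfile m r) (hτ : TailBound K τ r)
    (k : ℕ) (u : UnitAddCircle) :
    0 ≤ arrivalRate φ r k u - ∑ l ∈ Finset.range K, ∫ v, φ l k v u * r l v ∧
      arrivalRate φ r k u - ∑ l ∈ Finset.range K, ∫ v, φ l k v u * r l v ≤ C * τ := by
  rw [hφ.arrivalRate_eq hr]
  refine (tsum_sub_sum_mem
    (fun l => integral_nonneg fun v => mul_nonneg (hφ.nonneg _ _ _ _) (hr.nonneg l v))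
    fun n => ?_).2
  refine sum_integral_le (fun l => hφ.continuous_arrivalTerm k l u (r l)) fun v => ?_
  calc ∑ l ∈ Finset.Ico K n, φ l k v u * r l v
      ≤ ∑ l ∈ Finset.Ico K n, C * (l * r l v) := Finset.sum_le_sum fun l _ => by
        have := mul_le_mul_of_nonneg_right (hφ.le l k v u) (hr.nonneg l v)
        linarith
    _ = C * ∑ l ∈ Finset.Ico K n, l * r l v := by rw [Finset.mul_sum]
    _ ≤ C * τ := mul_le_mul_of_nonneg_left (hτ n v) hφ.const_nonneg

theorem BoundedRates.arrival_mem (hr : IsProfile m r) (k : ℕ) (u : UnitAddCircle) :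
    0 ≤ arrivalRate φ r k u ∧ arrivalRate φ r k u ≤ C * m := by
  have h := hφ.arrival_split (K := 0) (τ := m) hr
    (fun n u => by rw [← Finset.range_eq_Ico]; exact hr.moment_le n u) k u
  simpa using h

/-- The right-hand side as a difference of fluxes. -/
theorem BoundedRates.meanFieldRHS_eq (k : ℕ) (u : UnitAddCircle) :
    meanFieldRHS φ r k u = r (k + 1) u * departureRate φ r (k + 1) u
      - r k u * departureRate φ r k u
      + (if k = 0 then 0 else r (k - 1) u * arrivalRate φ r (k - 1) u)
      - r k u * arrivalRate φ r k u := by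
  cases k with
  | zero => simp [meanFieldRHS, hφ.departure_zero]
  | succ k => simp [meanFieldRHS]; ring

/-- Summation by parts. -/
theorem BoundedRates.sum_mul_meanFieldRHS (w : ℕ → ℝ) (n : ℕ) (u : UnitAddCircle) :
    ∑ k ∈ Finset.range (n + 1), w k * meanFieldRHS φ r k u =
      ∑ k ∈ Finset.range (n + 1), r k u * departureRate φ r k u * (w (k - 1) - w k)
      + ∑ k ∈ Finset.range (n + 1), r k u * arrivalRate φ r k u * (w (k + 1) - w k)
      + w n * (r (n + 1) u * departureRate φ r (n + 1) u)
      - w (n + 1) * (r n u * arrivalRate φ r n u) := by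
  -- The two extra terms are the fluxes between levels `n` and `n + 1`. At `k = 0` the natural
  -- subtraction makes `w (k - 1) - w k` vanish, which is consistent because level zero has no
  -- departures.
  induction n with
  | zero => simp [hφ.meanFieldRHS_eq, hφ.departure_zero]; ring
  | succ n ih =>
    rw [Finset.sum_range_succ, ih, Finset.sum_range_succ _ (n + 1),
      Finset.sum_range_succ _ (n + 1), hφ.meanFieldRHS_eq]
    simp
    ring

end Rates

end MeanField

namespace MeanField

/-! ### Stability of the mean field equation -/

/-- Both remainders lie in the same interval `[0, e]`, so their difference costs `e` and not `2 *
e`. -/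
theorem abs_sub_le_of_split {x y s s' e d : ℝ} (hx : 0 ≤ x - s ∧ x - s ≤ e)
    (hy : 0 ≤ y - s' ∧ y - s' ≤ e) (hs : |s - s'| ≤ d) : |x - y| ≤ d + e := by
  rw [abs_le] at hs ⊢
  constructor <;> linarith [hx.1, hx.2, hy.1, hy.2, hs.1, hs.2]

theorem abs_mul_sub_mul_le {x x' y y' : ℝ} (hx' : 0 ≤ x') (hy : 0 ≤ y) :
    |x * y - x' * y'| ≤ |x - x'| * y + x' * |y - y'| := by
  calc |x * y - x' * y'| = |(x - x') * y + x' * (y - y')| := by ring_nf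
    _ ≤ |(x - x') * y| + |x' * (y - y')| := abs_add_le _ _
    _ = _ := by rw [abs_mul, abs_mul, abs_of_nonneg hy, abs_of_nonneg hx']

theorem abs_sum_integral_sub_le {g : ℕ → UnitAddCircle → ℝ} (hg : ∀ l, Continuous (g l))
    {r r' : ℕ → C(UnitAddCircle, ℝ)} {K : ℕ} {a b : ℝ} (ha : 0 ≤ a)
    (hga : ∀ l < K, ∀ v, |g l v| ≤ a)
    (hb : ∀ v, ∑ k ∈ Finset.range K, |r k v - r' k v| ≤ b) :
    |(∑ l ∈ Finset.range K, ∫ v, g l v * r l v) - ∑ l ∈ Finset.range K, ∫ v, g l v * r' l v|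
      ≤ a * b := by
  rw [← Finset.sum_sub_distrib]
  calc |∑ l ∈ Finset.range K, ((∫ v, g l v * r l v) - ∫ v, g l v * r' l v)|
      ≤ ∑ l ∈ Finset.range K, |(∫ v, g l v * r l v) - ∫ v, g l v * r' l v| :=
        Finset.abs_sum_le_sum_abs _ _
    _ ≤ ∑ l ∈ Finset.range K, ∫ v, |g l v * (r l v - r' l v)| := by
        refine Finset.sum_le_sum fun l _ => ?_
        have hi : ∀ s : C(UnitAddCircle, ℝ), Integrable fun v => g l v * s v := fun s =>
          integrable_of_continuous ((hg l).mul s.continuous)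
        rw [← integral_sub (hi (r l)) (hi (r' l))]
        refine (abs_integral_le_integral_abs).trans_eq ?_
        simp only [mul_sub]
    _ ≤ a * b := by
        refine sum_integral_le (g := fun l v => |g l v * (r l v - r' l v)|)
          (fun l => ((hg l).mul ((r l).continuous.sub (r' l).continuous)).abs) fun v => ?_
        calc ∑ l ∈ Finset.range K, |g l v * (r l v - r' l v)|
            ≤ ∑ l ∈ Finset.range K, a * |r l v - r' l v| := by
              refine Finset.sum_le_sum fun l hl => ?_
              rw [abs_mul]
              exact mul_le_mul_of_nonneg_right (hga l (Finset.mem_range.1 hl) v) (abs_nonneg _)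
          _ = a * ∑ l ∈ Finset.range K, |r l v - r' l v| := by rw [Finset.mul_sum]
          _ ≤ a * b := mul_le_mul_of_nonneg_left (hb v) ha

section Lipschitz

variable {φ : ℕ → ℕ → UnitAddCircle → UnitAddCircle → ℝ} {C : ℝ} (hφ : BoundedRates φ C)
  {r r' : ℕ → C(UnitAddCircle, ℝ)} {m τ b : ℝ} {K : ℕ}
include hφ

theorem BoundedRates.abs_departure_sub_le (hr : IsProfile m r) (hr' : IsProfile m r')
    (hτ : TailBound K τ r) (hτ' : TailBound K τ r') (hK : 1 ≤ K)
    (hb : ∀ v, ∑ k ∈ Finset.range K, |r k v - r' k v| ≤ b) (k : ℕ) (u : UnitAddCircle) :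
    |departureRate φ r k u - departureRate φ r' k u| ≤ C * k * (b + τ) := by
  rw [mul_add]
  exact abs_sub_le_of_split (hφ.departure_split hr hτ hK k u).2
    (hφ.departure_split hr' hτ' hK k u).2
    (abs_sum_integral_sub_le (fun l => hφ.continuous_right k l u)
      (mul_nonneg hφ.const_nonneg k.cast_nonneg) (fun l _ v => hφ.abs_rate_le k l u v) hb)

theorem BoundedRates.abs_arrival_sub_le (hr : IsProfile m r) (hr' : IsProfile m r')
    (hτ : TailBound K τ r) (hτ' : TailBound K τ r')
    (hb : ∀ v, ∑ k ∈ Finset.range K, |r k v - r' k v| ≤ b) (k : ℕ) (u : UnitAddCircle) :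
    |arrivalRate φ r k u - arrivalRate φ r' k u| ≤ C * K * b + C * τ := by
  refine abs_sub_le_of_split (hφ.arrival_split hr hτ k u) (hφ.arrival_split hr' hτ' k u)
    (abs_sum_integral_sub_le (fun l => hφ.continuous_left l k u)
      (mul_nonneg hφ.const_nonneg K.cast_nonneg) (fun l hl v => (hφ.abs_rate_le l k v u).trans ?_) hb)
  exact mul_le_mul_of_nonneg_left (by exact_mod_cast hl.le) hφ.const_nonneg

/-- The right-hand side of the mean field equation, cut off at level `K`, is Lipschitz up to a
tail error. -/
theorem BoundedRates.sum_abs_meanFieldRHS_sub_le (hr : IsProfile m r) (hr' : IsProfile m r')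
    (hτ : TailBound K τ r) (hτ' : TailBound K τ r') (hK : 1 ≤ K)
    (hb : ∀ v, ∑ k ∈ Finset.range K, |r k v - r' k v| ≤ b) (u : UnitAddCircle) :
    ∑ k ∈ Finset.range K, |meanFieldRHS φ r k u - meanFieldRHS φ r' k u|
      ≤ C * (6 * K + 2 * m) * b + C * (2 * K + 4) * τ := by
  have hC := hφ.const_nonneg
  have hm := hr.const_nonneg
  have hτ0 := hτ.nonneg
  have hb0 : 0 ≤ b := (Finset.sum_nonneg fun k _ => abs_nonneg _).trans (hb u)
  have hK0 : (0 : ℝ) ≤ K := K.cast_nonneg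
  -- `J` and `I` are the differences of the departure and arrival fluxes. Each flux leaves one level
  -- and enters a neighbour, hence occurs twice in the sum over levels.
  set J : ℕ → ℝ := fun k => |r k u * departureRate φ r k u - r' k u * departureRate φ r' k u|
    with hJ
  set I : ℕ → ℝ := fun k => |r k u * arrivalRate φ r k u - r' k u * arrivalRate φ r' k u| with hI
  have hJsum : ∑ k ∈ Finset.range K, J k ≤ C * K * b + C * K * (b + τ) := by
    calc ∑ k ∈ Finset.range K, J k
        ≤ ∑ k ∈ Finset.range K, (C * K * |r k u - r' k u| + C * K * (b + τ) * r' k u) := by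
          refine Finset.sum_le_sum fun k hk => ?_
          have hkK : (k : ℝ) ≤ K := by exact_mod_cast (Finset.mem_range.1 hk).le
          have hCk : C * k ≤ C * K := mul_le_mul_of_nonneg_left hkK hC
          refine (abs_mul_sub_mul_le (hr'.nonneg k u) (hφ.departure_mem hr k u).1).trans
            (add_le_add ?_ ?_)
          · rw [mul_comm]
            exact mul_le_mul_of_nonneg_right ((hφ.departure_mem hr k u).2.trans hCk)
              (abs_nonneg _)
          · rw [mul_comm]
            refine mul_le_mul_of_nonneg_right
              ((hφ.abs_departure_sub_le hr hr' hτ hτ' hK hb k u).trans ?_) (hr'.nonneg k u)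
            exact mul_le_mul_of_nonneg_right hCk (by positivity)
      _ = C * K * ∑ k ∈ Finset.range K, |r k u - r' k u|
          + C * K * (b + τ) * ∑ k ∈ Finset.range K, r' k u := by
          rw [Finset.sum_add_distrib, Finset.mul_sum, Finset.mul_sum]
      _ ≤ C * K * b + C * K * (b + τ) * 1 := by
          gcongr
          · exact hb u
          · exact hr'.mass_le K u
      _ = _ := by ring
  -- The flux from level `K` down to `K - 1` is the only one entering from outside the sum. It is at
  -- most `r K * C * K`, which the tail bound controls.
  have hflux : ∀ s : ℕ → C(UnitAddCircle, ℝ), IsProfile m s → TailBound K τ s →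
      0 ≤ s K u * departureRate φ s K u ∧ s K u * departureRate φ s K u ≤ C * τ := by
    intro s hs hsτ
    have h := hφ.departure_mem hs K u
    refine ⟨mul_nonneg (hs.nonneg K u) h.1, ?_⟩
    calc s K u * departureRate φ s K u ≤ s K u * (C * K) :=
          mul_le_mul_of_nonneg_left h.2 (hs.nonneg K u)
      _ = C * (K * s K u) := by ring
      _ ≤ C * τ := mul_le_mul_of_nonneg_left (hsτ.level_le u) hC
  have hJK : J K ≤ C * τ := by
    have h1 := hflux r hr hτ
    have h2 := hflux r' hr' hτ'
    rw [hJ]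
    simp only
    rw [abs_le]
    constructor <;> linarith [h1.1, h1.2, h2.1, h2.2]
  have hIsum : ∑ k ∈ Finset.range K, I k ≤ C * m * b + (C * K * b + C * τ) := by
    calc ∑ k ∈ Finset.range K, I k
        ≤ ∑ k ∈ Finset.range K, (C * m * |r k u - r' k u| + (C * K * b + C * τ) * r' k u) := by
          refine Finset.sum_le_sum fun k hk => ?_
          refine (abs_mul_sub_mul_le (hr'.nonneg k u) (hφ.arrival_mem hr k u).1).trans
            (add_le_add ?_ ?_)
          · rw [mul_comm]
            exact mul_le_mul_of_nonneg_right (hφ.arrival_mem hr k u).2 (abs_nonneg _)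
          · rw [mul_comm]
            exact mul_le_mul_of_nonneg_right (hφ.abs_arrival_sub_le hr hr' hτ hτ' hb k u)
              (hr'.nonneg k u)
      _ = C * m * ∑ k ∈ Finset.range K, |r k u - r' k u|
          + (C * K * b + C * τ) * ∑ k ∈ Finset.range K, r' k u := by
          rw [Finset.sum_add_distrib, Finset.mul_sum, Finset.mul_sum]
      _ ≤ C * m * b + (C * K * b + C * τ) * 1 := by
          gcongr
          · exact hb u
          · exact hr'.mass_le K u
      _ = _ := by ring
  have hpt : ∀ k, |meanFieldRHS φ r k u - meanFieldRHS φ r' k u|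
      ≤ J (k + 1) + J k + (if k = 0 then 0 else I (k - 1)) + I k := by
    intro k
    rw [hφ.meanFieldRHS_eq, hφ.meanFieldRHS_eq]
    have h1 := abs_le.1 (le_refl (J (k + 1)))
    have h2 := abs_le.1 (le_refl (J k))
    have h3 := abs_le.1 (le_refl (I k))
    have h4 := abs_le.1 (le_refl (I (k - 1)))
    split_ifs with hk <;> rw [abs_le] <;>
      constructor <;> linarith [h1.1, h1.2, h2.1, h2.2, h3.1, h3.2, h4.1, h4.2]
  have hJ1 : ∑ k ∈ Finset.range K, J (k + 1) ≤ ∑ k ∈ Finset.range K, J k + J K := by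
    rw [← Finset.sum_range_succ, Finset.sum_range_succ']
    exact le_add_of_nonneg_right (abs_nonneg _)
  have hI1 : ∑ k ∈ Finset.range K, (if k = 0 then 0 else I (k - 1))
      ≤ ∑ k ∈ Finset.range K, I k := by
    obtain ⟨K', rfl⟩ := Nat.exists_eq_add_of_le' hK
    rw [Finset.sum_range_succ', Finset.sum_range_succ _ K']
    simp only [Nat.add_eq_zero_iff, one_ne_zero, and_false, if_false, Nat.add_sub_cancel, if_true,
      add_zero]
    exact le_add_of_nonneg_right (abs_nonneg _)
  -- Twice the sum of `J`, twice the sum of `I` and one boundary flux: this gives `6 * K + 2 * m` in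
  -- front of `b`, and `2 * K + 3`, rounded up to `2 * K + 4`, in front of `τ`.
  calc ∑ k ∈ Finset.range K, |meanFieldRHS φ r k u - meanFieldRHS φ r' k u|
      ≤ ∑ k ∈ Finset.range K, (J (k + 1) + J k + (if k = 0 then 0 else I (k - 1)) + I k) :=
        Finset.sum_le_sum fun k _ => hpt k
    _ = ∑ k ∈ Finset.range K, J (k + 1) + ∑ k ∈ Finset.range K, J k
        + ∑ k ∈ Finset.range K, (if k = 0 then 0 else I (k - 1)) + ∑ k ∈ Finset.range K, I k := by
        rw [Finset.sum_add_distrib, Finset.sum_add_distrib, Finset.sum_add_distrib]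
    _ ≤ _ := by linarith [mul_nonneg hC hτ0]

end Lipschitz

/-! ### Differential inequalities -/

/-- Integrating factor: `f t * exp (-(a * t))` has right derivative at most `ε * exp (-(a * t)) ≤
ε`. One-sided derivatives suffice, so curves known only on `[0, T]` are covered. -/
theorem le_of_deriv_right_le_linear {f f' : ℝ → ℝ} {a ε T : ℝ} (ha : 0 ≤ a) (hε : 0 ≤ ε)
    (hf : ContinuousOn f (Set.Icc 0 T))
    (hf' : ∀ t ∈ Set.Ico 0 T, HasDerivWithinAt f (f' t) (Set.Ici t) t)
    (h : ∀ t ∈ Set.Ico 0 T, f' t ≤ a * f t + ε) :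
    ∀ t ∈ Set.Icc 0 T, f t ≤ (f 0 + ε * t) * Real.exp (a * t) := by
  intro t ht
  have key : f t * Real.exp (-(a * t)) ≤ f 0 + ε * t := by
    have hE : ∀ t : ℝ, HasDerivAt (fun t => Real.exp (-(a * t))) (-a * Real.exp (-(a * t))) t := by
      intro t
      have := (((hasDerivAt_id t).const_mul a).neg).exp
      simpa [mul_comm] using this
    refine image_le_of_deriv_right_le_deriv_boundary
      (f := fun t => f t * Real.exp (-(a * t))) (B := fun t => f 0 + ε * t) (B' := fun _ => ε)
      (hf.mul (by fun_prop)) (fun t ht => (hf' t ht).mul (hE t).hasDerivWithinAt) (by simp)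
      (by fun_prop) (fun t _ => ?_) (fun t ht => ?_) ht
    · simpa using (((hasDerivAt_id t).const_mul ε).const_add (f 0)).hasDerivWithinAt
    · have h1 := h t ht
      have hexp : Real.exp (-(a * t)) ≤ 1 := Real.exp_le_one_iff.2 (by nlinarith [ht.1])
      have hpos := Real.exp_pos (-(a * t))
      nlinarith
  calc f t = f t * Real.exp (-(a * t)) * Real.exp (a * t) := by
        rw [mul_assoc, ← Real.exp_add]; simp
    _ ≤ _ := mul_le_mul_of_nonneg_right key (Real.exp_pos _).le

/-- `-f` cannot cross the barrier `ε / (1 + T) * (1 + t)`: at a contact point `f` is negative, so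
`-f` has nonpositive slope while the barrier has positive slope. Only the sign of `f'` where `f < 0`
matters. -/
theorem nonneg_of_deriv_right_nonneg {f f' : ℝ → ℝ} {T : ℝ}
    (hf : ContinuousOn f (Set.Icc 0 T))
    (hf' : ∀ t ∈ Set.Ico 0 T, HasDerivWithinAt f (f' t) (Set.Ici t) t) (h0 : 0 ≤ f 0)
    (h : ∀ t ∈ Set.Ico 0 T, f t < 0 → 0 ≤ f' t) : ∀ t ∈ Set.Icc 0 T, 0 ≤ f t := by
  intro t ht
  refine le_of_forall_pos_le_add fun ε hε => ?_
  have ht1 : (0 : ℝ) < 1 + t := by linarith [ht.1]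
  have := image_le_of_deriv_right_lt_deriv_boundary' (f := fun t => - f t)
    (f' := fun t => - f' t) (B := fun t => ε / (1 + T) * (1 + t)) (B' := fun _ => ε / (1 + T))
    hf.neg (fun t ht => (hf' t ht).neg)
    (by have : 0 ≤ ε / (1 + T) := div_nonneg hε.le (by linarith [ht.1, ht.2])
        simp; linarith) (by fun_prop)
    (fun t _ => by
      simpa using (((hasDerivAt_id t).const_add 1).const_mul (ε / (1 + T))).hasDerivWithinAt)
    (fun s hs hfs => ?_) ht
  · have hT : (0 : ℝ) < 1 + T := by linarith [ht.1, ht.2]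
    have : ε / (1 + T) * (1 + t) ≤ ε := by
      rw [div_mul_eq_mul_div, div_le_iff₀ hT]
      exact mul_le_mul_of_nonneg_left (by linarith [ht.2]) hε.le
    linarith
  · have hT : (0 : ℝ) < ε / (1 + T) := div_pos hε (by linarith [ht.1, ht.2])
    have hneg : f s < 0 := by
      have : 0 < ε / (1 + T) * (1 + s) := mul_pos hT (by linarith [hs.1])
      linarith
    have := h s hs hneg
    linarith

/-- A Gronwall inequality, uniform in a parameter, for the `ℓ¹` norm of finitely many functions:
the derivatives at one value of the parameter are controlled by the supremum over all values. -/
theorem sum_abs_le_of_sum_abs_deriv_le {U : Type*} {d d' : ℝ → ℕ → U → ℝ} {K : ℕ} {L ε T b₀ : ℝ}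
    (hL : 0 ≤ L) (hε : 0 ≤ ε)
    (hd : ∀ t ∈ Set.Icc 0 T, ∀ k < K, ∀ u,
      HasDerivWithinAt (fun s => d s k u) (d' t k u) (Set.Icc 0 T) t)
    (h0 : ∀ k < K, ∀ u, d 0 k u = 0)
    (hb : ∀ t ∈ Set.Icc 0 T, ∀ u, ∑ k ∈ Finset.range K, |d t k u| ≤ b₀)
    (h : ∀ t ∈ Set.Icc 0 T, ∀ b, (∀ u, ∑ k ∈ Finset.range K, |d t k u| ≤ b) →
      ∀ u, ∑ k ∈ Finset.range K, |d' t k u| ≤ L * b + ε) :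
    ∀ t ∈ Set.Icc 0 T, ∀ u, ∑ k ∈ Finset.range K, |d t k u| ≤ ε * t * Real.exp (L * t) := by
  -- The supremum over `u` need not be differentiable in time, so the inequality is iterated instead
  -- with `u` fixed. Each round integrates the previous bound, and the contribution of the crude
  -- bound `b₀` shrinks like `(L * t) ^ n / n!`.
  have main : ∀ n : ℕ, ∀ t ∈ Set.Icc 0 T, ∀ u, ∑ k ∈ Finset.range K, |d t k u|
      ≤ b₀ * ((L * t) ^ n / n.factorial) + ε * t * Real.exp (L * t) := by
    intro n
    induction n with
    | zero =>
      intro t ht u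
      have : 0 ≤ ε * t * Real.exp (L * t) :=
        mul_nonneg (mul_nonneg hε ht.1) (Real.exp_pos _).le
      simpa using (hb t ht u).trans (le_add_of_nonneg_right this)
    | succ n ih =>
      intro t ht u
      -- The signs are frozen at the final time `t`. The sum with frozen signs is differentiable in
      -- `s`, its derivative is at most the `ℓ¹` norm of `d'`, and at `s = t` it equals the `ℓ¹`
      -- norm of `d`.
      set σ : ℕ → ℝ := fun k => SignType.sign (d t k u) with hσ
      have hσ1 : ∀ k, |σ k| ≤ 1 := fun k => by
        rcases lt_trichotomy (d t k u) 0 with h | h | h <;> simp [hσ, h]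
      have hσd : ∀ k, σ k * d t k u = |d t k u| := fun k => sign_mul_self _
      have hB : ∀ s : ℝ, HasDerivAt
          (fun s => b₀ * ((L * s) ^ (n + 1) / (n + 1).factorial) + ε * s * Real.exp (L * s))
          (L * (b₀ * ((L * s) ^ n / n.factorial) + ε * s * Real.exp (L * s))
            + ε * Real.exp (L * s)) s := by
        intro s
        have hL1 : HasDerivAt (fun s : ℝ => L * s) L s := by
          simpa using (hasDerivAt_id s).const_mul L
        have h1 := ((hL1.pow (n + 1)).div_const ((n + 1).factorial : ℝ)).const_mul b₀
        have h2 : HasDerivAt (fun s : ℝ => ε * s * Real.exp (L * s)) _ s :=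
          ((hasDerivAt_id s).const_mul ε).mul hL1.exp
        refine (h1.add h2).congr_deriv ?_
        have hf : ((n + 1).factorial : ℝ) = (n + 1) * n.factorial := by
          rw [Nat.factorial_succ]; push_cast; ring
        have hf0 : (n.factorial : ℝ) ≠ 0 := by positivity
        have hn0 : ((n : ℝ) + 1) ≠ 0 := by positivity
        rw [hf]
        simp only [Nat.add_sub_cancel, id]
        push_cast
        field_simp
        ring
      have hmono : Set.Icc 0 t ⊆ Set.Icc 0 T := Set.Icc_subset_Icc_right ht.2
      have hsum : ∀ s ∈ Set.Icc 0 t, HasDerivWithinAt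
          (fun s => ∑ k ∈ Finset.range K, σ k * d s k u)
          (∑ k ∈ Finset.range K, σ k * d' s k u) (Set.Icc 0 t) s := fun s hs =>
        HasDerivWithinAt.fun_sum fun k hk =>
          ((hd s (hmono hs) k (Finset.mem_range.1 hk) u).mono hmono).const_mul (σ k)
      have := image_le_of_deriv_right_le_deriv_boundary
        (f := fun s => ∑ k ∈ Finset.range K, σ k * d s k u)
        (fun s hs => (hsum s hs).continuousWithinAt)
        (fun s hs => (hsum s ⟨hs.1, hs.2.le⟩).mono_of_mem_nhdsWithin
          (Icc_mem_nhdsGE_of_mem hs))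
        (B := fun s => b₀ * ((L * s) ^ (n + 1) / (n + 1).factorial)
          + ε * s * Real.exp (L * s))
        (by
          rw [Finset.sum_eq_zero fun k hk => by
            rw [h0 k (Finset.mem_range.1 hk) u, mul_zero]]
          simp)
        (fun s _ => (hB s).continuousAt.continuousWithinAt)
        (fun s _ => (hB s).hasDerivWithinAt)
        (fun s hs => ?_) (Set.right_mem_Icc.2 ht.1)
      · simpa only [hσd] using this
      · have hs' : s ∈ Set.Icc 0 T := hmono ⟨hs.1, hs.2.le⟩
        have h1 := h s hs' _ (ih s hs') u
        have h2 : ∑ k ∈ Finset.range K, σ k * d' s k u ≤ ∑ k ∈ Finset.range K, |d' s k u| := by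
          refine Finset.sum_le_sum fun k _ => (le_abs_self _).trans ?_
          rw [abs_mul]
          exact mul_le_of_le_one_left (abs_nonneg _) (hσ1 k)
        have h3 : ε ≤ ε * Real.exp (L * s) :=
          le_mul_of_one_le_right hε (Real.one_le_exp (mul_nonneg hL hs.1))
        linarith
  intro t ht u
  have hlim : Tendsto (fun n : ℕ => b₀ * ((L * t) ^ n / n.factorial) + ε * t * Real.exp (L * t))
      atTop (𝓝 (b₀ * 0 + ε * t * Real.exp (L * t))) :=
    ((FloorSemiring.tendsto_pow_div_factorial_atTop (L * t)).const_mul b₀).add_const _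
  rw [mul_zero, zero_add] at hlim
  exact ge_of_tendsto' hlim fun n => main n t ht u

/-- The mean field equation holds on `[0, T]` for the levels below `K`. -/
def IsSolutionOn (φ : ℕ → ℕ → UnitAddCircle → UnitAddCircle → ℝ) (T : ℝ) (K : ℕ)
    (ρ : ℝ → ℕ → C(UnitAddCircle, ℝ)) : Prop :=
  ∀ t ∈ Set.Icc 0 T, ∀ k < K, ∀ u,
    HasDerivWithinAt (fun s => ρ s k u) (meanFieldRHS φ (ρ t) k u) (Set.Icc 0 T) t

/-- Two solutions with the same initial data are close if their tails are small. -/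
theorem BoundedRates.sum_abs_sub_le {φ : ℕ → ℕ → UnitAddCircle → UnitAddCircle → ℝ} {C : ℝ}
    (hφ : BoundedRates φ C) {ρ ρ' : ℝ → ℕ → C(UnitAddCircle, ℝ)} {m τ T : ℝ} {K : ℕ}
    (hK : 1 ≤ K) (hρ : IsSolutionOn φ T K ρ) (hρ' : IsSolutionOn φ T K ρ')
    (h0 : ∀ k < K, ∀ u, ρ 0 k u = ρ' 0 k u)
    (hm : ∀ t ∈ Set.Icc 0 T, IsProfile m (ρ t)) (hm' : ∀ t ∈ Set.Icc 0 T, IsProfile m (ρ' t))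
    (hτ : ∀ t ∈ Set.Icc 0 T, TailBound K τ (ρ t)) (hτ' : ∀ t ∈ Set.Icc 0 T, TailBound K τ (ρ' t))
    {t : ℝ} (ht : t ∈ Set.Icc 0 T) (u : UnitAddCircle) :
    ∑ k ∈ Finset.range K, |ρ t k u - ρ' t k u|
      ≤ C * (2 * K + 4) * τ * t * Real.exp (C * (6 * K + 2 * m) * t) := by
  have hm0 := (hm t ht).const_nonneg
  have hτ0 := (hτ t ht).nonneg
  have hC := hφ.const_nonneg
  refine sum_abs_le_of_sum_abs_deriv_le (d := fun t k u => ρ t k u - ρ' t k u)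
    (d' := fun t k u => meanFieldRHS φ (ρ t) k u - meanFieldRHS φ (ρ' t) k u) (b₀ := 2)
    (by positivity) (by positivity) (fun t ht k hk u => (hρ t ht k hk u).sub (hρ' t ht k hk u))
    (fun k hk u => sub_eq_zero.2 (h0 k hk u)) (fun t ht u => ?_)
    (fun t ht b hb u => hφ.sum_abs_meanFieldRHS_sub_le (hm t ht) (hm' t ht) (hτ t ht) (hτ' t ht)
      hK hb u) t ht u
  calc ∑ k ∈ Finset.range K, |ρ t k u - ρ' t k u|
      ≤ ∑ k ∈ Finset.range K, (ρ t k u + ρ' t k u) := Finset.sum_le_sum fun k _ => by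
        have h1 := (hm t ht).nonneg k u
        have h2 := (hm' t ht).nonneg k u
        rw [abs_le]; constructor <;> linarith
    _ ≤ 2 := by
        rw [Finset.sum_add_distrib]
        linarith [(hm t ht).mass_le K u, (hm' t ht).mass_le K u]

end MeanField

namespace MeanField

/-! ### The equation truncated at a finite level -/

section Truncation

variable {φ : ℕ → ℕ → UnitAddCircle → UnitAddCircle → ℝ} {C : ℝ}

/-- A continuous function cut off to values in `[0, 1]`. -/
noncomputable def clip (f : C(UnitAddCircle, ℝ)) : C(UnitAddCircle, ℝ) := (f ⊔ 0) ⊓ 1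

theorem clip_apply (f : C(UnitAddCircle, ℝ)) (u : UnitAddCircle) :
    clip f u = min (max (f u) 0) 1 := rfl

theorem clip_nonneg (f : C(UnitAddCircle, ℝ)) (u : UnitAddCircle) : 0 ≤ clip f u := by
  rw [clip_apply]
  positivity

theorem norm_clip_le (f : C(UnitAddCircle, ℝ)) : ‖clip f‖ ≤ 1 := by
  rw [ContinuousMap.norm_le _ zero_le_one]
  intro u
  rw [Real.norm_of_nonneg (clip_nonneg f u)]
  exact min_le_right _ _

theorem norm_clip_sub_clip_le (f g : C(UnitAddCircle, ℝ)) : ‖clip f - clip g‖ ≤ ‖f - g‖ := by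
  rw [ContinuousMap.norm_le _ (norm_nonneg _)]
  intro u
  refine le_trans ?_ ((f - g).norm_coe_le_norm u)
  simp only [ContinuousMap.sub_apply, clip_apply, Real.norm_eq_abs]
  refine (abs_min_sub_min_le_max _ _ _ _).trans (max_le ?_ (by simp))
  refine (abs_max_sub_max_le_max _ _ _ _).trans (max_le le_rfl (by simp))

/-- The state with levels `0, …, K`, clipped to `[0, 1]` and extended by zero. -/
noncomputable def truncate (K : ℕ) (x : Fin (K + 1) → C(UnitAddCircle, ℝ)) (k : ℕ) : C(UnitAddCircle, ℝ) :=
  if h : k < K + 1 then clip (x ⟨k, h⟩) else 0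

/-- The operator `g ↦ ∫ φ_{k,l}(·, v) g(v) dv`. -/
noncomputable def departureOp (hφ : BoundedRates φ C) (k l : ℕ) (g : C(UnitAddCircle, ℝ)) :
    C(UnitAddCircle, ℝ) where
  toFun u := ∫ v, φ k l u v * g v
  continuous_toFun := by
    have := continuous_parametric_integral_of_continuous (μ := (volume : Measure UnitAddCircle))
      (f := fun u v => φ k l u v * g v)
      ((hφ.continuous₂ k l).mul (g.continuous.comp continuous_snd)) isCompact_univ
    simpa using this

/-- The operator `g ↦ ∫ φ_{l,k}(v, ·) g(v) dv`. -/
noncomputable def arrivalOp (hφ : BoundedRates φ C) (k l : ℕ) (g : C(UnitAddCircle, ℝ)) :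
    C(UnitAddCircle, ℝ) where
  toFun u := ∫ v, φ l k v u * g v
  continuous_toFun := by
    have := continuous_parametric_integral_of_continuous (μ := (volume : Measure UnitAddCircle))
      (f := fun u v => φ l k v u * g v)
      (((hφ.continuous₂ l k).comp continuous_swap).mul (g.continuous.comp continuous_snd))
      isCompact_univ
    simpa using this

theorem norm_integral_mul_le {h : UnitAddCircle → ℝ} {c : ℝ} (hc : ∀ v, |h v| ≤ c)
    (g : C(UnitAddCircle, ℝ)) : ‖∫ v, h v * g v‖ ≤ c * ‖g‖ := by
  have := norm_integral_le_of_norm_le_const (μ := (volume : Measure UnitAddCircle))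
    (f := fun v => h v * g v) (C := c * ‖g‖) (Eventually.of_forall fun v => by
      rw [norm_mul]
      exact mul_le_mul (hc v) (g.norm_coe_le_norm v) (norm_nonneg _)
        ((abs_nonneg _).trans (hc v)))
  simpa using this

theorem norm_departureOp_le (hφ : BoundedRates φ C) (k l : ℕ) (g : C(UnitAddCircle, ℝ)) :
    ‖departureOp hφ k l g‖ ≤ C * k * ‖g‖ := by
  have hC := hφ.const_nonneg
  rw [ContinuousMap.norm_le _ (by positivity)]
  exact fun u => norm_integral_mul_le (fun v => hφ.abs_rate_le k l u v) g

theorem norm_arrivalOp_le (hφ : BoundedRates φ C) (k l : ℕ) (g : C(UnitAddCircle, ℝ)) :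
    ‖arrivalOp hφ k l g‖ ≤ C * l * ‖g‖ := by
  have hC := hφ.const_nonneg
  rw [ContinuousMap.norm_le _ (by positivity)]
  exact fun u => norm_integral_mul_le (fun v => hφ.abs_rate_le l k v u) g

theorem departureOp_sub (hφ : BoundedRates φ C) (k l : ℕ) (g g' : C(UnitAddCircle, ℝ)) :
    departureOp hφ k l (g - g') = departureOp hφ k l g - departureOp hφ k l g' := by
  ext u
  refine Eq.trans ?_ (integral_sub
    (integrable_of_continuous (hφ.continuous_departureTerm k l u g))
    (integrable_of_continuous (hφ.continuous_departureTerm k l u g')))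
  simp only [departureOp, ContinuousMap.coe_mk, ContinuousMap.sub_apply, mul_sub]

theorem arrivalOp_sub (hφ : BoundedRates φ C) (k l : ℕ) (g g' : C(UnitAddCircle, ℝ)) :
    arrivalOp hφ k l (g - g') = arrivalOp hφ k l g - arrivalOp hφ k l g' := by
  ext u
  refine Eq.trans ?_ (integral_sub
    (integrable_of_continuous (hφ.continuous_arrivalTerm k l u g))
    (integrable_of_continuous (hφ.continuous_arrivalTerm k l u g')))
  simp only [arrivalOp, ContinuousMap.coe_mk, ContinuousMap.sub_apply, mul_sub]

/-- The right-hand side of the mean field equation for states without levels above `K`. -/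
noncomputable def finiteRHS (hφ : BoundedRates φ C) (K : ℕ) (r : ℕ → C(UnitAddCircle, ℝ)) (k : ℕ) :
    C(UnitAddCircle, ℝ) :=
  r (k + 1) * (∑ l ∈ Finset.range (K + 1), departureOp hφ (k + 1) l (r l))
    - r k * (∑ l ∈ Finset.range (K + 1), departureOp hφ k l (r l))
    + (if k = 0 then 0 else
        r (k - 1) * (∑ l ∈ Finset.range (K + 1), arrivalOp hφ (k - 1) l (r l)))
    - r k * (∑ l ∈ Finset.range (K + 1), arrivalOp hφ k l (r l))

theorem finiteRHS_apply (hφ : BoundedRates φ C) {K : ℕ} {r : ℕ → C(UnitAddCircle, ℝ)}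
    (hr : ∀ k, K < k → r k = 0) (k : ℕ) (u : UnitAddCircle) :
    finiteRHS hφ K r k u = meanFieldRHS φ r k u := by
  have hD : ∀ k, (∑ l ∈ Finset.range (K + 1), departureOp hφ k l (r l)) u
      = departureRate φ r k u := fun k => by
    rw [ContinuousMap.sum_apply, departureRate, tsum_eq_sum]
    · rfl
    · intro l hl
      rw [hr l (by simpa using hl)]
      simp
  have hA : ∀ k, (∑ l ∈ Finset.range (K + 1), arrivalOp hφ k l (r l)) u
      = arrivalRate φ r k u := fun k => by
    have h0 : ∀ l ∉ Finset.range (K + 1), ∫ v, φ l k v u * r l v = 0 := fun l hl => by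
      rw [hr l (by simpa using hl)]
      simp
    have h1 : arrivalRate φ r k u = ∑' l, ∫ v, φ l k v u * r l v := by
      rw [(summable_of_ne_finset_zero h0).tsum_eq_zero_add]
      simp [arrivalRate, hφ.zero]
    rw [ContinuousMap.sum_apply, h1, tsum_eq_sum h0]
    rfl
  rw [hφ.meanFieldRHS_eq, finiteRHS]
  split_ifs with hk <;> simp only [ContinuousMap.sub_apply, ContinuousMap.add_apply,
    ContinuousMap.mul_apply, hD, hA, ContinuousMap.zero_apply]

/-- Bounded and globally Lipschitz maps. -/
def IsBoundedLipschitz {X E : Type*} [NormedAddCommGroup X] [NormedAddCommGroup E]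
    (F : X → E) : Prop :=
  ∃ B : ℝ≥0, (∀ x, ‖F x‖ ≤ B) ∧ ∀ x y, ‖F x - F y‖ ≤ B * ‖x - y‖

/-! ### Calculus of bounded Lipschitz maps. -/

section BoundedLipschitz

variable {X E : Type*} [NormedAddCommGroup X] [NormedAddCommGroup E] {F G : X → E}

theorem IsBoundedLipschitz.zero : IsBoundedLipschitz fun _ : X => (0 : E) :=
  ⟨0, by simp, by simp⟩

theorem IsBoundedLipschitz.add (hF : IsBoundedLipschitz F) (hG : IsBoundedLipschitz G) :
    IsBoundedLipschitz fun x => F x + G x := by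
  obtain ⟨B, h1, h2⟩ := hF
  obtain ⟨B', h1', h2'⟩ := hG
  refine ⟨B + B', fun x => (norm_add_le _ _).trans (add_le_add (h1 x) (h1' x)), fun x y => ?_⟩
  rw [add_sub_add_comm, NNReal.coe_add, add_mul]
  exact (norm_add_le _ _).trans (add_le_add (h2 x y) (h2' x y))

theorem IsBoundedLipschitz.sub (hF : IsBoundedLipschitz F) (hG : IsBoundedLipschitz G) :
    IsBoundedLipschitz fun x => F x - G x := by
  obtain ⟨B, h1, h2⟩ := hF
  obtain ⟨B', h1', h2'⟩ := hG
  refine ⟨B + B', fun x => (norm_sub_le _ _).trans (add_le_add (h1 x) (h1' x)), fun x y => ?_⟩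
  rw [sub_sub_sub_comm, NNReal.coe_add, add_mul]
  exact (norm_sub_le _ _).trans (add_le_add (h2 x y) (h2' x y))

theorem IsBoundedLipschitz.sum {ι : Type*} {s : Finset ι} {F : ι → X → E}
    (hF : ∀ i, IsBoundedLipschitz (F i)) : IsBoundedLipschitz fun x => ∑ i ∈ s, F i x := by
  classical
  induction s using Finset.induction_on with
  | empty => simpa using IsBoundedLipschitz.zero
  | insert i s hi ih =>
    simp only [Finset.sum_insert hi]
    exact (hF i).add ih

theorem IsBoundedLipschitz.comp {E' : Type*} [NormedAddCommGroup E'] {A : E → E'} {c : ℝ}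
    (hF : IsBoundedLipschitz F) (hc : 0 ≤ c) (hA : ∀ x, ‖A x‖ ≤ c * ‖x‖)
    (hsub : ∀ x y, A (x - y) = A x - A y) : IsBoundedLipschitz fun x => A (F x) := by
  obtain ⟨B, h1, h2⟩ := hF
  lift c to ℝ≥0 using hc
  refine ⟨c * B, fun x => (hA _).trans ?_, fun x y => ?_⟩
  · exact mul_le_mul_of_nonneg_left (h1 x) c.2
  · rw [← hsub, NNReal.coe_mul, mul_assoc]
    exact (hA _).trans (mul_le_mul_of_nonneg_left (h2 x y) c.2)

/-- This is why a bound is carried along with the Lipschitz constant: the right-hand side is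
quadratic, and a product of Lipschitz maps is globally Lipschitz only if the factors are bounded. -/
theorem IsBoundedLipschitz.mul {A : Type*} [NormedRing A] {F G : X → A}
    (hF : IsBoundedLipschitz F) (hG : IsBoundedLipschitz G) :
    IsBoundedLipschitz fun x => F x * G x := by
  obtain ⟨B, h1, h2⟩ := hF
  obtain ⟨B', h1', h2'⟩ := hG
  refine ⟨B * B' + B * B', fun x => ?_, fun x y => ?_⟩
  · have : ‖F x * G x‖ ≤ B * B' :=
      (norm_mul_le _ _).trans (mul_le_mul (h1 x) (h1' x) (norm_nonneg _) B.2)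
    push_cast
    have hBB : (0 : ℝ) ≤ B * B' := by positivity
    linarith
  · have h3 : F x * G x - F y * G y = (F x - F y) * G x + F y * (G x - G y) := by noncomm_ring
    rw [h3]
    refine (norm_add_le _ _).trans ?_
    have h4 : ‖(F x - F y) * G x‖ ≤ B * ‖x - y‖ * B' :=
      (norm_mul_le _ _).trans (mul_le_mul (h2 x y) (h1' x) (norm_nonneg _) (by positivity))
    have h5 : ‖F y * (G x - G y)‖ ≤ B * (B' * ‖x - y‖) :=
      (norm_mul_le _ _).trans (mul_le_mul (h1 y) (h2' x y) (norm_nonneg _) B.2)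
    push_cast
    linarith

theorem IsBoundedLipschitz.pi {ι : Type*} [Fintype ι] {F : X → ι → E}
    (hF : ∀ i, IsBoundedLipschitz fun x => F x i) : IsBoundedLipschitz F := by
  choose B h1 h2 using hF
  have hle : ∀ i, (B i : ℝ) ≤ (∑ i, B i : ℝ≥0) := fun i => by
    exact_mod_cast Finset.single_le_sum (f := B) (fun _ _ => zero_le) (Finset.mem_univ i)
  refine ⟨∑ i, B i, fun x => ?_, fun x y => ?_⟩
  · exact (pi_norm_le_iff_of_nonneg (NNReal.coe_nonneg _)).2 fun i => (h1 i x).trans (hle i)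
  · refine (pi_norm_le_iff_of_nonneg (by positivity)).2 fun i => (h2 i x y).trans ?_
    exact mul_le_mul_of_nonneg_right (hle i) (norm_nonneg _)

end BoundedLipschitz

theorem isBoundedLipschitz_truncate (K k : ℕ) : IsBoundedLipschitz fun x => truncate K x k := by
  by_cases h : k < K + 1
  · refine ⟨1, fun x => ?_, fun x y => ?_⟩
    · simpa [truncate, h] using norm_clip_le _
    · simp only [truncate, h, dif_pos, NNReal.coe_one, one_mul]
      exact (norm_clip_sub_clip_le _ _).trans (norm_le_pi_norm (x - y) ⟨k, h⟩)
  · simpa [truncate, h] using IsBoundedLipschitz.zero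

theorem isBoundedLipschitz_finiteRHS (hφ : BoundedRates φ C) (K : ℕ) :
    IsBoundedLipschitz fun (x : Fin (K + 1) → C(UnitAddCircle, ℝ)) (k : Fin (K + 1)) =>
      finiteRHS hφ K (truncate K x) k := by
  have hC := hφ.const_nonneg
  have hD : ∀ k, IsBoundedLipschitz fun x : Fin (K + 1) → C(UnitAddCircle, ℝ) =>
      truncate K x k * ∑ l ∈ Finset.range (K + 1), departureOp hφ k l (truncate K x l) := fun k =>
    (isBoundedLipschitz_truncate K k).mul (IsBoundedLipschitz.sum fun l =>
      (isBoundedLipschitz_truncate K l).comp (by positivity) (norm_departureOp_le hφ k l)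
        (departureOp_sub hφ k l))
  have hA : ∀ k, IsBoundedLipschitz fun x : Fin (K + 1) → C(UnitAddCircle, ℝ) =>
      truncate K x k * ∑ l ∈ Finset.range (K + 1), arrivalOp hφ k l (truncate K x l) := fun k =>
    (isBoundedLipschitz_truncate K k).mul (IsBoundedLipschitz.sum fun l =>
      (isBoundedLipschitz_truncate K l).comp (by positivity) (norm_arrivalOp_le hφ k l)
        (arrivalOp_sub hφ k l))
  refine IsBoundedLipschitz.pi fun k => (((hD _).sub (hD _)).add ?_).sub (hA _)
  split_ifs
  · exact IsBoundedLipschitz.zero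
  · exact hA _

theorem IsBoundedLipschitz.continuous {X E : Type*} [NormedAddCommGroup X]
    [NormedAddCommGroup E] {F : X → E} (hF : IsBoundedLipschitz F) : Continuous F := by
  obtain ⟨B, -, h⟩ := hF
  exact (LipschitzWith.of_dist_le_mul (K := B) fun x y => by
    simpa [dist_eq_norm] using h x y).continuous

/-- A bounded Lipschitz vector field has an integral curve on any interval `[0, T]`. -/
theorem IsBoundedLipschitz.exists_integralCurve {E : Type*} [NormedAddCommGroup E]
    [NormedSpace ℝ E] [CompleteSpace E] {F : E → E} (hF : IsBoundedLipschitz F) (x₀ : E) {T : ℝ}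
    (hT : 0 ≤ T) :
    ∃ α : ℝ → E, α 0 = x₀ ∧ ∀ t ∈ Set.Icc 0 T, HasDerivWithinAt α (F (α t)) (Set.Icc 0 T) t := by
  obtain ⟨B, h1, h2⟩ := hF
  lift T to ℝ≥0 using hT
  -- The speed is at most `B`, so a ball of radius `B * T` is not left before time `T` and the local
  -- theorem covers the whole interval.
  have hP : IsPicardLindelof (fun _ => F) (⟨0, Set.left_mem_Icc.2 T.2⟩ : Set.Icc 0 (T : ℝ)) x₀
      (B * T) 0 B B := by
    refine IsPicardLindelof.of_time_independent (fun x _ => h1 x) ?_ ?_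
    · exact (LipschitzWith.of_dist_le_mul fun x y => by
        simpa [dist_eq_norm] using h2 x y).lipschitzOnWith
    · simp
  obtain ⟨α, h0, hα⟩ := hP.exists_eq_forall_mem_Icc_hasDerivWithinAt₀
  exact ⟨α, h0, hα⟩

/-- A solution on `[0, T]` of the equation truncated above level `K`, as a differentiable curve in
`C(𝕋)` at each level. -/
structure IsTruncatedSolution (φ : ℕ → ℕ → UnitAddCircle → UnitAddCircle → ℝ) (T : ℝ) (K : ℕ)
    (r₀ : ℕ → C(UnitAddCircle, ℝ)) (ρ R : ℝ → ℕ → C(UnitAddCircle, ℝ)) : Prop where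
  hasDeriv : ∀ t ∈ Set.Icc 0 T, ∀ k ≤ K,
    HasDerivWithinAt (fun s => ρ s k) (R t k) (Set.Icc 0 T) t
  rhs : ∀ t ∈ Set.Icc 0 T, ∀ k ≤ K, ∀ u, R t k u = meanFieldRHS φ (ρ t) k u
  continuousOn : ∀ k ≤ K, ContinuousOn (fun t => R t k) (Set.Icc 0 T)
  initial : ∀ k ≤ K, ρ 0 k = r₀ k
  nonneg : ∀ t ∈ Set.Icc 0 T, ∀ k u, 0 ≤ ρ t k u
  mass_le : ∀ t ∈ Set.Icc 0 T, ∀ n u, ∑ k ∈ Finset.range n, ρ t k u ≤ 1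
  eq_zero : ∀ t, ∀ k, K < k → ρ t k = 0

theorem hasDerivWithinAt_apply {f : ℝ → C(UnitAddCircle, ℝ)} {f' : C(UnitAddCircle, ℝ)}
    {s : Set ℝ} {t : ℝ} (h : HasDerivWithinAt f f' s t) (u : UnitAddCircle) :
    HasDerivWithinAt (fun s => f s u) (f' u) s t :=
  (ContinuousMap.evalCLM ℝ u : C(UnitAddCircle, ℝ) →L[ℝ] ℝ).hasFDerivAt.comp_hasDerivWithinAt t h

theorem truncate_nonneg (K : ℕ) (x : Fin (K + 1) → C(UnitAddCircle, ℝ)) (k : ℕ)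
    (u : UnitAddCircle) : 0 ≤ truncate K x k u := by
  rw [truncate]
  split_ifs
  · exact clip_nonneg _ _
  · exact le_rfl

theorem BoundedRates.departureRate_nonneg (hφ : BoundedRates φ C) {r : ℕ → C(UnitAddCircle, ℝ)}
    (hr : ∀ k u, 0 ≤ r k u) (k : ℕ) (u : UnitAddCircle) : 0 ≤ departureRate φ r k u :=
  tsum_nonneg fun l => integral_nonneg fun v => mul_nonneg (hφ.nonneg _ _ _ _) (hr l v)

theorem BoundedRates.arrivalRate_nonneg (hφ : BoundedRates φ C) {r : ℕ → C(UnitAddCircle, ℝ)}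
    (hr : ∀ k u, 0 ≤ r k u) (k : ℕ) (u : UnitAddCircle) : 0 ≤ arrivalRate φ r k u :=
  tsum_nonneg fun _ => integral_nonneg fun v => mul_nonneg (hφ.nonneg _ _ _ _) (hr _ v)

/-- The equation is solved with the clipped right-hand side, which is bounded and Lipschitz.
Nonnegativity and mass at most one then confine every level to `[0, 1]`, where clipping is the
identity, so the curve solves the unclipped truncated equation. -/
theorem exists_isTruncatedSolution (hφ : BoundedRates φ C) {m : ℝ}
    {r₀ : ℕ → C(UnitAddCircle, ℝ)} (hr₀ : IsProfile m r₀) (K : ℕ) {T : ℝ} (hT : 0 ≤ T) :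
    ∃ ρ R : ℝ → ℕ → C(UnitAddCircle, ℝ), IsTruncatedSolution φ T K r₀ ρ R := by
  have hF := isBoundedLipschitz_finiteRHS hφ K
  obtain ⟨α, hα0, hα⟩ := hF.exists_integralCurve (fun k : Fin (K + 1) => r₀ k) hT
  have hz : ∀ t k, K < k → truncate K (α t) k = 0 := fun t k hk => by
    simp [truncate, Nat.not_lt.2 (Nat.succ_le_of_lt hk)]
  have hcont : ∀ k, ContinuousOn (fun t => α t k) (Set.Icc 0 T) := fun k t ht =>
    (hasDerivWithinAt_pi.1 (hα t ht) k).continuousWithinAt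
  have hpt : ∀ (k : Fin (K + 1)) (u : UnitAddCircle), ∀ t ∈ Set.Icc 0 T,
      HasDerivWithinAt (fun s => α s k u) (meanFieldRHS φ (truncate K (α t)) k u)
        (Set.Icc 0 T) t := fun k u t ht => by
    rw [← finiteRHS_apply hφ (hz t)]
    exact hasDerivWithinAt_apply (hasDerivWithinAt_pi.1 (hα t ht) k) u
  have hright : ∀ {f : ℝ → ℝ} {f' : ℝ → ℝ},
      (∀ t ∈ Set.Icc 0 T, HasDerivWithinAt f (f' t) (Set.Icc 0 T) t) →
      ∀ t ∈ Set.Ico 0 T, HasDerivWithinAt f (f' t) (Set.Ici t) t := fun h t ht =>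
    (h t ⟨ht.1, ht.2.le⟩).mono_of_mem_nhdsWithin (Icc_mem_nhdsGE_of_mem ht)
  have hnn : ∀ (k : Fin (K + 1)) (u : UnitAddCircle), ∀ t ∈ Set.Icc 0 T, 0 ≤ α t k u := by
    intro k u
    refine nonneg_of_deriv_right_nonneg (fun t ht => (hpt k u t ht).continuousWithinAt)
      (hright (hpt k u)) (by rw [hα0]; exact hr₀.nonneg k u) fun t ht hneg => ?_
    -- Where level `k` is negative its clipped value is zero, so both loss terms vanish and only
    -- nonnegative gains remain.
    have h0 : truncate K (α t) k u = 0 := by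
      simp [truncate, clip_apply, k.2, hneg.le]
    have hD := hφ.departureRate_nonneg (truncate_nonneg K (α t))
    have hA := hφ.arrivalRate_nonneg (truncate_nonneg K (α t))
    have hnn := truncate_nonneg K (α t)
    rw [hφ.meanFieldRHS_eq, h0]
    have h1 := mul_nonneg (hnn (k + 1) u) (hD (k + 1) u)
    split_ifs
    · linarith
    · have h2 := mul_nonneg (hnn (k - 1) u) (hA (k - 1) u)
      linarith
  have hmass : ∀ u, ∀ t ∈ Set.Icc 0 T, ∑ k : Fin (K + 1), α t k u ≤ 1 := by
    intro u t ht
    have hsum : ∀ t ∈ Set.Icc 0 T, HasDerivWithinAt (fun s => ∑ k : Fin (K + 1), α s k u)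
        (∑ k : Fin (K + 1), meanFieldRHS φ (truncate K (α t)) k u) (Set.Icc 0 T) t :=
      fun t ht => HasDerivWithinAt.fun_sum fun k _ => hpt k u t ht
    have := le_of_deriv_right_le_linear le_rfl le_rfl
      (fun t ht => (hsum t ht).continuousWithinAt) (hright hsum) (fun t ht => ?_) t ht
    · refine this.trans ?_
      rw [hα0, Finset.sum_fin_eq_sum_range]
      simp only [zero_mul, add_zero, Real.exp_zero, mul_one]
      refine le_trans (le_of_eq (Finset.sum_congr rfl fun k hk => ?_)) (hr₀.mass_le (K + 1) u)
      simp [Finset.mem_range.1 hk]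
    · have h1 := hφ.sum_mul_meanFieldRHS (r := truncate K (α t)) (fun _ => 1) K u
      simp only [one_mul, sub_self, mul_zero, Finset.sum_const_zero, zero_add, hz t (K + 1)
        (Nat.lt_succ_self K), ContinuousMap.zero_apply, zero_mul, zero_sub] at h1
      rw [Fin.sum_univ_eq_sum_range fun k => meanFieldRHS φ (truncate K (α t)) k u, h1]
      have := mul_nonneg (truncate_nonneg K (α t) K u)
        (hφ.arrivalRate_nonneg (truncate_nonneg K (α t)) K u)
      linarith
  have heq : ∀ t ∈ Set.Icc 0 T, ∀ k : Fin (K + 1), truncate K (α t) k = α t k := by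
    intro t ht k
    ext u
    have h1 : α t k u ≤ 1 :=
      (Finset.single_le_sum (f := fun k => α t k u) (fun k _ => hnn k u t ht)
        (Finset.mem_univ k)).trans (hmass u t ht)
    simp [truncate, clip_apply, k.2, hnn k u t ht, h1]
  refine ⟨fun t => truncate K (α t), fun t => finiteRHS hφ K (truncate K (α t)), ?_, ?_, ?_, ?_,
    fun t _ => truncate_nonneg K (α t), ?_, hz⟩
  · intro t ht k hk
    exact (hasDerivWithinAt_pi.1 (hα t ht) ⟨k, Nat.lt_succ_of_le hk⟩).congr
      (fun s hs => heq s hs ⟨k, Nat.lt_succ_of_le hk⟩) (heq t ht ⟨k, Nat.lt_succ_of_le hk⟩)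
  · exact fun t _ k _ u => finiteRHS_apply hφ (hz t) k u
  · intro k hk
    have h1 : ContinuousOn α (Set.Icc 0 T) := fun t ht => (hα t ht).continuousWithinAt
    exact ((continuous_apply (⟨k, Nat.lt_succ_of_le hk⟩ : Fin (K + 1))).comp
      hF.continuous).comp_continuousOn h1
  · intro k hk
    have := heq 0 (Set.left_mem_Icc.2 hT) ⟨k, Nat.lt_succ_of_le hk⟩
    simpa [hα0] using this
  · intro t ht n u
    have hK : ∑ k ∈ Finset.range (K + 1), truncate K (α t) k u ≤ 1 := by
      rw [← Fin.sum_univ_eq_sum_range fun k => truncate K (α t) k u]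
      refine le_trans (le_of_eq (Finset.sum_congr rfl fun k _ => ?_)) (hmass u t ht)
      rw [heq t ht]
    refine le_trans ?_ hK
    rw [Finset.sum_subset (Finset.range_subset_range.2 (le_max_left (K + 1) n))
      (fun k _ hk => by rw [hz t k (by simpa using hk)]; rfl)]
    exact Finset.sum_le_sum_of_subset_of_nonneg
      (Finset.range_subset_range.2 (le_max_right _ _)) fun k _ _ => truncate_nonneg K (α t) k u

end Truncation

end MeanField

namespace MeanField

/-! ### Exponential moments -/

/-- The exponential moment with parameter `θ` is at most `Λ`. -/
def ExpMomentBound (θ Λ : ℝ) (r : ℕ → C(UnitAddCircle, ℝ)) : Prop :=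
  ∀ n u, ∑ k ∈ Finset.range n, Real.exp (θ * k) * r k u ≤ Λ

theorem natCast_le_exp (k : ℕ) : (k : ℝ) ≤ Real.exp k := by
  linarith [Real.add_one_le_exp (k : ℝ)]

/-- From `k ≤ exp k` and `exp ((1 - θ) * k) ≤ exp ((1 - θ) * K)`. This is the source of the decay
rate `θ - 1` in the tail bounds, for profiles and for particle configurations alike. -/
theorem natCast_le_exp_mul {θ : ℝ} (hθ : 1 ≤ θ) {K k : ℕ} (hk : K ≤ k) :
    (k : ℝ) ≤ Real.exp (-(θ - 1) * K) * Real.exp (θ * k) := by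
  rw [← Real.exp_add]
  refine (natCast_le_exp k).trans (Real.exp_le_exp.2 ?_)
  have : (K : ℝ) ≤ k := by exact_mod_cast hk
  nlinarith

section ExpMoment

variable {r : ℕ → C(UnitAddCircle, ℝ)} {θ Λ : ℝ}

theorem ExpMomentBound.isProfile (h : ExpMomentBound 1 Λ r) (hr : ∀ k u, 0 ≤ r k u)
    (hr1 : ∀ n u, ∑ k ∈ Finset.range n, r k u ≤ 1) : IsProfile Λ r where
  nonneg := hr
  mass_le := hr1
  moment_le n u := by
    refine (Finset.sum_le_sum fun k _ => ?_).trans (h n u)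
    rw [one_mul]
    exact mul_le_mul_of_nonneg_right (natCast_le_exp k) (hr k u)

theorem ExpMomentBound.nonneg (h : ExpMomentBound θ Λ r) : 0 ≤ Λ := by simpa using h 0 0

theorem ExpMomentBound.tailBound (h : ExpMomentBound θ Λ r) (hθ : 1 ≤ θ)
    (hr : ∀ k u, 0 ≤ r k u) (K : ℕ) : TailBound K (Real.exp (-(θ - 1) * K) * Λ) r := by
  intro n u
  calc ∑ k ∈ Finset.Ico K n, (k : ℝ) * r k u
      ≤ ∑ k ∈ Finset.Ico K n, Real.exp (-(θ - 1) * K) * (Real.exp (θ * k) * r k u) := by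
        refine Finset.sum_le_sum fun k hk => ?_
        rw [← mul_assoc]
        exact mul_le_mul_of_nonneg_right (natCast_le_exp_mul hθ (Finset.mem_Ico.1 hk).1)
          (hr k u)
    _ = Real.exp (-(θ - 1) * K) * ∑ k ∈ Finset.Ico K n, Real.exp (θ * k) * r k u := by
        rw [Finset.mul_sum]
    _ ≤ Real.exp (-(θ - 1) * K) * Λ := by
        refine mul_le_mul_of_nonneg_left (le_trans ?_ (h n u)) (Real.exp_pos _).le
        refine Finset.sum_le_sum_of_subset_of_nonneg (fun k hk => ?_) fun k _ _ =>
          mul_nonneg (Real.exp_pos _).le (hr k u)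
        exact Finset.mem_range.2 (Finset.mem_Ico.1 hk).2

end ExpMoment

/-- Integration against a continuous function, as a continuous linear functional on `C(𝕋)`. -/
noncomputable def integralAgainst (h : C(UnitAddCircle, ℝ)) : C(UnitAddCircle, ℝ) →L[ℝ] ℝ :=
  LinearMap.mkContinuous
    { toFun := fun g => ∫ u, h u * g u
      map_add' := fun g g' => by
        rw [← integral_add (integrable_of_continuous (f := fun u => h u * g u) (by fun_prop))
          (integrable_of_continuous (f := fun u => h u * g' u) (by fun_prop))]
        simp [mul_add]
      map_smul' := fun c g => by
        simp only [ContinuousMap.smul_apply, smul_eq_mul, RingHom.id_apply]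
        rw [← integral_const_mul]
        simp only [mul_left_comm] }
    ‖h‖ fun g => norm_integral_mul_le (fun v => h.norm_coe_le_norm v) g

theorem integralAgainst_apply (h g : C(UnitAddCircle, ℝ)) :
    integralAgainst h g = ∫ u, h u * g u := rfl

/-! ### A priori estimates uniform in the truncation level. -/

section Apriori

variable {φ : ℕ → ℕ → UnitAddCircle → UnitAddCircle → ℝ} {C : ℝ} {T m : ℝ} {K : ℕ}
  {r₀ : ℕ → C(UnitAddCircle, ℝ)} {ρ R : ℝ → ℕ → C(UnitAddCircle, ℝ)}

theorem IsTruncatedSolution.mono (h : IsTruncatedSolution φ T K r₀ ρ R) {T' : ℝ} (hT : T' ≤ T) :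
    IsTruncatedSolution φ T' K r₀ ρ R where
  hasDeriv t ht k hk :=
    (h.hasDeriv t ⟨ht.1, ht.2.trans hT⟩ k hk).mono (Set.Icc_subset_Icc_right hT)
  rhs t ht := h.rhs t ⟨ht.1, ht.2.trans hT⟩
  continuousOn k hk := (h.continuousOn k hk).mono (Set.Icc_subset_Icc_right hT)
  initial := h.initial
  nonneg t ht := h.nonneg t ⟨ht.1, ht.2.trans hT⟩
  mass_le t ht := h.mass_le t ⟨ht.1, ht.2.trans hT⟩
  eq_zero := h.eq_zero

theorem IsTruncatedSolution.isSolutionOn (h : IsTruncatedSolution φ T K r₀ ρ R) {K' : ℕ}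
    (hK : K' ≤ K + 1) : IsSolutionOn φ T K' ρ := by
  intro t ht k hk u
  have hk' : k ≤ K := by omega
  rw [← h.rhs t ht k hk' u]
  exact hasDerivWithinAt_apply (h.hasDeriv t ht k hk') u

theorem IsTruncatedSolution.sum_range_le (h : IsTruncatedSolution φ T K r₀ ρ R) {t : ℝ}
    (ht : t ∈ Set.Icc 0 T) {w : ℕ → ℝ} (hw : ∀ k, 0 ≤ w k) (n : ℕ) (u : UnitAddCircle) :
    ∑ k ∈ Finset.range n, w k * ρ t k u ≤ ∑ k ∈ Finset.range (K + 1), w k * ρ t k u := by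
  rw [Finset.sum_subset (Finset.range_subset_range.2 (le_max_left (K + 1) n))
    (fun k _ hk => by rw [h.eq_zero t k (by simpa using hk)]; simp)]
  exact Finset.sum_le_sum_of_subset_of_nonneg
    (Finset.range_subset_range.2 (le_max_right _ _))
    fun k _ _ => mul_nonneg (hw k) (h.nonneg t ht k u)

/-- The moment bound `K` is not uniform in the truncation. It only justifies writing the arrival
rate as a series over all levels. -/
theorem IsTruncatedSolution.isProfile_level (h : IsTruncatedSolution φ T K r₀ ρ R) {t : ℝ}
    (ht : t ∈ Set.Icc 0 T) : IsProfile K (ρ t) where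
  nonneg := h.nonneg t ht
  mass_le := h.mass_le t ht
  moment_le n u := by
    refine (h.sum_range_le ht (fun k => k.cast_nonneg) n u).trans ?_
    calc ∑ k ∈ Finset.range (K + 1), (k : ℝ) * ρ t k u
        ≤ ∑ k ∈ Finset.range (K + 1), (K : ℝ) * ρ t k u := Finset.sum_le_sum fun k hk =>
          mul_le_mul_of_nonneg_right
            (by exact_mod_cast Nat.lt_succ_iff.1 (Finset.mem_range.1 hk)) (h.nonneg t ht k u)
      _ = K * ∑ k ∈ Finset.range (K + 1), ρ t k u := by rw [Finset.mul_sum]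
      _ ≤ K * 1 := mul_le_mul_of_nonneg_left (h.mass_le t ht _ u) K.cast_nonneg
      _ = K := mul_one _

/-- The total number of particles. -/
noncomputable def meanDensity (K : ℕ) (r : ℕ → C(UnitAddCircle, ℝ)) : ℝ :=
  ∑ k ∈ Finset.range (K + 1), k * ∫ u, r k u

/-- Linear growth in the number of particles at the departure site bounds the arrival rate
everywhere by the spatially averaged density. The estimates at different positions `u` are thereby
coupled through one scalar only. -/
theorem IsTruncatedSolution.arrivalRate_le (hφ : BoundedRates φ C)
    (h : IsTruncatedSolution φ T K r₀ ρ R) {t : ℝ} (ht : t ∈ Set.Icc 0 T) (k : ℕ)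
    (u : UnitAddCircle) : arrivalRate φ (ρ t) k u ≤ C * meanDensity K (ρ t) := by
  rw [hφ.arrivalRate_eq (h.isProfile_level ht), tsum_eq_sum (s := Finset.range (K + 1))
    (fun l hl => by rw [h.eq_zero t l (by simpa using hl)]; simp), meanDensity, Finset.mul_sum]
  refine Finset.sum_le_sum fun l _ => ?_
  rw [← mul_assoc, ← integral_const_mul]
  refine integral_mono (integrable_of_continuous (hφ.continuous_arrivalTerm k l u (ρ t l)))
    (integrable_of_continuous (by fun_prop)) fun v => ?_
  exact mul_le_mul_of_nonneg_right (hφ.le l k v u) (h.nonneg t ht l v)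

/-- For a nonnegative nondecreasing weight, departures and the loss across level `K` have the
favourable sign, so only arrivals contribute. -/
theorem IsTruncatedSolution.sum_mul_rhs_le (hφ : BoundedRates φ C)
    (h : IsTruncatedSolution φ T K r₀ ρ R) {t : ℝ} (ht : t ∈ Set.Icc 0 T) {w : ℕ → ℝ}
    (hw0 : ∀ k, 0 ≤ w k) (hw : Monotone w) (u : UnitAddCircle) :
    ∑ k ∈ Finset.range (K + 1), w k * R t k u
      ≤ C * meanDensity K (ρ t)
        * ∑ k ∈ Finset.range (K + 1), (w (k + 1) - w k) * ρ t k u := by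
  have hr := h.nonneg t ht
  rw [Finset.sum_congr rfl fun k hk => by
    rw [h.rhs t ht k (Nat.lt_succ_iff.1 (Finset.mem_range.1 hk)) u],
    hφ.sum_mul_meanFieldRHS, h.eq_zero t (K + 1) (Nat.lt_succ_self K)]
  have h1 : ∑ k ∈ Finset.range (K + 1), ρ t k u * departureRate φ (ρ t) k u
      * (w (k - 1) - w k) ≤ 0 := Finset.sum_nonpos fun k _ =>
    mul_nonpos_of_nonneg_of_nonpos (mul_nonneg (hr k u) (hφ.departureRate_nonneg hr k u))
      (sub_nonpos.2 (hw (Nat.sub_le k 1)))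
  have h2 : ∑ k ∈ Finset.range (K + 1), ρ t k u * arrivalRate φ (ρ t) k u * (w (k + 1) - w k)
      ≤ C * meanDensity K (ρ t) * ∑ k ∈ Finset.range (K + 1), (w (k + 1) - w k) * ρ t k u := by
    rw [Finset.mul_sum]
    refine Finset.sum_le_sum fun k _ => ?_
    have hw' : 0 ≤ w (k + 1) - w k := sub_nonneg.2 (hw (Nat.le_succ k))
    have := mul_le_mul_of_nonneg_right (h.arrivalRate_le hφ ht k u)
      (mul_nonneg hw' (hr k u))
    linarith
  have h3 : 0 ≤ w (K + 1) * (ρ t K u * arrivalRate φ (ρ t) K u) :=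
    mul_nonneg (hw0 _) (mul_nonneg (hr K u) (hφ.arrivalRate_nonneg hr K u))
  simp only [ContinuousMap.zero_apply, zero_mul, mul_zero, add_zero]
  linarith

theorem hasDerivWithinAt_Ici_of_Icc {E : Type*} [NormedAddCommGroup E] [NormedSpace ℝ E]
    {f : ℝ → E} {f' : ℝ → E} {T : ℝ}
    (h : ∀ t ∈ Set.Icc 0 T, HasDerivWithinAt f (f' t) (Set.Icc 0 T) t) :
    ∀ t ∈ Set.Ico 0 T, HasDerivWithinAt f (f' t) (Set.Ici t) t := fun t ht =>
  (h t ⟨ht.1, ht.2.le⟩).mono_of_mem_nhdsWithin (Icc_mem_nhdsGE_of_mem ht)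

/-- With the weight `w k = k` the increments are one and the mass is at most one, so the derivative
of the density is at most `C` times the density. -/
theorem IsTruncatedSolution.meanDensity_le (hφ : BoundedRates φ C) (hr₀ : IsProfile m r₀)
    (h : IsTruncatedSolution φ T K r₀ ρ R) {t : ℝ} (ht : t ∈ Set.Icc 0 T) :
    meanDensity K (ρ t) ≤ m * Real.exp (C * t) := by
  have hC := hφ.const_nonneg
  have hd : ∀ t ∈ Set.Icc 0 T, HasDerivWithinAt (fun s => meanDensity K (ρ s))
      (∑ k ∈ Finset.range (K + 1), (k : ℝ) * ∫ u, R t k u) (Set.Icc 0 T) t := fun t ht => by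
    refine HasDerivWithinAt.fun_sum fun k hk => HasDerivWithinAt.const_mul _ ?_
    have := (integralAgainst 1).hasFDerivAt.comp_hasDerivWithinAt t
      (h.hasDeriv t ht k (Nat.lt_succ_iff.1 (Finset.mem_range.1 hk)))
    simpa [integralAgainst_apply, Function.comp_def] using this
  have key := le_of_deriv_right_le_linear hC le_rfl
    (fun t ht => (hd t ht).continuousWithinAt) (hasDerivWithinAt_Ici_of_Icc hd)
    (fun t ht => ?_) t ht
  · refine key.trans (mul_le_mul_of_nonneg_right ?_ (Real.exp_pos _).le)
    rw [zero_mul, add_zero, meanDensity, Finset.sum_congr rfl fun k hk => by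
      rw [h.initial k (Nat.lt_succ_iff.1 (Finset.mem_range.1 hk)), ← integral_const_mul]]
    exact sum_integral_le (g := fun k u => (k : ℝ) * r₀ k u) (fun k => by fun_prop)
      (hr₀.moment_le (K + 1))
  · have ht' : t ∈ Set.Icc 0 T := ⟨ht.1, ht.2.le⟩
    have hmd : 0 ≤ meanDensity K (ρ t) := Finset.sum_nonneg fun k _ =>
      mul_nonneg k.cast_nonneg (integral_nonneg fun u => h.nonneg t ht' k u)
    simp only [add_zero, ← integral_const_mul]
    refine sum_integral_le (g := fun k u => (k : ℝ) * R t k u) (fun k => by fun_prop) fun u => ?_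
    refine (h.sum_mul_rhs_le hφ ht' (fun k => k.cast_nonneg) Nat.mono_cast u).trans ?_
    refine mul_le_of_le_one_right (mul_nonneg hC hmd) ?_
    simpa using h.mass_le t ht' (K + 1) u

/-- Exponential moments are bounded uniformly in the truncation level. -/
theorem IsTruncatedSolution.expMomentBound (hφ : BoundedRates φ C) (hr₀ : IsProfile m r₀)
    {θ Λ : ℝ} (hθ : 0 ≤ θ) (hΛ : ExpMomentBound θ Λ r₀)
    (h : IsTruncatedSolution φ T K r₀ ρ R) {t : ℝ} (ht : t ∈ Set.Icc 0 T) :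
    ExpMomentBound θ
      (Λ * Real.exp (C * (m * Real.exp (C * T)) * (Real.exp θ - 1) * T)) (ρ t) := by
  have hC := hφ.const_nonneg
  have hm := hr₀.const_nonneg
  have hθ1 : 0 ≤ Real.exp θ - 1 := sub_nonneg.2 (Real.one_le_exp hθ)
  set a := C * (m * Real.exp (C * T)) * (Real.exp θ - 1) with ha_def
  have ha : 0 ≤ a := by positivity
  intro n u
  refine (h.sum_range_le ht (fun k => (Real.exp_pos (θ * k)).le) n u).trans ?_
  have hd : ∀ t ∈ Set.Icc 0 T, HasDerivWithinAt
      (fun s => ∑ k ∈ Finset.range (K + 1), Real.exp (θ * k) * ρ s k u)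
      (∑ k ∈ Finset.range (K + 1), Real.exp (θ * k) * R t k u) (Set.Icc 0 T) t := fun t ht =>
    HasDerivWithinAt.fun_sum fun k hk => HasDerivWithinAt.const_mul _
      (hasDerivWithinAt_apply (h.hasDeriv t ht k (Nat.lt_succ_iff.1 (Finset.mem_range.1 hk))) u)
  have key := le_of_deriv_right_le_linear ha le_rfl
    (fun t ht => (hd t ht).continuousWithinAt) (hasDerivWithinAt_Ici_of_Icc hd)
    (fun t ht => ?_) t ht
  · refine key.trans (mul_le_mul ?_ (Real.exp_le_exp.2 (mul_le_mul_of_nonneg_left ht.2 ha))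
      (Real.exp_pos _).le hΛ.nonneg)
    rw [zero_mul, add_zero, Finset.sum_congr rfl fun k hk => by
      rw [h.initial k (Nat.lt_succ_iff.1 (Finset.mem_range.1 hk))]]
    exact hΛ _ u
  · have ht' : t ∈ Set.Icc 0 T := ⟨ht.1, ht.2.le⟩
    have hmono : Monotone fun k : ℕ => Real.exp (θ * k) := fun k l hkl =>
      Real.exp_le_exp.2 (mul_le_mul_of_nonneg_left (by exact_mod_cast hkl) hθ)
    refine (h.sum_mul_rhs_le hφ ht' (fun k => (Real.exp_pos _).le) hmono u).trans ?_
    -- The increments of an exponential weight are proportional to the weight, which closes a linear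
    -- differential inequality for the exponential moment at each fixed `u`.
    have hexp : ∀ k : ℕ, Real.exp (θ * (k + 1 : ℕ)) - Real.exp (θ * k)
        = (Real.exp θ - 1) * Real.exp (θ * k) := fun k => by
      push_cast
      rw [mul_add, mul_one, Real.exp_add]
      ring
    simp only [hexp, mul_assoc (Real.exp θ - 1), ← Finset.mul_sum, add_zero]
    have hS : 0 ≤ ∑ k ∈ Finset.range (K + 1), Real.exp (θ * k) * ρ t k u :=
      Finset.sum_nonneg fun k _ => mul_nonneg (Real.exp_pos _).le (h.nonneg t ht' k u)
    have hmd : meanDensity K (ρ t) ≤ m * Real.exp (C * T) :=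
      (h.meanDensity_le hφ hr₀ ht').trans (mul_le_mul_of_nonneg_left
        (Real.exp_le_exp.2 (mul_le_mul_of_nonneg_left ht'.2 hC)) hm)
    rw [ha_def, mul_assoc (C * _)]
    exact mul_le_mul_of_nonneg_right (mul_le_mul_of_nonneg_left hmd hC) (mul_nonneg hθ1 hS)

end Apriori

end MeanField

namespace MeanField

/-! ### Removing the truncation -/

section Limit

variable {φ : ℕ → ℕ → UnitAddCircle → UnitAddCircle → ℝ} {C : ℝ}
  {r₀ : ℕ → C(UnitAddCircle, ℝ)} {ρ R : ℕ → ℝ → ℕ → C(UnitAddCircle, ℝ)}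

/-- Arithmetic of the competition. In the tail rate `6 * C * T + 3`, the summand `6 * C * T` cancels
the Gronwall factor `exp (6 * C * K * T)`; of the remaining `exp (-3 * K)`, one factor `exp (-K)`
absorbs the polynomial prefactor in the distance bound, and another the Lipschitz constant of order
`K` in the bound for the derivatives. -/
theorem exp_error_le {C T m Λ : ℝ} (hC : 0 ≤ C) (hT : 0 ≤ T) (hm : 0 ≤ m) (hΛ : 0 ≤ Λ) :
    ∃ c D : ℝ, 0 ≤ c ∧ 0 ≤ D ∧ ∀ K : ℕ,
      C * (2 * K + 4) * (Real.exp (-(6 * C * T + 3) * K) * Λ) * T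
          * Real.exp (C * (6 * K + 2 * m) * T) ≤ c * Real.exp (-2 * K) ∧
      C * (6 * K + 2 * m) * (c * Real.exp (-2 * K))
        + C * (2 * K + 4) * (Real.exp (-(6 * C * T + 3) * K) * Λ) ≤ D * Real.exp (-K) ∧
      c * Real.exp (-2 * K) ≤ D * Real.exp (-K) ∧
      Real.exp (-(6 * C * T + 3) * K) * Λ ≤ D * Real.exp (-K) := by
  set c := C * 6 * Λ * T * Real.exp (2 * C * m * T) with hc_def
  have hc : 0 ≤ c := by positivity
  refine ⟨c, C * (6 + 2 * m) * c + C * 6 * Λ + c + Λ, hc, by positivity, fun K => ?_⟩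
  have hK0 : (0 : ℝ) ≤ K := K.cast_nonneg
  have hKe : (K : ℝ) ≤ Real.exp K := natCast_le_exp K
  have h1e : 1 ≤ Real.exp K := Real.one_le_exp hK0
  have hq0 : 0 < Real.exp (-(K : ℝ)) := Real.exp_pos _
  have hq1 : Real.exp (-(K : ℝ)) ≤ 1 := Real.exp_le_one_iff.2 (by linarith)
  have heq : Real.exp K * Real.exp (-(K : ℝ)) = 1 := by rw [← Real.exp_add]; simp
  set q := Real.exp (-(K : ℝ)) with hq_def
  have h2 : Real.exp (-2 * (K : ℝ)) = q ^ 2 := by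
    rw [hq_def, ← Real.exp_nat_mul]; congr 1; push_cast; ring
  have h3 : Real.exp (-3 * (K : ℝ)) = q ^ 3 := by
    rw [hq_def, ← Real.exp_nat_mul]; congr 1; push_cast; ring
  have hKq : (K : ℝ) * q ≤ 1 := by rw [← heq]; exact mul_le_mul_of_nonneg_right hKe hq0.le
  have h24 : (2 * (K : ℝ) + 4) * q ≤ 6 := by linarith
  have h62 : (6 * (K : ℝ) + 2 * m) * q ≤ 6 + 2 * m := by nlinarith
  have hτ : Real.exp (-(6 * C * T + 3) * K) ≤ q ^ 3 := by
    rw [← h3]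
    refine Real.exp_le_exp.2 ?_
    have : 0 ≤ C * T * K := by positivity
    linarith
  have hq3 : q ^ 3 ≤ q := by nlinarith [mul_nonneg hq0.le hq0.le, mul_le_one₀ hq1 hq0.le hq1]
  have hq2 : q ^ 2 ≤ q := by nlinarith
  refine ⟨?_, ?_, ?_, ?_⟩
  · have hexp : Real.exp (-(6 * C * T + 3) * K) * Real.exp (C * (6 * K + 2 * m) * T)
        = q ^ 3 * Real.exp (2 * C * m * T) := by
      rw [← h3, ← Real.exp_add, ← Real.exp_add]; congr 1; ring
    calc C * (2 * K + 4) * (Real.exp (-(6 * C * T + 3) * K) * Λ) * T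
          * Real.exp (C * (6 * K + 2 * m) * T)
        = C * (2 * K + 4) * Λ * T
          * (Real.exp (-(6 * C * T + 3) * K) * Real.exp (C * (6 * K + 2 * m) * T)) := by ring
      _ = C * Λ * T * Real.exp (2 * C * m * T) * q ^ 2 * ((2 * K + 4) * q) := by
          rw [hexp]; ring
      _ ≤ C * Λ * T * Real.exp (2 * C * m * T) * q ^ 2 * 6 :=
          mul_le_mul_of_nonneg_left h24 (by positivity)
      _ = c * Real.exp (-2 * K) := by rw [h2]; ring
  · have e1 : C * (6 * K + 2 * m) * (c * Real.exp (-2 * K)) ≤ C * (6 + 2 * m) * c * q := by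
      rw [h2]
      calc C * (6 * K + 2 * m) * (c * q ^ 2) = C * c * q * ((6 * K + 2 * m) * q) := by ring
        _ ≤ C * c * q * (6 + 2 * m) := mul_le_mul_of_nonneg_left h62 (by positivity)
        _ = _ := by ring
    have e2 : C * (2 * K + 4) * (Real.exp (-(6 * C * T + 3) * K) * Λ) ≤ C * 6 * Λ * q := by
      calc C * (2 * K + 4) * (Real.exp (-(6 * C * T + 3) * K) * Λ)
          ≤ C * (2 * K + 4) * (q ^ 3 * Λ) := by gcongr
        _ = C * Λ * q ^ 2 * ((2 * K + 4) * q) := by ring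
        _ ≤ C * Λ * q ^ 2 * 6 := mul_le_mul_of_nonneg_left h24 (by positivity)
        _ = C * 6 * Λ * q ^ 2 := by ring
        _ ≤ C * 6 * Λ * q := mul_le_mul_of_nonneg_left hq2 (by positivity)
    have e3 : 0 ≤ (c + Λ) * q := by positivity
    linarith
  · rw [h2]
    have e1 : c * q ^ 2 ≤ c * q := mul_le_mul_of_nonneg_left hq2 hc
    have e3 : 0 ≤ (C * (6 + 2 * m) * c + C * 6 * Λ + Λ) * q := by positivity
    linarith
  · have e1 : Real.exp (-(6 * C * T + 3) * K) * Λ ≤ q * Λ :=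
      mul_le_mul_of_nonneg_right (hτ.trans hq3) hΛ
    have e3 : 0 ≤ (C * (6 + 2 * m) * c + C * 6 * Λ + c) * q := by positivity
    linarith

/-- The truncated solutions up to time `T` satisfy uniform tail bounds and form a Cauchy sequence,
at an exponential rate. -/
theorem exists_uniform_bounds (hφ : BoundedRates φ C) (hr0 : ∀ k u, 0 ≤ r₀ k u)
    (hr1 : ∀ n u, ∑ k ∈ Finset.range n, r₀ k u ≤ 1)
    (hΛ : ∀ θ, ∃ Λ, ExpMomentBound θ Λ r₀)
    (hρ : ∀ K : ℕ, IsTruncatedSolution φ K K r₀ (ρ K) (R K)) {T : ℝ} (hT : 0 ≤ T) :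
    ∃ (m D : ℝ) (τ ω : ℕ → ℝ), 0 ≤ D ∧
      (∀ K : ℕ, C * (6 * K + 2 * m) * ω K + C * (2 * K + 4) * τ K ≤ D * Real.exp (-K)) ∧
      (∀ K : ℕ, ω K ≤ D * Real.exp (-K)) ∧ (∀ K : ℕ, τ K ≤ D * Real.exp (-K)) ∧
      ∀ K : ℕ, 1 ≤ K → T ≤ K → ∀ t ∈ Set.Icc 0 T, ∀ K' ≥ K,
        IsProfile m (ρ K' t) ∧ TailBound K (τ K) (ρ K' t) ∧
        ∀ u, ∑ k ∈ Finset.range K, |ρ K t k u - ρ K' t k u| ≤ ω K := by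
  have hC := hφ.const_nonneg
  obtain ⟨Λ₁, hΛ₁⟩ := hΛ 1
  have hprof := hΛ₁.isProfile hr0 hr1
  -- An exponential moment of order `θ` gives tails of rate `θ - 1 = 6 * C * T + 3`, as
  -- `exp_error_le` requires.
  set θ := 6 * C * T + 4 with hθ_def
  have hθ : 1 ≤ θ := by have : 0 ≤ 6 * C * T := by positivity
                        linarith
  obtain ⟨Λ₂, hΛ₂⟩ := hΛ θ
  obtain ⟨m, hm⟩ : ∃ m, m = Λ₁ * Real.exp (C * (Λ₁ * Real.exp (C * T)) * (Real.exp 1 - 1) * T) :=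
    ⟨_, rfl⟩
  obtain ⟨Λ, hΛeq⟩ : ∃ Λ, Λ = Λ₂ * Real.exp
    (C * (Λ₁ * Real.exp (C * T)) * (Real.exp θ - 1) * T) := ⟨_, rfl⟩
  have hm0 : 0 ≤ m := hm ▸ mul_nonneg hΛ₁.nonneg (Real.exp_pos _).le
  have hΛ0 : 0 ≤ Λ := hΛeq ▸ mul_nonneg hΛ₂.nonneg (Real.exp_pos _).le
  obtain ⟨c, D, hc, hD, hcD⟩ := exp_error_le hC hT hm0 hΛ0
  refine ⟨m, D, fun K => Real.exp (-(6 * C * T + 3) * K) * Λ, fun K => c * Real.exp (-2 * K), hD,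
    fun K => (hcD K).2.1, fun K => (hcD K).2.2.1, fun K => (hcD K).2.2.2, ?_⟩
  have hsol : ∀ K : ℕ, T ≤ K → IsTruncatedSolution φ T K r₀ (ρ K) (R K) := fun K hK =>
    (hρ K).mono hK
  have hP : ∀ K : ℕ, T ≤ K → ∀ t ∈ Set.Icc 0 T, IsProfile m (ρ K t) := fun K hK t ht => by
    have h := (hsol K hK).expMomentBound hφ hprof zero_le_one hΛ₁ ht
    rw [← hm] at h
    exact h.isProfile ((hsol K hK).nonneg t ht) ((hsol K hK).mass_le t ht)
  have hTail : ∀ K K' : ℕ, T ≤ K → T ≤ K' → ∀ t ∈ Set.Icc 0 T,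
      TailBound K (Real.exp (-(6 * C * T + 3) * K) * Λ) (ρ K' t) := fun K K' hK hK' t ht => by
    have h := (hsol K' hK').expMomentBound hφ hprof (zero_le_one.trans hθ) hΛ₂ ht
    rw [← hΛeq] at h
    have h' := h.tailBound hθ ((hsol K' hK').nonneg t ht) K
    rwa [show θ - 1 = 6 * C * T + 3 by rw [hθ_def]; ring] at h'
  intro K hK1 hKT t ht K' hKK'
  have hKT' : T ≤ K' := hKT.trans (by exact_mod_cast hKK')
  refine ⟨hP K' hKT' t ht, hTail K K' hKT hKT' t ht, fun u => ?_⟩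
  refine (hφ.sum_abs_sub_le hK1 ((hsol K hKT).isSolutionOn (Nat.le_succ K))
    ((hsol K' hKT').isSolutionOn (hKK'.trans (Nat.le_succ K'))) (fun k hk u => ?_)
    (hP K hKT) (hP K' hKT') (hTail K K hKT hKT) (hTail K K' hKT hKT') ht u).trans ?_
  · rw [(hρ K).initial k hk.le, (hρ K').initial k (hk.le.trans hKK')]
  · refine le_trans ?_ (hcD K).1
    have h1 : C * (6 * K + 2 * m) * t ≤ C * (6 * K + 2 * m) * T :=
      mul_le_mul_of_nonneg_left ht.2 (by positivity)
    have h2 : 0 ≤ C * (2 * K + 4) * (Real.exp (-(6 * C * T + 3) * K) * Λ) := by positivity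
    exact mul_le_mul (mul_le_mul_of_nonneg_left ht.2 h2) (Real.exp_le_exp.2 h1)
      (Real.exp_pos _).le (mul_nonneg h2 hT)

theorem tendsto_const_mul_exp_neg (D : ℝ) :
    Tendsto (fun K : ℕ => D * Real.exp (-K)) atTop (𝓝 0) := by
  have := (Real.tendsto_exp_neg_atTop_nhds_zero.comp
    (tendsto_natCast_atTop_atTop (R := ℝ))).const_mul D
  simpa using this

/-- The truncated solutions converge, together with their time derivatives. -/
theorem exists_limit (hφ : BoundedRates φ C) (hr0 : ∀ k u, 0 ≤ r₀ k u)
    (hr1 : ∀ n u, ∑ k ∈ Finset.range n, r₀ k u ≤ 1)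
    (hΛ : ∀ θ, ∃ Λ, ExpMomentBound θ Λ r₀)
    (hρ : ∀ K : ℕ, IsTruncatedSolution φ K K r₀ (ρ K) (R K)) :
    ∃ g : ℝ≥0 → ℕ → C(UnitAddCircle, ℝ),
      (∀ (t : ℝ≥0) (k : ℕ), Tendsto (fun K => ρ K t k) atTop (𝓝 (g t k))) ∧
      ∀ T : ℝ≥0, ∃ D m : ℝ, ∃ τ : ℕ → ℝ, (∀ K : ℕ, τ K ≤ D * Real.exp (-K)) ∧
        ∀ K : ℕ, 1 ≤ K → T ≤ K → ∀ t ≤ T,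
          IsProfile m (g t) ∧ TailBound K (τ K) (g t) ∧ ∀ k < K, ∀ u,
            |R K t k u - meanFieldRHS φ (g t) k u| ≤ D * Real.exp (-K) := by
  have hlim : ∀ (t : ℝ≥0) (k : ℕ), ∃ g, Tendsto (fun K => ρ K t k) atTop (𝓝 g) := by
    intro t k
    obtain ⟨m, D, τ, ω, hD, -, hω, -, hmain⟩ := exists_uniform_bounds hφ hr0 hr1 hΛ hρ t.2
    obtain ⟨K₀, hK₀⟩ := exists_nat_ge (t : ℝ)
    -- The shift ensures that level `k` lies below the cutoff and that time `t` lies in the interval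
    -- `[0, K]` on which the solution with cutoff `K` is defined.
    have hcs : CauchySeq fun n => ρ (n + (K₀ + k + 1)) t k := by
      refine cauchySeq_of_le_tendsto_0' (fun n : ℕ => D * Real.exp (-(n + (K₀ + k + 1) : ℕ)))
        (fun n n' hnn' => ?_)
        ((tendsto_add_atTop_iff_nat _).2 (tendsto_const_mul_exp_neg D))
      rw [dist_eq_norm, ContinuousMap.norm_le _ (by positivity)]
      intro u
      have hle : (t : ℝ) ≤ (n + (K₀ + k + 1) : ℕ) := hK₀.trans (by exact_mod_cast (by omega))
      have h := (hmain (n + (K₀ + k + 1)) (by omega) hle t ⟨t.2, le_rfl⟩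
        (n' + (K₀ + k + 1)) (by omega)).2.2 u
      refine le_trans ?_ (h.trans (hω _))
      exact Finset.single_le_sum (f := fun j => |ρ (n + (K₀ + k + 1)) t j u
        - ρ (n' + (K₀ + k + 1)) t j u|) (fun j _ => abs_nonneg _)
        (Finset.mem_range.2 (by omega : k < n + (K₀ + k + 1)))
    obtain ⟨g, hg⟩ := cauchySeq_tendsto_of_complete hcs
    exact ⟨g, (tendsto_add_atTop_iff_nat _).1 hg⟩
  choose g hg using hlim
  have hgu : ∀ (t : ℝ≥0) k u, Tendsto (fun K => ρ K t k u) atTop (𝓝 (g t k u)) := fun t k u =>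
    ((continuous_eval_const u).tendsto _).comp (hg t k)
  refine ⟨g, hg, fun T => ?_⟩
  obtain ⟨m, D, τ, ω, hD, herr, hω, hτ, hmain⟩ := exists_uniform_bounds hφ hr0 hr1 hΛ hρ T.2
  refine ⟨D, m, τ, hτ, fun K hK1 hKT t ht => ?_⟩
  have htT : (t : ℝ) ∈ Set.Icc 0 (T : ℝ) := ⟨t.2, ht⟩
  have hKT' : (T : ℝ) ≤ K := by exact_mod_cast hKT
  have hm := hmain K hK1 hKT' t htT
  have hsum : ∀ (s : Finset ℕ) (w : ℕ → ℝ) (u : UnitAddCircle),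
      Tendsto (fun K' => ∑ k ∈ s, w k * ρ K' t k u) atTop (𝓝 (∑ k ∈ s, w k * g t k u)) :=
    fun s w u => tendsto_finsetSum s fun k _ => (hgu t k u).const_mul (w k)
  have hP : IsProfile m (g t) :=
    { nonneg := fun k u => ge_of_tendsto (hgu t k u)
        ((eventually_ge_atTop K).mono fun K' hK' => (hm K' hK').1.nonneg k u)
      mass_le := fun n u => by
        have := hsum (Finset.range n) (fun _ => 1) u
        simp only [one_mul] at this
        exact le_of_tendsto this
          ((eventually_ge_atTop K).mono fun K' hK' => (hm K' hK').1.mass_le n u)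
      moment_le := fun n u => le_of_tendsto (hsum (Finset.range n) (fun k => k) u)
        ((eventually_ge_atTop K).mono fun K' hK' => (hm K' hK').1.moment_le n u) }
  have hTail : TailBound K (τ K) (g t) := fun n u =>
    le_of_tendsto (hsum (Finset.Ico K n) (fun k => k) u)
      ((eventually_ge_atTop K).mono fun K' hK' => (hm K' hK').2.1 n u)
  have hdiff : ∀ u, ∑ k ∈ Finset.range K, |ρ K t k u - g t k u| ≤ ω K := fun u =>
    le_of_tendsto (tendsto_finsetSum _ fun k _ => ((hgu t k u).const_sub _).abs)
      ((eventually_ge_atTop K).mono fun K' hK' => (hm K' hK').2.2 u)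
  refine ⟨hP, hTail, fun k hk u => ?_⟩
  rw [(hρ K).rhs t ⟨t.2, (htT.2).trans hKT'⟩ k hk.le u]
  -- The Lipschitz estimate applies to the limit as well, since it inherits the moment and tail
  -- bounds. Hence the derivatives converge at an exponential rate, uniformly in `u` and in `t ≤ T`.
  have h := hφ.sum_abs_meanFieldRHS_sub_le (hm K le_rfl).1 hP (hm K le_rfl).2.1 hTail hK1 hdiff u
  refine le_trans ?_ (h.trans (herr K))
  exact Finset.single_le_sum
    (f := fun k => |meanFieldRHS φ (ρ K t) k u - meanFieldRHS φ (g t) k u|)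
    (fun k _ => abs_nonneg _) (Finset.mem_range.2 hk)

/-- A solution of the mean field equation as a differentiable curve in `C(𝕋)` at each level, with
locally bounded exponential moments. -/
structure IsRegularSolution (φ : ℕ → ℕ → UnitAddCircle → UnitAddCircle → ℝ)
    (r₀ : ℕ → C(UnitAddCircle, ℝ)) (ρ R : ℝ≥0 → ℕ → C(UnitAddCircle, ℝ)) : Prop where
  hasDeriv : ∀ (t : ℝ≥0) (k : ℕ),
    HasDerivWithinAt (fun s : ℝ => ρ s.toNNReal k) (R t k) (Set.Ici 0) t
  rhs : ∀ t k u, R t k u = meanFieldRHS φ (ρ t) k u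
  initial : ∀ k, ρ 0 k = r₀ k
  nonneg : ∀ t k u, 0 ≤ ρ t k u
  mass : ∀ t u, HasSum (fun k => ρ t k u) 1
  expMoment : ∀ (T : ℝ≥0) (θ : ℝ), ∃ Λ, ∀ t ≤ T, ExpMomentBound θ Λ (ρ t)

/-- The right-hand side at the limit is a uniform limit of the continuous functions `R K t k`, so it
is a continuous curve in `C(𝕋)`. The integrated equation passes to the limit, and the fundamental
theorem of calculus gives the differential equation back. Exponential moments survive pointwise
limits of finite sums. -/
theorem exists_isRegularSolution (hφ : BoundedRates φ C) (hr0 : ∀ k u, 0 ≤ r₀ k u)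
    (hr1 : ∀ u, HasSum (fun k => r₀ k u) 1) (hΛ : ∀ θ, ∃ Λ, ExpMomentBound θ Λ r₀) :
    ∃ ρ R, IsRegularSolution φ r₀ ρ R := by
  have hr1' : ∀ n u, ∑ k ∈ Finset.range n, r₀ k u ≤ 1 := fun n u =>
    sum_le_hasSum _ (fun k _ => hr0 k u) (hr1 u)
  obtain ⟨Λ₁, hΛ₁⟩ := hΛ 1
  have hprof := hΛ₁.isProfile hr0 hr1'
  -- The solution with cutoff `K` is taken on `[0, K]`, so one sequence serves every time horizon.
  have hex : ∀ K : ℕ, ∃ ρ R, IsTruncatedSolution φ K K r₀ ρ R := fun K =>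
    exists_isTruncatedSolution hφ hprof K K.cast_nonneg
  choose ρ R hρ using hex
  obtain ⟨g, hg, hmain⟩ := exists_limit hφ hr0 hr1' hΛ hρ
  have hgu : ∀ (t : ℝ≥0) k u, Tendsto (fun K => ρ K t k u) atTop (𝓝 (g t k u)) := fun t k u =>
    ((continuous_eval_const u).tendsto _).comp (hg t k)
  have hRcont : ∀ t k, Continuous (meanFieldRHS φ (g t) k) := by
    intro t k
    obtain ⟨D, m, τ, -, h⟩ := hmain t
    obtain ⟨K₀, hK₀⟩ := exists_nat_ge t
    refine TendstoUniformly.continuous (F := fun K : ℕ => ⇑(R K t k)) (p := atTop) ?_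
      (Frequently.of_forall fun K => (R K t k).continuous)
    rw [Metric.tendstoUniformly_iff]
    intro ε hε
    filter_upwards [(tendsto_const_mul_exp_neg D).eventually_lt_const hε,
      eventually_ge_atTop (K₀ + k + 1)] with K hK hK'
    intro u
    rw [dist_comm, Real.dist_eq]
    exact ((h K (by omega) (hK₀.trans (by exact_mod_cast (by omega))) t le_rfl).2.2 k
      (by omega) u).trans_lt hK
  obtain ⟨S, hS⟩ : ∃ S : ℝ≥0 → ℕ → C(UnitAddCircle, ℝ), ∀ t k u,
      S t k u = meanFieldRHS φ (g t) k u := ⟨fun t k => ⟨_, hRcont t k⟩, fun _ _ _ => rfl⟩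
  have hRS : ∀ (T : ℝ≥0), ∃ D : ℝ, 0 ≤ D ∧ ∀ k K : ℕ, k < K → T ≤ K → ∀ t ≤ T,
      ‖R K t k - S t k‖ ≤ D * Real.exp (-K) := by
    intro T
    obtain ⟨D, m, τ, -, h⟩ := hmain T
    refine ⟨|D|, abs_nonneg D, fun k K hk hK t ht => ?_⟩
    rw [ContinuousMap.norm_le _ (by positivity)]
    intro u
    rw [ContinuousMap.sub_apply, hS, Real.norm_eq_abs]
    exact ((h K (by omega) hK t ht).2.2 k hk u).trans
      (mul_le_mul_of_nonneg_right (le_abs_self D) (Real.exp_pos _).le)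
  have hScont : ∀ k, Continuous fun t : ℝ => S t.toNNReal k := by
    intro k
    rw [continuous_iff_continuousAt]
    intro t₀
    obtain ⟨D, hD, h⟩ := hRS (t₀ + 1).toNNReal
    obtain ⟨K₀, hK₀⟩ := exists_nat_ge (t₀ + 1).toNNReal
    -- Uniform convergence is used on an open half-line around `t₀`; negative times cause no
    -- trouble, as `toNNReal` sends them to zero.
    have hU : TendstoUniformlyOn (fun (K : ℕ) (t : ℝ) => R K t.toNNReal k)
        (fun t => S t.toNNReal k) atTop (Set.Iio (t₀ + 1)) := by
      rw [Metric.tendstoUniformlyOn_iff]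
      intro ε hε
      filter_upwards [(tendsto_const_mul_exp_neg D).eventually_lt_const hε,
        eventually_ge_atTop (K₀ + k + 1)] with K hK hK' t ht
      rw [dist_comm, dist_eq_norm]
      refine (h k K (by omega) (hK₀.trans (by exact_mod_cast (by omega))) t.toNNReal
        (Real.toNNReal_le_toNNReal (le_of_lt ht))).trans_lt hK
    refine (hU.continuousOn (Eventually.frequently ?_)).continuousAt
      (Iio_mem_nhds (by linarith))
    filter_upwards [eventually_ge_atTop (K₀ + k + 1)] with K hK
    refine ((hρ K).continuousOn k (by omega)).comp
      (continuous_real_toNNReal.subtype_val.continuousOn) fun t ht => ⟨(t.toNNReal).2, ?_⟩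
    have h1 : t.toNNReal ≤ (K : ℝ≥0) := (Real.toNNReal_le_toNNReal (le_of_lt ht)).trans
      (hK₀.trans (by exact_mod_cast (by omega)))
    exact_mod_cast h1
  have hFTC : ∀ (t : ℝ≥0) k, g t k = r₀ k + ∫ s in (0 : ℝ)..t, S s.toNNReal k := by
    intro t k
    obtain ⟨D, hD, h⟩ := hRS t
    obtain ⟨K₀, hK₀⟩ := exists_nat_ge t
    refine tendsto_nhds_unique (hg t k) (tendsto_iff_norm_sub_tendsto_zero.2 ?_)
    refine squeeze_zero' (Eventually.of_forall fun _ => norm_nonneg _) ?_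
      (tendsto_const_mul_exp_neg (D * t))
    filter_upwards [eventually_ge_atTop (K₀ + k + 1)] with K hK
    have htK : t ≤ (K : ℝ≥0) := hK₀.trans (by exact_mod_cast (by omega))
    have htK' : (t : ℝ) ≤ K := by exact_mod_cast htK
    have hsub : Set.Icc 0 (t : ℝ) ⊆ Set.Icc 0 (K : ℝ) := Set.Icc_subset_Icc_right htK'
    have hRint : IntervalIntegrable (fun s => R K s k) volume 0 t :=
      (((hρ K).continuousOn k (by omega)).mono
        (by rw [Set.uIcc_of_le t.coe_nonneg]; exact hsub)).intervalIntegrable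
    have hint : ∫ s in (0 : ℝ)..t, R K s k = ρ K t k - ρ K 0 k := by
      refine intervalIntegral.integral_eq_sub_of_hasDeriv_right
        (f := fun s => ρ K s k) (fun s hs => ?_) (fun s hs => ?_) hRint
      · rw [Set.uIcc_of_le t.coe_nonneg] at hs ⊢
        exact (((hρ K).hasDeriv s (hsub hs) k (by omega)).continuousWithinAt).mono hsub
      · rw [min_eq_left t.coe_nonneg, max_eq_right t.coe_nonneg] at hs
        have hs' : s ∈ Set.Icc 0 (K : ℝ) := hsub ⟨hs.1.le, hs.2.le⟩
        exact (((hρ K).hasDeriv s hs' k (by omega)).hasDerivAt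
          (Icc_mem_nhds hs.1 (hs.2.trans_le htK'))).hasDerivWithinAt
    rw [(hρ K).initial k (by omega)] at hint
    have heq : ρ K t k - (r₀ k + ∫ s in (0 : ℝ)..t, S s.toNNReal k)
        = ∫ s in (0 : ℝ)..t, (R K s k - S s.toNNReal k) := by
      rw [intervalIntegral.integral_sub hRint ((hScont k).intervalIntegrable _ _), hint]
      abel
    rw [heq]
    refine (intervalIntegral.norm_integral_le_of_norm_le_const (C := D * Real.exp (-K))
      fun s hs => ?_).trans_eq ?_
    · rw [Set.uIoc_of_le t.coe_nonneg] at hs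
      have h1 := h k K (by omega) htK s.toNNReal (Real.toNNReal_le_iff_le_coe.2 hs.2)
      rwa [Real.coe_toNNReal s hs.1.le] at h1
    · rw [sub_zero, abs_of_nonneg t.coe_nonneg]; ring
  have hderiv : ∀ (t : ℝ≥0) (k : ℕ),
      HasDerivWithinAt (fun s : ℝ => g s.toNNReal k) (S t k) (Set.Ici 0) t := by
    intro t k
    have h1 := ((hScont k).integral_hasStrictDerivAt 0 (t : ℝ)).hasDerivAt.const_add (r₀ k)
    rw [Real.toNNReal_coe] at h1
    refine h1.hasDerivWithinAt.congr (fun s hs => ?_) ?_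
    · rw [hFTC, Real.coe_toNNReal s hs]
    · rw [hFTC, Real.toNNReal_coe]
  have hinit : ∀ k, g 0 k = r₀ k := fun k => by rw [hFTC]; simp
  have hnn : ∀ t k u, 0 ≤ g t k u := fun t k u => by
    obtain ⟨D, m, τ, -, h⟩ := hmain t
    obtain ⟨K₀, hK₀⟩ := exists_nat_ge t
    exact (h (K₀ + 1) (by omega) (hK₀.trans (by exact_mod_cast (by omega))) t
      le_rfl).1.nonneg k u
  refine ⟨g, S, hderiv, hS, hinit, hnn, fun t u => ?_, fun T θ => ?_⟩
  · rw [hasSum_iff_tendsto_nat_of_nonneg fun k => hnn t k u]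
    obtain ⟨D, m, τ, hτ, h⟩ := hmain t
    obtain ⟨K₀, hK₀⟩ := exists_nat_ge t
    have hC := hφ.const_nonneg
    have h2 := (hasSum_iff_tendsto_nat_of_nonneg (fun k => hr0 k u) 1).1 (hr1 u)
    rw [← tendsto_add_atTop_iff_nat 1] at h2 ⊢
    have hm0 : 0 ≤ m := (h (K₀ + 1) (by omega) (hK₀.trans (by exact_mod_cast (by omega))) t
      le_rfl).1.const_nonneg
    -- By summation by parts with weight one, the mass of the levels up to `n` changes only through
    -- the two fluxes between `n` and `n + 1`. The tail bounds make both exponentially small in `n`,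
    -- so no mass escapes to infinity.
    have h3 : Tendsto (fun n : ℕ => (∑ k ∈ Finset.range (n + 1), g t k u)
        - ∑ k ∈ Finset.range (n + 1), r₀ k u) atTop (𝓝 0) := by
      have hb : Tendsto (fun n : ℕ => (C * (D * Real.exp (-(n + 1 : ℕ)))
          + C * m * (D * Real.exp (-n))) * t) atTop (𝓝 ((C * 0 + C * m * 0) * t)) :=
        ((((tendsto_add_atTop_iff_nat 1).2 (tendsto_const_mul_exp_neg D)).const_mul C).add
          ((tendsto_const_mul_exp_neg D).const_mul (C * m))).mul_const _
      simp only [mul_zero, add_zero, zero_mul] at hb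
      refine squeeze_zero_norm' ?_ hb
      filter_upwards [eventually_ge_atTop (K₀ + 1)] with n hn
      have hd : ∀ s ∈ Set.Icc 0 (t : ℝ), HasDerivWithinAt
          (fun s : ℝ => ∑ k ∈ Finset.range (n + 1), g s.toNNReal k u)
          (∑ k ∈ Finset.range (n + 1), meanFieldRHS φ (g s.toNNReal) k u)
          (Set.Icc 0 (t : ℝ)) s := fun s hs => HasDerivWithinAt.fun_sum fun k _ => by
        have h4 := (hderiv s.toNNReal k).mono
          (Set.Icc_subset_Ici_self : Set.Icc 0 (t : ℝ) ⊆ Set.Ici 0)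
        rw [Real.coe_toNNReal s hs.1] at h4
        rw [← hS]
        exact hasDerivWithinAt_apply h4 u
      have hbound : ∀ s ∈ Set.Icc 0 (t : ℝ),
          ‖∑ k ∈ Finset.range (n + 1), meanFieldRHS φ (g s.toNNReal) k u‖
            ≤ C * (D * Real.exp (-(n + 1 : ℕ))) + C * m * (D * Real.exp (-n)) := by
        intro s hs
        have hst : s.toNNReal ≤ t := Real.toNNReal_le_iff_le_coe.2 hs.2
        obtain ⟨hP, hT1, -⟩ := h (n + 1) (by omega) (hK₀.trans (by exact_mod_cast (by omega)))
          s.toNNReal hst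
        obtain ⟨-, hT0, -⟩ := h n (by omega) (hK₀.trans (by exact_mod_cast (by omega)))
          s.toNNReal hst
        have hsum := hφ.sum_mul_meanFieldRHS (r := g s.toNNReal) (fun _ => 1) n u
        simp only [one_mul, sub_self, mul_zero, Finset.sum_const_zero, zero_add] at hsum
        rw [hsum]
        have hDm := hφ.departure_mem hP (n + 1) u
        have hAm := hφ.arrival_mem hP n u
        have hn1 : (1 : ℝ) ≤ n := by exact_mod_cast (by omega : 1 ≤ n)
        have f1 : g s.toNNReal (n + 1) u * departureRate φ (g s.toNNReal) (n + 1) u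
            ≤ C * (D * Real.exp (-(n + 1 : ℕ))) := by
          calc g s.toNNReal (n + 1) u * departureRate φ (g s.toNNReal) (n + 1) u
              ≤ g s.toNNReal (n + 1) u * (C * (n + 1 : ℕ)) :=
                mul_le_mul_of_nonneg_left hDm.2 (hnn _ _ _)
            _ = C * ((n + 1 : ℕ) * g s.toNNReal (n + 1) u) := by ring
            _ ≤ C * (D * Real.exp (-(n + 1 : ℕ))) :=
                mul_le_mul_of_nonneg_left ((hT1.level_le u).trans (hτ _)) hC
        have f2 : g s.toNNReal n u * arrivalRate φ (g s.toNNReal) n u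
            ≤ C * m * (D * Real.exp (-n)) := by
          calc g s.toNNReal n u * arrivalRate φ (g s.toNNReal) n u
              ≤ g s.toNNReal n u * (C * m) := mul_le_mul_of_nonneg_left hAm.2 (hnn _ _ _)
            _ ≤ (n * g s.toNNReal n u) * (C * m) := by
                refine mul_le_mul_of_nonneg_right ?_ (mul_nonneg hC hm0)
                exact le_mul_of_one_le_left (hnn _ _ _) hn1
            _ = C * m * (n * g s.toNNReal n u) := by ring
            _ ≤ C * m * (D * Real.exp (-n)) :=
                mul_le_mul_of_nonneg_left ((hT0.level_le u).trans (hτ _)) (mul_nonneg hC hm0)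
        have g1 := mul_nonneg (hnn s.toNNReal (n + 1) u) hDm.1
        have g2 := mul_nonneg (hnn s.toNNReal n u) hAm.1
        rw [Real.norm_eq_abs, abs_le]
        constructor <;> linarith
      have := (convex_Icc 0 (t : ℝ)).norm_image_sub_le_of_norm_hasDerivWithin_le hd hbound
        (Set.left_mem_Icc.2 t.coe_nonneg) (Set.right_mem_Icc.2 t.coe_nonneg)
      simpa [hinit, abs_of_nonneg t.coe_nonneg] using this
    simpa using h3.add h2
  -- The a priori estimate needs a nonnegative exponent; for negative `θ` the exponent zero
  -- dominates.
  · obtain ⟨Λ, hΛ'⟩ := hΛ (max θ 0)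
    refine ⟨Λ * Real.exp (C * (Λ₁ * Real.exp (C * T)) * (Real.exp (max θ 0) - 1) * T),
      fun t ht n u => le_of_tendsto (tendsto_finsetSum _ fun k _ =>
      (hgu t k u).const_mul (Real.exp (θ * k))) ?_⟩
    · obtain ⟨K₀, hK₀⟩ := exists_nat_ge T
      filter_upwards [eventually_ge_atTop K₀] with K hK
      have hTK : T ≤ (K : ℝ≥0) := hK₀.trans (by exact_mod_cast hK)
      have hsol := (hρ K).mono (T' := T) (by exact_mod_cast hTK)
      have htT : (t : ℝ) ∈ Set.Icc 0 (T : ℝ) := ⟨t.coe_nonneg, ht⟩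
      refine le_trans (Finset.sum_le_sum fun k _ => ?_)
        (hsol.expMomentBound hφ hprof (le_max_right θ 0) hΛ' htT n u)
      exact mul_le_mul_of_nonneg_right (Real.exp_le_exp.2
        (mul_le_mul_of_nonneg_right (le_max_left θ 0) k.cast_nonneg)) (hsol.nonneg t htT k u)

end Limit

end MeanField

namespace MeanField

/-! ### Superexponential tails on the logarithmic scale -/

theorem log_ofReal_exp (x : ℝ) : ENNReal.log (ENNReal.ofReal (Real.exp x)) = (x : EReal) := by
  rw [ENNReal.log_ofReal_of_pos (Real.exp_pos x), Real.log_exp]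

theorem coe_inv_mul_log_ofReal_exp {M : ℕ} (hM : 1 ≤ M) (a : ℝ) :
    ((1 / (M : ℝ) : ℝ) : EReal) * ENNReal.log (ENNReal.ofReal (Real.exp (-a * M)))
      = ((-a : ℝ) : EReal) := by
  have hM0 : (M : ℝ) ≠ 0 := by positivity
  rw [log_ofReal_exp, ← EReal.coe_mul]
  congr 1
  field_simp

theorem inv_mul_log_le {M : ℕ} (hM : 1 ≤ M) {a : ℝ} {S : ℝ≥0∞}
    (h : S ≤ ENNReal.ofReal (Real.exp (-a * M))) :
    ((1 / (M : ℝ) : ℝ) : EReal) * ENNReal.log S ≤ ((-a : ℝ) : EReal) := by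
  rw [← coe_inv_mul_log_ofReal_exp hM a]
  exact mul_le_mul_of_nonneg_left (ENNReal.log_monotone h)
    (EReal.coe_nonneg.2 (by positivity))

theorem le_ofReal_exp_of_inv_mul_log_lt {M : ℕ} (hM : 1 ≤ M) {a : ℝ} {S : ℝ≥0∞}
    (h : ((1 / (M : ℝ) : ℝ) : EReal) * ENNReal.log S < ((-a : ℝ) : EReal)) :
    S ≤ ENNReal.ofReal (Real.exp (-a * M)) := by
  by_contra hS
  refine absurd h (not_lt.2 ?_)
  rw [← coe_inv_mul_log_ofReal_exp hM a]
  exact mul_le_mul_of_nonneg_left (ENNReal.log_monotone (not_le.1 hS).le)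
    (EReal.coe_nonneg.2 (by positivity))

/-! ### Existence and uniqueness -/

section Poisson

variable {ψ : UnitAddCircle → ℝ}

/-- The Poisson profile `e^{-ψ} ψ^k / k!`. -/
noncomputable def poissonProfile (hψ : Continuous ψ) (k : ℕ) : C(UnitAddCircle, ℝ) where
  toFun u := Real.exp (- ψ u) * ψ u ^ k / (k.factorial : ℝ)
  continuous_toFun := by fun_prop

theorem poissonProfile_apply (hψ : Continuous ψ) (k : ℕ) (u : UnitAddCircle) :
    poissonProfile hψ k u = Real.exp (- ψ u) * ψ u ^ k / (k.factorial : ℝ) := rfl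

theorem poissonProfile_nonneg (hψ : Continuous ψ) (hψ0 : ∀ u, 0 < ψ u) (k : ℕ)
    (u : UnitAddCircle) : 0 ≤ poissonProfile hψ k u := by
  have := hψ0 u
  rw [poissonProfile_apply]
  positivity

theorem hasSum_poissonProfile (hψ : Continuous ψ) (hψ0 : ∀ u, 0 < ψ u) (u : UnitAddCircle) :
    HasSum (fun k => poissonProfile hψ k u) 1 := by
  have := hasSum_one_poissonMeasure (ψ u).toNNReal
  rwa [Real.coe_toNNReal _ (hψ0 u).le] at this

theorem exists_forall_le_of_continuous (hψ : Continuous ψ) : ∃ B, ∀ u, ψ u ≤ B := by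
  obtain ⟨u, -, hu⟩ := isCompact_univ.exists_isMaxOn Set.univ_nonempty hψ.continuousOn
  exact ⟨ψ u, fun v => hu (Set.mem_univ v)⟩

/-- The Poisson moment generating function is `exp ((exp θ - 1) * ψ u)`. Dropping `exp (-ψ u) ≤ 1`
leaves a bound that is uniform because `ψ` is bounded. -/
theorem exists_expMomentBound_poissonProfile (hψ : Continuous ψ) (hψ0 : ∀ u, 0 < ψ u) (θ : ℝ) :
    ∃ Λ, ExpMomentBound θ Λ (poissonProfile hψ) := by
  obtain ⟨B, hB⟩ := exists_forall_le_of_continuous hψ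
  refine ⟨Real.exp (Real.exp θ * B), fun n u => ?_⟩
  have h0 := hψ0 u
  calc ∑ k ∈ Finset.range n, Real.exp (θ * k) * poissonProfile hψ k u
      = Real.exp (- ψ u) * ∑ k ∈ Finset.range n, (Real.exp θ * ψ u) ^ k / (k.factorial : ℝ) := by
        rw [Finset.mul_sum]
        refine Finset.sum_congr rfl fun k _ => ?_
        rw [poissonProfile_apply, mul_pow, ← Real.exp_nat_mul, mul_comm (k : ℝ) θ]
        ring
    _ ≤ 1 * Real.exp (Real.exp θ * ψ u) :=
        mul_le_mul (Real.exp_le_one_iff.2 (by linarith))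
          (Real.sum_le_exp_of_nonneg (by positivity) n)
          (Finset.sum_nonneg fun k _ => by positivity) zero_le_one
    _ ≤ Real.exp (Real.exp θ * B) := by
        rw [one_mul]
        exact Real.exp_le_exp.2 (mul_le_mul_of_nonneg_left (hB u) (Real.exp_pos θ).le)

end Poisson

section ExistsUnique

variable {φ : ℕ → ℕ → UnitAddCircle → UnitAddCircle → ℝ} {C : ℝ} {ψ : UnitAddCircle → ℝ}

theorem tsum_ofReal_le {a : ℕ → ℝ} {Λ : ℝ} (ha : ∀ l, 0 ≤ a l)
    (h : ∀ n, ∑ l ∈ Finset.range n, a l ≤ Λ) : ∑' l, ENNReal.ofReal (a l) ≤ ENNReal.ofReal Λ :=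
  ENNReal.tsum_le_of_sum_range_le fun n => by
    rw [← ENNReal.ofReal_sum_of_nonneg fun l _ => ha l]
    exact ENNReal.ofReal_le_ofReal (h n)

theorem IsRegularSolution.isMeanFieldSolution (hψ : Continuous ψ)
    {ρ R : ℝ≥0 → ℕ → C(UnitAddCircle, ℝ)}
    (h : IsRegularSolution φ (poissonProfile hψ) ρ R) : IsMeanFieldSolution φ ψ ρ where
  equation t k u := by
    rw [← h.rhs]
    exact hasDerivWithinAt_apply (h.hasDeriv t k) u
  initial k u := by rw [h.initial, poissonProfile_apply]
  nonneg := h.nonneg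
  mass := h.mass
  moments T r hr := by
    -- The exponent 2 serves both moments, since `l` and `l ^ 2` are at most `exp (2 * l)`.
    obtain ⟨Λ, hΛ⟩ := h.expMoment T 2
    refine lt_of_le_of_lt (iSup₂_le fun t ht => iSup_le fun u => tsum_ofReal_le
      (Λ := Λ) (fun l => mul_nonneg (by positivity) (h.nonneg t l u)) fun n => ?_)
      ENNReal.ofReal_lt_top
    refine le_trans (Finset.sum_le_sum fun l _ => ?_) (hΛ t ht n u)
    refine mul_le_mul_of_nonneg_right ?_ (h.nonneg t l u)
    have h1 : (l : ℝ) ≤ Real.exp l := natCast_le_exp l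
    have h2 : (1 : ℝ) ≤ Real.exp l := Real.one_le_exp l.cast_nonneg
    have h3 : Real.exp (2 * (l : ℝ)) = Real.exp l ^ 2 := by
      rw [← Real.exp_nat_mul]; norm_num
    rw [h3]
    rcases hr with rfl | rfl
    · rw [pow_one]; nlinarith
    · exact pow_le_pow_left₀ l.cast_nonneg h1 2
  tails T := by
    rw [EReal.eq_bot_iff_forall_lt]
    intro y
    obtain ⟨a, ha0, hay⟩ : ∃ a : ℝ, 0 ≤ a ∧ -a < y :=
      ⟨|y| + 1, by positivity, by linarith [neg_abs_le y]⟩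
    refine lt_of_le_of_lt ?_ (EReal.coe_lt_coe_iff.2 hay)
    -- The tail is at most `Λ * exp (-(a + 1) * M)`, and `Λ ≤ exp M` once `M ≥ Λ`; this leaves `exp
    -- (-a * M)` exactly.
    obtain ⟨Λ, hΛ⟩ := h.expMoment T (a + 2)
    refine limsup_le_of_le (h := ?_)
    filter_upwards [eventually_ge_atTop 1, eventually_ge_atTop ⌈Λ⌉₊] with M hM1 hMΛ
    refine inv_mul_log_le hM1 (iSup₂_le fun t ht => iSup_le fun u => ?_)
    refine (tsum_subtype {l : ℕ | M ≤ l}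
      fun l : ℕ => ENNReal.ofReal ((l : ℝ) * ρ t l u)).trans_le ?_
    have hind : ∀ l : ℕ, Set.indicator {l : ℕ | M ≤ l}
        (fun l : ℕ => ENNReal.ofReal ((l : ℝ) * ρ t l u)) l
        = ENNReal.ofReal (if M ≤ l then (l : ℝ) * ρ t l u else 0) := fun l => by
      by_cases hl : M ≤ l <;> simp [hl]
    simp only [hind]
    refine tsum_ofReal_le (fun l => ?_) fun n => ?_
    · split_ifs
      · exact mul_nonneg l.cast_nonneg (h.nonneg t l u)
      · exact le_rfl
    · have hT := (hΛ t ht).tailBound (by linarith) (h.nonneg t) M n u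
      have hsum : ∑ l ∈ Finset.range n, (if M ≤ l then (l : ℝ) * ρ t l u else 0)
          = ∑ l ∈ Finset.Ico M n, (l : ℝ) * ρ t l u := by
        rw [← Finset.sum_filter]
        congr 1
        ext l
        simp [and_comm]
      rw [hsum]
      refine hT.trans ?_
      have h1 : Λ ≤ Real.exp M := (Nat.ceil_le.1 hMΛ).trans (natCast_le_exp M)
      refine (mul_le_mul_of_nonneg_left h1 (Real.exp_pos _).le).trans_eq ?_
      rw [← Real.exp_add]
      congr 1
      ring

theorem IsMeanFieldSolution.exists_isProfile {ρ : ℝ≥0 → ℕ → C(UnitAddCircle, ℝ)}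
    (h : IsMeanFieldSolution φ ψ ρ) (T : ℝ≥0) : ∃ m, ∀ t ≤ T, IsProfile m (ρ t) := by
  have hfin := h.moments T 1 (by simp)
  set S := (⨆ (t : ℝ≥0) (_ : t ≤ T) (u : UnitAddCircle),
      ∑' l : ℕ, ENNReal.ofReal ((l : ℝ) ^ 1 * ρ t l u)) with hS
  refine ⟨S.toReal, fun t ht => ⟨h.nonneg t, fun n u => sum_le_hasSum _
    (fun k _ => h.nonneg t k u) (h.mass t u), fun n u => ?_⟩⟩
  rw [← ENNReal.ofReal_le_iff_le_toReal hfin.ne,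
    ENNReal.ofReal_sum_of_nonneg fun k _ => mul_nonneg k.cast_nonneg (h.nonneg t k u)]
  refine (ENNReal.sum_le_tsum _).trans ?_
  have := le_iSup₂_of_le (f := fun (t : ℝ≥0) (_ : t ≤ T) => ⨆ u : UnitAddCircle,
      ∑' l : ℕ, ENNReal.ofReal ((l : ℝ) ^ 1 * ρ t l u)) t ht
    (le_iSup (fun u : UnitAddCircle => ∑' l : ℕ, ENNReal.ofReal ((l : ℝ) ^ 1 * ρ t l u)) u)
  simpa only [pow_one, hS] using this

/-- A limit superior equal to `⊥` means that every exponential rate `a` is eventually achieved, in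
particular one chosen in terms of the Gronwall constant. -/
theorem IsMeanFieldSolution.eventually_tailBound {ρ : ℝ≥0 → ℕ → C(UnitAddCircle, ℝ)}
    (h : IsMeanFieldSolution φ ψ ρ) (T : ℝ≥0) (a : ℝ) :
    ∀ᶠ M : ℕ in atTop, ∀ t ≤ T, TailBound M (Real.exp (-a * M)) (ρ t) := by
  have hlim := eventually_lt_of_limsup_lt
    ((h.tails T).trans_lt (EReal.bot_lt_coe (-a)))
  filter_upwards [hlim, eventually_ge_atTop 1] with M hM hM1 t ht n u
  have hS := le_ofReal_exp_of_inv_mul_log_lt hM1 hM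
  rw [← ENNReal.ofReal_le_ofReal_iff (Real.exp_pos _).le,
    ENNReal.ofReal_sum_of_nonneg fun k _ => mul_nonneg k.cast_nonneg (h.nonneg t k u)]
  refine le_trans ?_ hS
  refine le_trans ?_ (le_iSup₂_of_le (f := fun (t : ℝ≥0) (_ : t ≤ T) => ⨆ u : UnitAddCircle,
      ∑' l : {l : ℕ // M ≤ l}, ENNReal.ofReal ((l : ℝ) * ρ t l u)) t ht
    (le_iSup (fun u : UnitAddCircle =>
      ∑' l : {l : ℕ // M ≤ l}, ENNReal.ofReal ((l : ℝ) * ρ t l u)) u))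
  refine le_trans ?_ (tsum_subtype {l : ℕ | M ≤ l}
    fun l : ℕ => ENNReal.ofReal ((l : ℝ) * ρ t l u)).ge
  refine le_trans (le_of_eq (Finset.sum_congr rfl fun l hl => ?_))
    (ENNReal.sum_le_tsum (Finset.Ico M n))
  rw [Set.indicator_of_mem (s := {l : ℕ | M ≤ l}) (Finset.mem_Ico.1 hl).1]

theorem IsMeanFieldSolution.isSolutionOn {ρ : ℝ≥0 → ℕ → C(UnitAddCircle, ℝ)}
    (h : IsMeanFieldSolution φ ψ ρ) (T : ℝ) (K : ℕ) :
    IsSolutionOn φ T K fun s => ρ s.toNNReal := fun t ht k _ u => by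
  have := h.equation t.toNNReal k u
  rw [Real.coe_toNNReal t ht.1] at this
  exact this.mono Set.Icc_subset_Ici_self

/-- For the given time `T` the tail condition is used with rate `6 * C * T + 3`, which outweighs the
Gronwall factor, so the difference at a fixed level is at most `c * exp (-2 * K)` for all large `K`.
-/
theorem IsMeanFieldSolution.unique (hφ : BoundedRates φ C)
    {ρ ρ' : ℝ≥0 → ℕ → C(UnitAddCircle, ℝ)} (h : IsMeanFieldSolution φ ψ ρ)
    (h' : IsMeanFieldSolution φ ψ ρ') : ρ = ρ' := by
  funext T k
  ext u
  obtain ⟨m, hm⟩ := h.exists_isProfile T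
  obtain ⟨m', hm'⟩ := h'.exists_isProfile T
  have hmax : ∀ {m₁ m₂ : ℝ} {r : ℕ → C(UnitAddCircle, ℝ)}, m₁ ≤ m₂ → IsProfile m₁ r →
      IsProfile m₂ r := fun hle hr => ⟨hr.nonneg, hr.mass_le, fun n u => (hr.moment_le n u).trans hle⟩
  have hm0 := (hm T le_rfl).const_nonneg
  obtain ⟨c, D, hc, -, hcD⟩ := exp_error_le hφ.const_nonneg T.coe_nonneg
    (hm0.trans (le_max_left m m')) zero_le_one
  have hkey : ∀ᶠ K : ℕ in atTop, |ρ T k u - ρ' T k u| ≤ c * Real.exp (-2 * K) := by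
    filter_upwards [eventually_ge_atTop (k + 1),
      h.eventually_tailBound T (6 * C * T + 3), h'.eventually_tailBound T (6 * C * T + 3)]
      with K hK hτ hτ'
    have hsub : ∀ t ∈ Set.Icc 0 (T : ℝ), t.toNNReal ≤ T := fun t ht =>
      Real.toNNReal_le_iff_le_coe.2 ht.2
    have key := hφ.sum_abs_sub_le (K := K) (T := T) (by omega) (h.isSolutionOn T K)
      (h'.isSolutionOn T K) (fun k _ u => by simp [h.initial, h'.initial])
      (fun t ht => hmax (le_max_left m m') (hm _ (hsub t ht)))
      (fun t ht => hmax (le_max_right m m') (hm' _ (hsub t ht)))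
      (fun t ht => hτ _ (hsub t ht)) (fun t ht => hτ' _ (hsub t ht))
      (Set.right_mem_Icc.2 T.coe_nonneg) u
    have h1 := (hcD K).1
    rw [mul_one] at h1
    refine le_trans ?_ (key.trans h1)
    simp only [Real.toNNReal_coe]
    exact Finset.single_le_sum (f := fun k => |ρ T k u - ρ' T k u|)
      (fun k _ => abs_nonneg _) (Finset.mem_range.2 (by omega))
  have hlim : Tendsto (fun K : ℕ => c * Real.exp (-2 * K)) atTop (𝓝 0) := by
    have h1 := tendsto_const_mul_exp_neg c
    refine squeeze_zero (fun K => by positivity) (fun K => ?_) h1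
    refine mul_le_mul_of_nonneg_left (Real.exp_le_exp.2 ?_) hc
    have : (0 : ℝ) ≤ K := K.cast_nonneg
    linarith
  have := ge_of_tendsto hlim hkey
  exact sub_eq_zero.1 (abs_eq_zero.1 (le_antisymm this (abs_nonneg _)))

theorem existsUnique_isMeanFieldSolution (hφ : BoundedRates φ C) (hψ : Continuous ψ)
    (hψ0 : ∀ u, 0 < ψ u) : ∃! ρ : ℝ≥0 → ℕ → C(UnitAddCircle, ℝ), IsMeanFieldSolution φ ψ ρ := by
  obtain ⟨ρ, R, h⟩ := exists_isRegularSolution hφ (poissonProfile_nonneg hψ hψ0)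
    (hasSum_poissonProfile hψ hψ0) (exists_expMomentBound_poissonProfile hψ hψ0)
  exact ⟨ρ, h.isMeanFieldSolution hψ, fun ρ' h' => h'.unique hφ (h.isMeanFieldSolution hψ)⟩

/-- Uniqueness as a regularity statement: the solution must be the constructed one, hence is
differentiable in `C(𝕋)` and has all exponential moments. The comparison with the particle system
uses both. -/
theorem IsMeanFieldSolution.exists_isRegularSolution (hφ : BoundedRates φ C) (hψ : Continuous ψ)
    (hψ0 : ∀ u, 0 < ψ u) {ρ : ℝ≥0 → ℕ → C(UnitAddCircle, ℝ)} (h : IsMeanFieldSolution φ ψ ρ) :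
    ∃ R, IsRegularSolution φ (poissonProfile hψ) ρ R := by
  obtain ⟨ρ', R, h'⟩ := MeanField.exists_isRegularSolution hφ (poissonProfile_nonneg hψ hψ0)
    (hasSum_poissonProfile hψ hψ0) (exists_expMomentBound_poissonProfile hψ hψ0)
  rw [h.unique hφ (h'.isMeanFieldSolution hψ)]
  exact ⟨R, h'⟩

end ExistsUnique

end MeanField

namespace MeanField

/-! ### The forward equation for expectations on a finite block -/

section Block

variable {N : ℕ}

/-- A function on configurations cut off to those with at most `L` particles. -/
noncomputable def cutoff (L : ℕ) (G : (Fin N → ℕ) → ℝ) (η : Fin N → ℕ) : ℝ :=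
  if ∑ i, η i ≤ L then G η else 0

theorem finite_block (N L : ℕ) : {η : Fin N → ℕ | ∑ i, η i ≤ L}.Finite := by
  refine (Set.Finite.pi' (t := fun _ : Fin N => Set.Iic L) fun _ => Set.finite_Iic L).subset ?_
  intro η hη i
  exact (Finset.single_le_sum (f := η) (fun _ _ => Nat.zero_le _) (Finset.mem_univ i)).trans hη

theorem finite_support_cutoff (L : ℕ) (G : (Fin N → ℕ) → ℝ) :
    (Function.support (cutoff L G)).Finite :=
  (finite_block N L).subset fun η hη => by
    by_contra h
    exact hη (if_neg h)

theorem exists_abs_cutoff_le (L : ℕ) (G : (Fin N → ℕ) → ℝ) : ∃ B, ∀ η, |cutoff L G η| ≤ B := by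
  obtain ⟨B, hB⟩ := ((finite_support_cutoff L G).image fun η => |cutoff L G η|).bddAbove
  refine ⟨max B 0, fun η => ?_⟩
  by_cases h : cutoff L G η = 0
  · simp [h]
  · exact (hB ⟨η, h, rfl⟩).trans (le_max_left _ _)

theorem sum_moveParticle (η : Fin N → ℕ) {i j : Fin N} (hij : j ≠ i) (hi : 1 ≤ η i) :
    ∑ l, moveParticle η i j l = ∑ l, η l := by
  classical
  have h1 : ∑ l, moveParticle η i j l
      = (η j + 1) + ((η i - 1) + ∑ l ∈ (Finset.univ.erase j).erase i, η l) := by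
    rw [← Finset.add_sum_erase _ _ (Finset.mem_univ j),
      ← Finset.add_sum_erase _ _ (Finset.mem_erase.2 ⟨hij.symm, Finset.mem_univ i⟩)]
    congr 1
    · simp [moveParticle]
    · congr 1
      · simp [moveParticle, Function.update_of_ne hij.symm]
      · refine Finset.sum_congr rfl fun l hl => ?_
        simp only [Finset.mem_erase] at hl
        rw [moveParticle, Function.update_of_ne hl.2.1, Function.update_of_ne hl.1]
  rw [h1, ← Finset.add_sum_erase (a := j) Finset.univ η (Finset.mem_univ j),
    ← Finset.add_sum_erase _ _ (Finset.mem_erase.2 ⟨hij.symm, Finset.mem_univ i⟩)]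
  omega

variable {φ : ℕ → ℕ → UnitAddCircle → UnitAddCircle → ℝ}

/-- Jumps conserve the number of particles, so the cutoff commutes with the generator. An empty
departure site, where `η i - 1` would be wrong, has rate zero. -/
theorem generator_cutoff (hφ : IsRateFamily φ) (L : ℕ) (G : (Fin N → ℕ) → ℝ) :
    generator N φ (cutoff L G) = cutoff L (generator N φ G) := by
  funext η
  have hterm : ∀ i, ∀ j ∈ Finset.univ.erase i,
      φ (η i) (η j) (site N i) (site N j) * (cutoff L G (moveParticle η i j) - cutoff L G η)
      = if ∑ l, η l ≤ L then
        φ (η i) (η j) (site N i) (site N j) * (G (moveParticle η i j) - G η) else 0 := by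
    intro i j hj
    rcases Nat.eq_zero_or_pos (η i) with h0 | h0
    · simp [h0, hφ.zero]
    · rw [cutoff, cutoff, sum_moveParticle η (Finset.ne_of_mem_erase hj) h0]
      split_ifs <;> simp
  rw [generator, Finset.sum_congr rfl fun i _ => Finset.sum_congr rfl (hterm i), cutoff]
  split_ifs
  · rfl
  · simp

end Block

/-! ### Expectations on a block: Dynkin's formula and the forward equation. -/

section Expectation

variable {Ω : Type*} [MeasurableSpace Ω] {P : Measure Ω} {N : ℕ}
  {φ : ℕ → ℕ → UnitAddCircle → UnitAddCircle → ℝ} {X : ℝ≥0 → Ω → (Fin N → ℕ)}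

theorem IsMarkovProcess.measurable (h : IsMarkovProcess P N φ X) (t : ℝ≥0) :
    Measurable (X t) := by
  obtain ⟨ℱ, hℱ, -⟩ := h.martingale
  exact (hℱ t).mono (ℱ.le t) le_rfl

/-- Joint measurability, needed for Fubini in Dynkin's formula. Time is approximated from the right
by grid points, and right continuity gives convergence of the sampled process. -/
theorem IsMarkovProcess.measurable_uncurry (h : IsMarkovProcess P N φ X)
    (F : (Fin N → ℕ) → ℝ) : Measurable fun p : ℝ × Ω => F (X p.1.toNNReal p.2) := by
  have hgrid : ∀ n : ℕ, Measurable fun p : ℝ × Ω =>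
      F (X ((⌊p.1.toNNReal * (n + 1 : ℕ)⌋₊ + 1 : ℕ) / (n + 1 : ℕ)) p.2) := by
    intro n
    have h1 : Measurable fun q : ℕ × Ω => F (X ((q.1 + 1 : ℕ) / (n + 1 : ℕ)) q.2) :=
      measurable_from_prod_countable_right fun k =>
        (Measurable.of_discrete (f := F)).comp (h.measurable ((k + 1 : ℕ) / (n + 1 : ℕ)))
    have h2 : Measurable fun p : ℝ × Ω => (⌊p.1.toNNReal * (n + 1 : ℕ)⌋₊, p.2) :=
      (Nat.measurable_floor.comp
        ((measurable_real_toNNReal.comp measurable_fst).mul_const _)).prodMk measurable_snd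
    exact h1.comp h2
  refine measurable_of_tendsto_metrizable hgrid (tendsto_pi_nhds.2 fun p => ?_)
  have htime : Tendsto (fun n : ℕ =>
      ((⌊p.1.toNNReal * (n + 1 : ℕ)⌋₊ + 1 : ℕ) / (n + 1 : ℕ) : ℝ≥0)) atTop
      (𝓝[≥] p.1.toNNReal) := by
    have hlo : ∀ n : ℕ, p.1.toNNReal
        ≤ ((⌊p.1.toNNReal * (n + 1 : ℕ)⌋₊ + 1 : ℕ) / (n + 1 : ℕ) : ℝ≥0) := fun n => by
      rw [le_div_iff₀ (by positivity)]
      exact_mod_cast (Nat.lt_floor_add_one (p.1.toNNReal * (n + 1 : ℕ))).le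
    refine tendsto_nhdsWithin_iff.2 ⟨?_, Eventually.of_forall hlo⟩
    have hup : Tendsto (fun n : ℕ => p.1.toNNReal + 1 / ((n : ℝ≥0) + 1)) atTop
        (𝓝 (p.1.toNNReal + 0)) := tendsto_const_nhds.add tendsto_one_div_add_atTop_nhds_zero_nat
    rw [add_zero] at hup
    refine tendsto_of_tendsto_of_tendsto_of_le_of_le tendsto_const_nhds hup hlo fun n => ?_
    have h3 : (⌊p.1.toNNReal * (n + 1 : ℕ)⌋₊ : ℝ≥0) ≤ p.1.toNNReal * (n + 1 : ℕ) :=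
      Nat.floor_le (by positivity)
    rw [div_le_iff₀ (by positivity)]
    have h4 : (p.1.toNNReal + 1 / ((n : ℝ≥0) + 1)) * ((n + 1 : ℕ) : ℝ≥0)
        = p.1.toNNReal * (n + 1 : ℕ) + 1 := by
      push_cast
      field_simp
    rw [h4]
    push_cast at h3 ⊢
    gcongr
  exact ((continuous_of_discreteTopology (f := F)).tendsto _).comp
    ((h.right_continuous p.2 p.1.toNNReal).tendsto.comp htime)

/-- The expectation of `G (X t)` on the event that there are at most `L` particles. -/
noncomputable def blockExp (P : Measure Ω) (X : ℝ≥0 → Ω → (Fin N → ℕ)) (L : ℕ)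
    (G : (Fin N → ℕ) → ℝ) (t : ℝ) : ℝ :=
  ∫ ω, cutoff L G (X t.toNNReal ω) ∂P

theorem blockExp_const_mul (L : ℕ) (c : ℝ) (G : (Fin N → ℕ) → ℝ) (t : ℝ) :
    blockExp P X L (fun η => c * G η) t = c * blockExp P X L G t := by
  rw [blockExp, blockExp, ← integral_const_mul]
  refine integral_congr_ae (Eventually.of_forall fun ω => ?_)
  simp only [cutoff]
  split_ifs <;> simp

variable [IsProbabilityMeasure P]

theorem IsMarkovProcess.integrable_cutoff (h : IsMarkovProcess P N φ X) (L : ℕ)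
    (G : (Fin N → ℕ) → ℝ) (t : ℝ≥0) : Integrable (fun ω => cutoff L G (X t ω)) P := by
  obtain ⟨B, hB⟩ := exists_abs_cutoff_le L G
  exact Integrable.of_bound ((Measurable.of_discrete (f := cutoff L G)).comp
    (h.measurable t)).aestronglyMeasurable B (Eventually.of_forall fun ω => hB _)

theorem IsMarkovProcess.blockExp_mono (h : IsMarkovProcess P N φ X) {L : ℕ}
    {G H : (Fin N → ℕ) → ℝ} (hGH : ∀ η, ∑ i, η i ≤ L → G η ≤ H η) (t : ℝ) :
    blockExp P X L G t ≤ blockExp P X L H t := by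
  refine integral_mono (h.integrable_cutoff L G _) (h.integrable_cutoff L H _) fun ω => ?_
  rw [cutoff, cutoff]
  split_ifs with hω
  · exact hGH _ hω
  · exact le_rfl

theorem IsMarkovProcess.blockExp_add (h : IsMarkovProcess P N φ X) (L : ℕ)
    (G H : (Fin N → ℕ) → ℝ) (t : ℝ) :
    blockExp P X L (fun η => G η + H η) t = blockExp P X L G t + blockExp P X L H t := by
  rw [blockExp, blockExp, blockExp,
    ← integral_add (h.integrable_cutoff L G _) (h.integrable_cutoff L H _)]
  refine integral_congr_ae (Eventually.of_forall fun ω => ?_)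
  simp only [cutoff]
  split_ifs <;> simp

theorem IsMarkovProcess.blockExp_const_le (h : IsMarkovProcess P N φ X) (L : ℕ) {c : ℝ}
    (hc : 0 ≤ c) (t : ℝ) : blockExp P X L (fun _ => c) t ≤ c := by
  have := integral_mono (h.integrable_cutoff L (fun _ => c) t.toNNReal) (integrable_const c)
    fun ω => by
      rw [cutoff]
      split_ifs
      · exact le_rfl
      · exact hc
  simpa [blockExp] using this

/-- Dynkin's formula. -/
theorem IsMarkovProcess.blockExp_eq (hφ : IsRateFamily φ) (h : IsMarkovProcess P N φ X) (L : ℕ)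
    (G : (Fin N → ℕ) → ℝ) {t : ℝ} (ht : 0 ≤ t) :
    blockExp P X L G t
      = blockExp P X L G 0 + ∫ s in (0 : ℝ)..t, blockExp P X L (generator N φ G) s := by
  obtain ⟨ℱ, hℱ, hM⟩ := h.martingale
  have hmart := hM (cutoff L G) (finite_support_cutoff L G)
  -- A martingale keeps its expectation, and the Dynkin process is zero at time zero.
  have h0 : ∫ ω, dynkinProcess N φ X (cutoff L G) t.toNNReal ω ∂P = 0 := by
    rw [← integral_condExp (ℱ.le 0), integral_congr_ae (hmart.condExp_ae_eq (zero_le (a := _)))]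
    simp [dynkinProcess]
  obtain ⟨B, hB⟩ := exists_abs_cutoff_le L (generator N φ G)
  have hmeas := h.measurable_uncurry (cutoff L (generator N φ G))
  have hint : Integrable (Function.uncurry fun (ω : Ω) (s : ℝ) =>
      cutoff L (generator N φ G) (X s.toNNReal ω)) (P.prod (volume.restrict (Set.Ioc 0 t))) :=
    Integrable.of_bound (hmeas.comp measurable_swap).aestronglyMeasurable B
      (Eventually.of_forall fun p => hB _)
  have hdyn : ∀ ω, dynkinProcess N φ X (cutoff L G) t.toNNReal ω
      = cutoff L G (X t.toNNReal ω) - cutoff L G (X 0 ω)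
        - ∫ s in Set.Ioc 0 t, cutoff L (generator N φ G) (X s.toNNReal ω) := fun ω => by
    rw [dynkinProcess, generator_cutoff hφ, Real.coe_toNNReal t ht,
      intervalIntegral.integral_of_le ht]
  simp only [hdyn] at h0
  have hswap := integral_integral_swap hint
  rw [integral_sub, integral_sub (h.integrable_cutoff L G _) (h.integrable_cutoff L G _),
    hswap] at h0
  · rw [intervalIntegral.integral_of_le ht]
    simp only [blockExp, Real.toNNReal_zero]
    linarith
  · exact (h.integrable_cutoff L G _).sub (h.integrable_cutoff L G _)
  · exact hint.integral_prod_left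

/-- By Dynkin's formula this is a primitive of a bounded function. Applied to `generator N φ G` it
makes the integrand in that formula continuous, so expectations are differentiable at every time and
not only almost everywhere. -/
theorem IsMarkovProcess.continuous_blockExp (hφ : IsRateFamily φ) (h : IsMarkovProcess P N φ X)
    (L : ℕ) (G : (Fin N → ℕ) → ℝ) : Continuous (blockExp P X L G) := by
  obtain ⟨B, hB⟩ := exists_abs_cutoff_le L (generator N φ G)
  have hmeas : StronglyMeasurable (blockExp P X L (generator N φ G)) :=
    (h.measurable_uncurry (cutoff L (generator N φ G))).stronglyMeasurable.integral_prod_right'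
  have hbound : ∀ s, ‖blockExp P X L (generator N φ G) s‖ ≤ B := fun s => by
    have := norm_integral_le_of_norm_le_const (μ := P)
      (f := fun ω => cutoff L (generator N φ G) (X s.toNNReal ω)) (C := B)
      (Eventually.of_forall fun ω => hB _)
    simpa [blockExp] using this
  have hint : ∀ a b : ℝ, IntervalIntegrable (blockExp P X L (generator N φ G)) volume a b :=
    fun a b => (intervalIntegrable_const (c := B)).mono_fun hmeas.aestronglyMeasurable
      (Eventually.of_forall fun s => (hbound s).trans (le_abs_self B))
  have heq : blockExp P X L G = fun t => blockExp P X L G 0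
      + ∫ s in (0 : ℝ)..(max t 0), blockExp P X L (generator N φ G) s := by
    funext t
    rw [← h.blockExp_eq hφ L G (le_max_right t 0)]
    have : (max t 0).toNNReal = t.toNNReal := by
      rw [Real.toNNReal, Real.toNNReal]; congr 1; simp
    rw [blockExp, blockExp, this]
  rw [heq]
  exact continuous_const.add ((intervalIntegral.continuous_primitive hint 0).comp
    (continuous_id.max continuous_const))

theorem IsMarkovProcess.hasDerivWithinAt_blockExp (hφ : IsRateFamily φ)
    (h : IsMarkovProcess P N φ X) (L : ℕ) (G : (Fin N → ℕ) → ℝ) {t : ℝ} (ht : 0 ≤ t) :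
    HasDerivWithinAt (blockExp P X L G) (blockExp P X L (generator N φ G) t) (Set.Ici 0) t := by
  have h1 := ((h.continuous_blockExp hφ L (generator N φ G)).integral_hasStrictDerivAt 0
    t).hasDerivAt.const_add (blockExp P X L G 0)
  exact h1.hasDerivWithinAt.congr (fun s hs => h.blockExp_eq hφ L G hs) (h.blockExp_eq hφ L G ht)

/-- The forward equation for a time-dependent function. -/
theorem IsMarkovProcess.hasDerivWithinAt_blockExp_time (hφ : IsRateFamily φ)
    (h : IsMarkovProcess P N φ X) (L : ℕ) {F F' : ℝ → (Fin N → ℕ) → ℝ} {t : ℝ} (ht : 0 ≤ t)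
    (hF : ∀ η, HasDerivWithinAt (fun s => F s η) (F' t η) (Set.Ici 0) t) :
    HasDerivWithinAt (fun s => blockExp P X L (F s) s)
      (blockExp P X L (fun η => F' t η + generator N φ (F t) η) t) (Set.Ici 0) t := by
  classical
  -- On the finite block an expectation is a finite sum of `F s η` times the probability of `η` at
  -- time `s`, so the product rule applies termwise.
  set S := (finite_block N L).toFinset with hS
  set p : (Fin N → ℕ) → ℝ → ℝ := fun η => blockExp P X L (Pi.single η 1) with hp
  have hmem : ∀ η : Fin N → ℕ, η ∈ S ↔ ∑ i, η i ≤ L := fun η => by simp [hS]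
  have hexpand : ∀ (G : (Fin N → ℕ) → ℝ) (s : ℝ),
      blockExp P X L G s = ∑ η ∈ S, G η * p η s := by
    intro G s
    simp only [hp, ← blockExp_const_mul]
    simp only [blockExp]
    rw [← integral_finsetSum _ fun η _ => h.integrable_cutoff L _ _]
    refine integral_congr_ae (Eventually.of_forall fun ω => ?_)
    simp only [cutoff]
    split_ifs with hω
    · simp only [Pi.single_apply, mul_ite, mul_one, mul_zero]
      rw [Finset.sum_ite_eq, if_pos ((hmem _).2 hω)]
    · simp
  have hpd : ∀ η, HasDerivWithinAt (p η) (blockExp P X L (generator N φ (Pi.single η 1)) t)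
      (Set.Ici 0) t := fun η => h.hasDerivWithinAt_blockExp hφ L _ ht
  -- The adjoint of the generator is not computed: freezing `F` at time `t` gives a function whose
  -- derivative is known in two ways, and derivatives on `[0, ∞)` are unique.
  have hG : ∑ η ∈ S, F t η * blockExp P X L (generator N φ (Pi.single η 1)) t
      = blockExp P X L (generator N φ (F t)) t := by
    have h1 : HasDerivWithinAt (blockExp P X L (F t))
        (∑ η ∈ S, F t η * blockExp P X L (generator N φ (Pi.single η 1)) t) (Set.Ici 0) t := by
      rw [show blockExp P X L (F t) = fun s => ∑ η ∈ S, F t η * p η s from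
        funext fun s => hexpand (F t) s]
      exact HasDerivWithinAt.fun_sum fun η _ => (hpd η).const_mul _
    exact (uniqueDiffOn_Ici (0 : ℝ) t ht).eq_deriv _ h1 (h.hasDerivWithinAt_blockExp hφ L (F t) ht)
  rw [h.blockExp_add, ← hG, hexpand (F' t) t, ← Finset.sum_add_distrib]
  rw [show (fun s => blockExp P X L (F s) s) = fun s => ∑ η ∈ S, F s η * p η s from
    funext fun s => hexpand (F s) s]
  exact HasDerivWithinAt.fun_sum fun η _ => (hF η).mul (hpd η)

end Expectation

end MeanField

namespace MeanField

/-! ### A smooth approximation of the absolute value -/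

/-- `√(β² + x²)`. -/
noncomputable def smoothAbs (β x : ℝ) : ℝ := Real.sqrt (β ^ 2 + x ^ 2)

section SmoothAbs

variable {β : ℝ} (hβ : 0 < β)

theorem abs_le_smoothAbs (β x : ℝ) : |x| ≤ smoothAbs β x := by
  rw [smoothAbs, ← Real.sqrt_sq_eq_abs]
  exact Real.sqrt_le_sqrt (by nlinarith [sq_nonneg β])

theorem smoothAbs_sq (β x : ℝ) : smoothAbs β x ^ 2 = β ^ 2 + x ^ 2 :=
  Real.sq_sqrt (by positivity)

theorem le_smoothAbs (β x : ℝ) : β ≤ smoothAbs β x :=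
  Real.le_sqrt_of_sq_le (by nlinarith [sq_nonneg x])

include hβ

theorem smoothAbs_le (x : ℝ) : smoothAbs β x ≤ |x| + β := by
  refine Real.sqrt_le_iff.2 ⟨by positivity, ?_⟩
  nlinarith [sq_abs x, abs_nonneg x]

theorem abs_div_smoothAbs_le_one (x : ℝ) : |x / smoothAbs β x| ≤ 1 := by
  have h := hβ.trans_le (le_smoothAbs β x)
  rw [abs_div, abs_of_pos h, div_le_one h]
  exact abs_le_smoothAbs β x

/-- A global second-order Taylor bound with curvature `1 / β`. It comes from `2 * s * s' ≤ s ^ 2 +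
s' ^ 2` with `s`, `s'` the values at `x` and `x + d`, together with `s ≥ β`. -/
theorem smoothAbs_add_le (x d : ℝ) :
    smoothAbs β (x + d) ≤ smoothAbs β x + x / smoothAbs β x * d + d ^ 2 / (2 * β) := by
  have hs := hβ.trans_le (le_smoothAbs β x)
  have h1 : smoothAbs β (x + d)
      ≤ smoothAbs β x + x / smoothAbs β x * d + d ^ 2 / (2 * smoothAbs β x) := by
    have : smoothAbs β x + x / smoothAbs β x * d + d ^ 2 / (2 * smoothAbs β x)
        = (smoothAbs β x ^ 2 + (β ^ 2 + (x + d) ^ 2)) / (2 * smoothAbs β x) := by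
      field_simp
      linear_combination smoothAbs_sq β x
    rw [this, le_div_iff₀ (by positivity), ← smoothAbs_sq β (x + d)]
    nlinarith [sq_nonneg (smoothAbs β (x + d) - smoothAbs β x)]
  refine h1.trans ?_
  gcongr
  exact le_smoothAbs β x

theorem hasDerivAt_smoothAbs (x : ℝ) :
    HasDerivAt (smoothAbs β) (x / smoothAbs β x) x := by
  have h : HasDerivAt (fun y : ℝ => β ^ 2 + y ^ 2) (2 * x) x := by
    simpa using (hasDerivAt_pow 2 x).const_add (β ^ 2)
  have h2 := h.sqrt (by positivity)
  rw [mul_div_mul_left _ _ two_ne_zero] at h2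
  exact h2

end SmoothAbs

/-! ### Partitions of unity on the torus -/

/-- A finite partition of unity on the torus, at the scale of which the rates with indices below
`K` vary by at most `δ`. -/
structure IsLocalization (φ : ℕ → ℕ → UnitAddCircle → UnitAddCircle → ℝ) (C : ℝ) (K : ℕ) (δ : ℝ)
    {ι : Type} [Fintype ι] (χ : ι → C(UnitAddCircle, ℝ)) (a : ℕ → ℕ → ι → ι → ℝ) : Prop where
  nonneg : ∀ c u, 0 ≤ χ c u
  sum_eq_one : ∀ u, ∑ c, χ c u = 1
  close : ∀ k < K, ∀ l < K, ∀ c c' u v, χ c u ≠ 0 → χ c' v ≠ 0 → |φ k l u v - a k l c c'| ≤ δ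
  abs_le_mul : ∀ k < K, ∀ l, ∀ c c', |a k l c c'| ≤ C * K

/-- Normalized hat functions on a finite cover by balls of radius `r`. One radius serves all rates
with indices below `K` and the test function `f`, being a common modulus of finitely many uniformly
continuous functions; `a` evaluates the rates at the centres. -/
theorem exists_isLocalization {φ : ℕ → ℕ → UnitAddCircle → UnitAddCircle → ℝ} {C : ℝ}
    (hφ : BoundedRates φ C) (K : ℕ) (f : C(UnitAddCircle, ℝ)) {δ : ℝ} (hδ : 0 < δ) :
    ∃ (ι : Type) (_ : Fintype ι) (χ : ι → C(UnitAddCircle, ℝ)) (a : ℕ → ℕ → ι → ι → ℝ)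
      (p : ι → UnitAddCircle), IsLocalization φ C K δ χ a ∧
      ∀ c u, χ c u ≠ 0 → |f u - f (p c)| ≤ δ := by
  classical
  have huc : ∀ k l, ∀ᶠ r in 𝓝[>] (0 : ℝ), ∀ u v u' v' : UnitAddCircle, dist u u' < r →
      dist v v' < r → |φ k l u v - φ k l u' v'| ≤ δ := fun k l => by
    obtain ⟨r₀, hr₀, h⟩ := Metric.uniformContinuous_iff.1
      (CompactSpace.uniformContinuous_of_continuous (hφ.continuous₂ k l)) δ hδ
    filter_upwards [Ioo_mem_nhdsGT hr₀] with r hr u v u' v' hu hv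
    have := @h (u, v) (u', v') (max_lt (hu.trans hr.2) (hv.trans hr.2))
    exact this.le
  have huf : ∀ᶠ r in 𝓝[>] (0 : ℝ), ∀ u u' : UnitAddCircle, dist u u' < r →
      |f u - f u'| ≤ δ := by
    obtain ⟨r₀, hr₀, h⟩ := Metric.uniformContinuous_iff.1
      (CompactSpace.uniformContinuous_of_continuous f.continuous) δ hδ
    filter_upwards [Ioo_mem_nhdsGT hr₀] with r hr u u' hu
    exact (h (hu.trans hr.2)).le
  have hall := (eventually_all_finset (Finset.range K)).2 fun k _ =>
    (eventually_all_finset (Finset.range K)).2 fun l _ => huc k l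
  obtain ⟨r, ⟨hr, hrf⟩, hr0⟩ := ((hall.and huf).and self_mem_nhdsWithin).exists
  have hr0 : 0 < r := hr0
  obtain ⟨t, -, htc⟩ := isCompact_univ.elim_nhds_subcover (fun x : UnitAddCircle => Metric.ball x r)
    fun x _ => Metric.ball_mem_nhds x hr0
  set g : t → UnitAddCircle → ℝ := fun c u => max 0 (r - dist u c) with hg
  have hgc : ∀ c, Continuous (g c) := fun c => by fun_prop
  have hg0 : ∀ c u, 0 ≤ g c u := fun c u => le_max_left _ _
  have hgd : ∀ c u, g c u ≠ 0 → dist u c < r := fun c u h => by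
    by_contra hd
    exact h (max_eq_left (by linarith))
  have hpos : ∀ u, 0 < ∑ c, g c u := fun u => by
    obtain ⟨x, hx, hux⟩ := Set.mem_iUnion₂.1 (htc (Set.mem_univ u))
    refine Finset.sum_pos' (fun c _ => hg0 c u) ⟨⟨x, hx⟩, Finset.mem_univ _, ?_⟩
    exact lt_max_of_lt_right (sub_pos.2 hux)
  let χ : t → C(UnitAddCircle, ℝ) := fun c => ⟨fun u => g c u / ∑ c', g c' u,
    (hgc c).div (continuous_finsetSum _ fun c' _ => hgc c') fun u => (hpos u).ne'⟩
  have hχd : ∀ c u, χ c u ≠ 0 → dist u c < r := fun c u h => hgd c u fun h0 => h (by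
    change g c u / _ = 0
    rw [h0, zero_div])
  refine ⟨t, inferInstance, χ, fun k l c c' => φ k l c c', fun c => c, ⟨?_, ?_, ?_, ?_⟩, ?_⟩
  · exact fun c u => div_nonneg (hg0 c u) (hpos u).le
  · intro u
    change ∑ c, g c u / ∑ c', g c' u = 1
    rw [← Finset.sum_div, div_self (hpos u).ne']
  · exact fun k hk l hl c c' u v hu hv => hr k (Finset.mem_range.2 hk) l (Finset.mem_range.2 hl)
      u v c c' (hχd c u hu) (hχd c' v hv)
  · intro k hk l c c'
    refine (hφ.abs_rate_le k l c c').trans (mul_le_mul_of_nonneg_left ?_ hφ.const_nonneg)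
    exact_mod_cast hk.le
  · exact fun c u hu => hrf u c (hχd c u hu)

/-! ### The discretized equation -/

section Discrete

variable {ι : Type} [Fintype ι]

/-- The departure rate for cell weights `y` and cell rates `a`. -/
def cellDeparture (a : ℕ → ℕ → ι → ι → ℝ) (K : ℕ) (y : ι → ℕ → ℝ) (c : ι) (k : ℕ) : ℝ :=
  ∑ c', ∑ l ∈ Finset.range K, y c' l * a k l c c'

/-- The arrival rate for cell weights `y` and cell rates `a`. -/
def cellArrival (a : ℕ → ℕ → ι → ι → ℝ) (K : ℕ) (y : ι → ℕ → ℝ) (c : ι) (k : ℕ) : ℝ :=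
  ∑ c', ∑ l ∈ Finset.range K, y c' l * a l k c' c

/-- The drift of `∑ y c k * w c k` for cell weights `y` and cell rates `a`. -/
def cellDrift (a : ℕ → ℕ → ι → ι → ℝ) (K : ℕ) (w y : ι → ℕ → ℝ) : ℝ :=
  (∑ c, ∑ k ∈ Finset.range K, y c k * (cellDeparture a K y c k * (w c (k - 1) - w c k)))
    + ∑ c, ∑ k ∈ Finset.range K, y c k * (cellArrival a K y c k * (w c (k + 1) - w c k))

theorem abs_cell_sum_sub_le {K : ℕ} {q : ι → ℕ → ℝ} {B : ℝ}
    (hq : ∀ c, ∀ k < K, |q c k| ≤ B) (y y' : ι → ℕ → ℝ) :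
    |(∑ c, ∑ k ∈ Finset.range K, y c k * q c k) - ∑ c, ∑ k ∈ Finset.range K, y' c k * q c k|
      ≤ B * ∑ c, ∑ k ∈ Finset.range K, |y c k - y' c k| := by
  simp only [← Finset.sum_sub_distrib, Finset.mul_sum]
  refine (Finset.abs_sum_le_sum_abs _ _).trans (Finset.sum_le_sum fun c _ =>
    (Finset.abs_sum_le_sum_abs _ _).trans (Finset.sum_le_sum fun k hk => ?_))
  rw [← sub_mul, abs_mul, mul_comm]
  exact mul_le_mul_of_nonneg_right (hq c k (Finset.mem_range.1 hk)) (abs_nonneg _)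

theorem abs_cell_sum_le {K : ℕ} {q : ι → ℕ → ℝ} {B : ℝ} (hB : 0 ≤ B)
    (hq : ∀ c, ∀ k < K, |q c k| ≤ B) {y : ι → ℕ → ℝ} (hy : ∀ c k, 0 ≤ y c k)
    (hy1 : ∑ c, ∑ k ∈ Finset.range K, y c k ≤ 1) :
    |∑ c, ∑ k ∈ Finset.range K, y c k * q c k| ≤ B := by
  have h := abs_cell_sum_sub_le hq y 0
  simp only [Pi.zero_apply, zero_mul, Finset.sum_const_zero, sub_zero, abs_of_nonneg (hy _ _)] at h
  nlinarith

/-- One of the two parts of the drift is Lipschitz in the cell weights. -/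
theorem abs_cell_bilinear_sub_le {K : ℕ} {B : ℝ} (hB : 0 ≤ B) {d : ι → ℕ → ι → ℕ → ℝ}
    (hd : ∀ c, ∀ k < K, ∀ c', ∀ l < K, |d c k c' l| ≤ B) {g : ι → ℕ → ℝ} (hg : ∀ c k, |g c k| ≤ 2)
    {y y' : ι → ℕ → ℝ} (hy : ∀ c k, 0 ≤ y c k) (hy' : ∀ c k, 0 ≤ y' c k)
    (hy1 : ∑ c, ∑ k ∈ Finset.range K, y c k ≤ 1) (hy1' : ∑ c, ∑ k ∈ Finset.range K, y' c k ≤ 1) :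
    |(∑ c, ∑ k ∈ Finset.range K,
        y c k * ((∑ c', ∑ l ∈ Finset.range K, y c' l * d c k c' l) * g c k))
      - ∑ c, ∑ k ∈ Finset.range K,
        y' c k * ((∑ c', ∑ l ∈ Finset.range K, y' c' l * d c k c' l) * g c k)|
      ≤ 4 * B * ∑ c, ∑ k ∈ Finset.range K, |y c k - y' c k| := by
  set S := ∑ c, ∑ k ∈ Finset.range K, |y c k - y' c k| with hS
  have hS0 : 0 ≤ S := Finset.sum_nonneg fun c _ => Finset.sum_nonneg fun k _ => abs_nonneg _
  have h1 : ∀ c, ∀ k < K,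
      |(∑ c', ∑ l ∈ Finset.range K, y c' l * d c k c' l) * g c k| ≤ B * 2 := fun c k hk => by
    rw [abs_mul]
    exact mul_le_mul (abs_cell_sum_le hB (hd c k hk) hy hy1) (hg c k) (abs_nonneg _) hB
  have h2 := abs_cell_sum_sub_le h1 y y'
  have h3 : ∀ c, ∀ k < K, |(∑ c', ∑ l ∈ Finset.range K, y c' l * d c k c' l) * g c k
      - (∑ c', ∑ l ∈ Finset.range K, y' c' l * d c k c' l) * g c k| ≤ B * S * 2 :=
    fun c k hk => by
      rw [← sub_mul, abs_mul]
      exact mul_le_mul (abs_cell_sum_sub_le (hd c k hk) y y') (hg c k) (abs_nonneg _)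
        (mul_nonneg hB hS0)
  have h4 := abs_cell_sum_le (by positivity) h3 hy' hy1'
  simp only [mul_sub, Finset.sum_sub_distrib] at h4
  rw [← hS] at h2
  rw [abs_le] at h2 h4 ⊢
  constructor <;> nlinarith [h2.1, h2.2, h4.1, h4.2]

theorem abs_cellDrift_sub_le {K : ℕ} {B : ℝ} (hB : 0 ≤ B) {a : ℕ → ℕ → ι → ι → ℝ}
    (ha : ∀ k < K, ∀ l, ∀ c c', |a k l c c'| ≤ B) {w : ι → ℕ → ℝ} (hw : ∀ c k, |w c k| ≤ 1)
    {y y' : ι → ℕ → ℝ} (hy : ∀ c k, 0 ≤ y c k) (hy' : ∀ c k, 0 ≤ y' c k)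
    (hy1 : ∑ c, ∑ k ∈ Finset.range K, y c k ≤ 1) (hy1' : ∑ c, ∑ k ∈ Finset.range K, y' c k ≤ 1) :
    |cellDrift a K w y - cellDrift a K w y'|
      ≤ 8 * B * ∑ c, ∑ k ∈ Finset.range K, |y c k - y' c k| := by
  have hw2 : ∀ c k l, |w c k - w c l| ≤ 2 := fun c k l =>
    (abs_sub _ _).trans (by linarith [hw c k, hw c l])
  have h1 := abs_cell_bilinear_sub_le hB (d := fun c k c' l => a k l c c')
    (fun c k hk c' l _ => ha k hk l c c') (g := fun c k => w c (k - 1) - w c k)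
    (fun c k => hw2 c _ _) hy hy' hy1 hy1'
  have h2 := abs_cell_bilinear_sub_le hB (d := fun c k c' l => a l k c' c)
    (fun c k _ c' l hl => ha l hl k c' c) (g := fun c k => w c (k + 1) - w c k)
    (fun c k => hw2 c _ _) hy hy' hy1 hy1'
  rw [cellDrift, cellDrift]
  simp only [cellDeparture, cellArrival]
  rw [abs_le] at h1 h2 ⊢
  constructor <;> linarith [h1.1, h1.2, h2.1, h2.2]

end Discrete

end MeanField

namespace MeanField

/-! ### The drift of the empirical cell weights -/

section Particle

variable {N : ℕ} {ι : Type} [Fintype ι]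

/-- The mass of particles at positions with at least `K` particles, per position. -/
noncomputable def tailMass (K : ℕ) (η : Fin N → ℕ) : ℝ :=
  (1 / (N : ℝ)) * ∑ i, if K ≤ η i then (η i : ℝ) else 0

/-- The weights of the levels `k` in the cells `c`. -/
noncomputable def cellWeight (χ : ι → C(UnitAddCircle, ℝ)) (η : Fin N → ℕ) (c : ι) (k : ℕ) : ℝ :=
  empirical η k (χ c)

theorem tailMass_nonneg (K : ℕ) (η : Fin N → ℕ) : 0 ≤ tailMass K η :=
  mul_nonneg (by positivity) (Finset.sum_nonneg fun i _ => by split_ifs <;> positivity)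

theorem average_le (hN : 1 ≤ N) {g : Fin N → ℝ} {b : ℝ} (h : ∀ i, g i ≤ b) :
    (1 / (N : ℝ)) * ∑ i, g i ≤ b := by
  have hN' : (0 : ℝ) < N := by exact_mod_cast hN
  rw [one_div, inv_mul_le_iff₀ hN']
  refine (Finset.sum_le_sum fun i _ => h i).trans_eq ?_
  simp

theorem sum_cellWeight_mul (χ : ι → C(UnitAddCircle, ℝ)) (η : Fin N → ℕ) (K : ℕ)
    (G : ι → ℕ → ℝ) :
    ∑ c, ∑ k ∈ Finset.range K, cellWeight χ η c k * G c k
      = (1 / (N : ℝ)) * ∑ i, if η i < K then ∑ c, χ c (site N i) * G c (η i) else 0 := by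
  have h1 : ∀ c, ∑ k ∈ Finset.range K, cellWeight χ η c k * G c k
      = (1 / (N : ℝ)) * ∑ i, if η i < K then χ c (site N i) * G c (η i) else 0 := by
    intro c
    simp only [cellWeight, empirical, mul_assoc, Finset.sum_mul, ← Finset.mul_sum]
    rw [Finset.sum_comm]
    congr 1
    refine Finset.sum_congr rfl fun i _ => ?_
    simp only [ite_mul, zero_mul, Finset.sum_ite_eq, Finset.mem_range]
  rw [Finset.sum_congr rfl fun c _ => h1 c, ← Finset.mul_sum, Finset.sum_comm]
  congr 1
  refine Finset.sum_congr rfl fun i _ => ?_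
  split_ifs <;> simp

theorem sum_comp_moveParticle (G : ℕ → Fin N → ℝ) (η : Fin N → ℕ) {i j : Fin N} (hij : j ≠ i) :
    ∑ l, G (moveParticle η i j l) l
      = ∑ l, G (η l) l + (G (η i - 1) i - G (η i) i) + (G (η j + 1) j - G (η j) j) := by
  classical
  have hi : i ∈ Finset.univ.erase j := Finset.mem_erase.2 ⟨hij.symm, Finset.mem_univ i⟩
  rw [← Finset.add_sum_erase _ _ (Finset.mem_univ j), ← Finset.add_sum_erase _ _ hi,
    ← Finset.add_sum_erase (a := j) Finset.univ (fun l => G (η l) l) (Finset.mem_univ j),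
    ← Finset.add_sum_erase (Finset.univ.erase j) (fun l => G (η l) l) hi]
  have h1 : moveParticle η i j j = η j + 1 := by simp [moveParticle]
  have h2 : moveParticle η i j i = η i - 1 := by
    simp [moveParticle, Function.update_of_ne hij.symm]
  have h3 : ∑ l ∈ (Finset.univ.erase j).erase i, G (moveParticle η i j l) l
      = ∑ l ∈ (Finset.univ.erase j).erase i, G (η l) l := by
    refine Finset.sum_congr rfl fun l hl => ?_
    simp only [Finset.mem_erase] at hl
    rw [moveParticle, Function.update_of_ne hl.2.1, Function.update_of_ne hl.1]
  rw [h1, h2, h3]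
  ring

variable {φ : ℕ → ℕ → UnitAddCircle → UnitAddCircle → ℝ} {C δ : ℝ} {K : ℕ}
  {χ : ι → C(UnitAddCircle, ℝ)} {a : ℕ → ℕ → ι → ι → ℝ}

theorem IsLocalization.abs_sum_mul_le (h : IsLocalization φ C K δ χ a) {g : ι → ℝ} {b : ℝ}
    (u : UnitAddCircle) (hg : ∀ c, χ c u ≠ 0 → |g c| ≤ b) : |∑ c, χ c u * g c| ≤ b := by
  refine (Finset.abs_sum_le_sum_abs _ _).trans ?_
  calc ∑ c, |χ c u * g c| ≤ ∑ c, χ c u * b := by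
        refine Finset.sum_le_sum fun c _ => ?_
        rw [abs_mul, abs_of_nonneg (h.nonneg c u)]
        by_cases hc : χ c u = 0
        · simp [hc]
        · exact mul_le_mul_of_nonneg_left (hg c hc) (h.nonneg c u)
    _ = b := by rw [← Finset.sum_mul, h.sum_eq_one, one_mul]

theorem IsLocalization.cellWeight_nonneg (h : IsLocalization φ C K δ χ a) (η : Fin N → ℕ)
    (c : ι) (k : ℕ) : 0 ≤ cellWeight χ η c k :=
  mul_nonneg (by positivity) (Finset.sum_nonneg fun i _ => by
    split_ifs
    · exact h.nonneg _ _
    · exact le_rfl)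

theorem IsLocalization.sum_cellWeight_le (h : IsLocalization φ C K δ χ a) (hN : 1 ≤ N)
    (η : Fin N → ℕ) : ∑ c, ∑ k ∈ Finset.range K, cellWeight χ η c k ≤ 1 := by
  have := sum_cellWeight_mul χ η K fun _ _ => 1
  simp only [mul_one] at this
  rw [this]
  refine average_le hN fun i => ?_
  split_ifs
  · rw [h.sum_eq_one]
  · exact zero_le_one

/-- The average of a function against the empirical measure, in terms of the cell weights. -/
theorem IsLocalization.abs_average_sub_le (h : IsLocalization φ C K δ χ a) (hN : 1 ≤ N)
    (hδ : 0 ≤ δ) {q : ℕ → UnitAddCircle → ℝ} {b : ι → ℕ → ℝ} {B : ℝ}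
    (hq : ∀ l < K, ∀ c v, χ c v ≠ 0 → |q l v - b c l| ≤ δ)
    (hq' : ∀ l, K ≤ l → ∀ v, |q l v| ≤ B * l) (η : Fin N → ℕ) :
    |(1 / (N : ℝ)) * ∑ j, q (η j) (site N j)
      - ∑ c, ∑ l ∈ Finset.range K, cellWeight χ η c l * b c l| ≤ δ + B * tailMass K η := by
  rw [sum_cellWeight_mul, ← mul_sub, ← Finset.sum_sub_distrib, abs_mul,
    abs_of_nonneg (by positivity : (0 : ℝ) ≤ 1 / N)]
  have hterm : ∀ j, |q (η j) (site N j)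
      - if η j < K then ∑ c, χ c (site N j) * b c (η j) else 0|
      ≤ δ + B * if K ≤ η j then (η j : ℝ) else 0 := by
    intro j
    by_cases hj : η j < K
    · rw [if_pos hj, if_neg (not_le.2 hj), mul_zero, add_zero]
      have := h.abs_sum_mul_le (site N j) fun c hc => hq (η j) hj c _ hc
      simpa only [mul_sub, Finset.sum_sub_distrib, ← Finset.sum_mul, h.sum_eq_one, one_mul]
        using this
    · rw [if_neg hj, if_pos (not_lt.1 hj), sub_zero]
      linarith [hq' (η j) (not_lt.1 hj) (site N j)]
  calc (1 / (N : ℝ)) * |∑ j, (q (η j) (site N j)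
        - if η j < K then ∑ c, χ c (site N j) * b c (η j) else 0)|
      ≤ (1 / (N : ℝ)) * ∑ j, (δ + B * if K ≤ η j then (η j : ℝ) else 0) :=
        mul_le_mul_of_nonneg_left ((Finset.abs_sum_le_sum_abs _ _).trans
          (Finset.sum_le_sum fun j _ => hterm j)) (by positivity)
    _ = (1 / (N : ℝ)) * ∑ _j : Fin N, δ + B * tailMass K η := by
        rw [Finset.sum_add_distrib, ← Finset.mul_sum, tailMass]
        ring
    _ ≤ δ + B * tailMass K η := by
        gcongr
        exact average_le hN fun _ => le_rfl

theorem abs_average_erase_sub_le {g : Fin N → ℝ} {b : ℝ} (i : Fin N) (hg : |g i| ≤ b) :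
    |(1 / (N : ℝ)) * ∑ j ∈ Finset.univ.erase i, g j - (1 / (N : ℝ)) * ∑ j, g j| ≤ b / N := by
  rw [← Finset.add_sum_erase _ _ (Finset.mem_univ i), mul_add, sub_add_cancel_right, abs_neg,
    abs_mul, abs_of_nonneg (by positivity : (0 : ℝ) ≤ 1 / N), one_div, inv_mul_eq_div]
  gcongr

/-- The total departure rate from the position `i`. -/
noncomputable def departureAt (φ : ℕ → ℕ → UnitAddCircle → UnitAddCircle → ℝ) (η : Fin N → ℕ)
    (i : Fin N) : ℝ :=
  (1 / (N : ℝ)) * ∑ j ∈ Finset.univ.erase i, φ (η i) (η j) (site N i) (site N j)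

/-- The total arrival rate at the position `i`. -/
noncomputable def arrivalAt (φ : ℕ → ℕ → UnitAddCircle → UnitAddCircle → ℝ) (η : Fin N → ℕ)
    (i : Fin N) : ℝ :=
  (1 / (N : ℝ)) * ∑ j ∈ Finset.univ.erase i, φ (η j) (η i) (site N j) (site N i)

theorem BoundedRates.departureAt_mem (hφ : BoundedRates φ C) (hN : 1 ≤ N) (η : Fin N → ℕ)
    (i : Fin N) : 0 ≤ departureAt φ η i ∧ departureAt φ η i ≤ C * η i := by
  have hn : ∀ j, 0 ≤ φ (η i) (η j) (site N i) (site N j) := fun j => hφ.nonneg _ _ _ _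
  refine ⟨mul_nonneg (by positivity) (Finset.sum_nonneg fun j _ => hn j), ?_⟩
  refine le_trans (mul_le_mul_of_nonneg_left (Finset.sum_le_sum_of_subset_of_nonneg
    (Finset.erase_subset _ _) fun j _ _ => hn j) (by positivity)) ?_
  exact average_le hN fun j => hφ.le _ _ _ _

/-- Three errors: `δ` from freezing the rates on cells, `C * tailMass` from partners at levels `K`
and above, and `C * K / N` from the excluded term `j = i`. -/
theorem IsLocalization.abs_departureAt_sub_le (h : IsLocalization φ C K δ χ a)
    (hφ : BoundedRates φ C) (hN : 1 ≤ N) (hδ : 0 ≤ δ) (η : Fin N → ℕ) {i : Fin N} (hi : η i < K)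
    {c : ι} (hc : χ c (site N i) ≠ 0) :
    |departureAt φ η i - cellDeparture a K (cellWeight χ η) c (η i)|
      ≤ δ + C * tailMass K η + C * K / N := by
  have hiK : ((η i : ℕ) : ℝ) ≤ K := by exact_mod_cast hi.le
  have h1 := h.abs_average_sub_le hN hδ (q := fun l v => φ (η i) l (site N i) v)
    (b := fun c' l => a (η i) l c c') (fun l hl c' v hv => h.close _ hi _ hl _ _ _ _ hc hv)
    (fun l hl v => (hφ.abs_rate_le _ _ _ _).trans (mul_le_mul_of_nonneg_left
      (by exact_mod_cast hi.le.trans hl) hφ.const_nonneg)) η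
  have h2 := abs_average_erase_sub_le (g := fun j => φ (η i) (η j) (site N i) (site N j)) i
    ((hφ.abs_rate_le _ _ _ _).trans (mul_le_mul_of_nonneg_left hiK hφ.const_nonneg))
  have := abs_add_le _ _ |>.trans (add_le_add h2 h1)
  rw [sub_add_sub_cancel] at this
  rw [add_comm (δ + _)]
  exact this

theorem IsLocalization.abs_arrivalAt_sub_le (h : IsLocalization φ C K δ χ a)
    (hφ : BoundedRates φ C) (hN : 1 ≤ N) (hδ : 0 ≤ δ) (η : Fin N → ℕ) {i : Fin N} (hi : η i < K)
    {c : ι} (hc : χ c (site N i) ≠ 0) :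
    |arrivalAt φ η i - cellArrival a K (cellWeight χ η) c (η i)|
      ≤ δ + C * tailMass K η + C * K / N := by
  have hiK : ((η i : ℕ) : ℝ) ≤ K := by exact_mod_cast hi.le
  have h1 := h.abs_average_sub_le hN hδ (q := fun l v => φ l (η i) v (site N i))
    (b := fun c' l => a l (η i) c' c) (fun l hl c' v hv => h.close _ hl _ hi _ _ _ _ hv hc)
    (fun l hl v => hφ.abs_rate_le _ _ _ _) η
  have h2 := abs_average_erase_sub_le (g := fun j => φ (η j) (η i) (site N j) (site N i)) i
    ((hφ.abs_rate_le _ _ _ _).trans (mul_le_mul_of_nonneg_left hiK hφ.const_nonneg))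
  have := abs_add_le _ _ |>.trans (add_le_add h2 h1)
  rw [sub_add_sub_cancel] at this
  rw [add_comm (δ + _)]
  exact this

/-- If a jump changes a function by a part depending on the origin and a part depending on the
target, summing over the other site leaves the total departure and arrival rates. -/
theorem generator_linear (η : Fin N → ℕ) (φ : ℕ → ℕ → UnitAddCircle → UnitAddCircle → ℝ)
    (A B : Fin N → ℝ) :
    (1 / (N : ℝ)) * ∑ i : Fin N, ∑ j ∈ Finset.univ.erase i,
      φ (η i) (η j) (site N i) (site N j) * ((1 / (N : ℝ)) * (A i + B j))
      = (1 / (N : ℝ)) * ∑ i, departureAt φ η i * A i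
        + (1 / (N : ℝ)) * ∑ i, arrivalAt φ η i * B i := by
  have h1 : ∑ i : Fin N, ∑ j ∈ Finset.univ.erase i,
      φ (η i) (η j) (site N i) (site N j) * ((1 / (N : ℝ)) * B j)
      = ∑ j, arrivalAt φ η j * B j := by
    rw [Finset.sum_comm' (t' := Finset.univ) (s' := fun j => Finset.univ.erase j)
      (by intro x y; simp [eq_comm])]
    refine Finset.sum_congr rfl fun j _ => ?_
    rw [arrivalAt, mul_assoc, Finset.sum_mul, Finset.mul_sum]
    exact Finset.sum_congr rfl fun i _ => by ring
  have h2 : ∑ i : Fin N, ∑ j ∈ Finset.univ.erase i,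
      φ (η i) (η j) (site N i) (site N j) * ((1 / (N : ℝ)) * A i)
      = ∑ j, departureAt φ η j * A j := by
    refine Finset.sum_congr rfl fun j _ => ?_
    rw [departureAt, mul_assoc, Finset.sum_mul, Finset.mul_sum]
    exact Finset.sum_congr rfl fun i _ => by ring
  simp only [mul_add, Finset.sum_add_distrib] at h1 h2 ⊢
  rw [h1, h2]

theorem IsLocalization.abs_cell_average_sub_le (h : IsLocalization φ C K δ χ a)
    {η : Fin N → ℕ} {D W : Fin N → ℝ} {d g : ι → ℕ → ℝ} {E B : ℝ} (hN : 1 ≤ N)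
    (hE : 0 ≤ E) (hg : ∀ c k, |g c k| ≤ 2)
    (hd : ∀ i, η i < K → ∀ c, χ c (site N i) ≠ 0 → |D i - d c (η i)| ≤ E)
    (hW : ∀ i, η i < K → W i = ∑ c, χ c (site N i) * g c (η i))
    (hDW : ∀ i, K ≤ η i → |D i * W i| ≤ B * η i) :
    |(1 / (N : ℝ)) * ∑ i, D i * W i
      - ∑ c, ∑ k ∈ Finset.range K, cellWeight χ η c k * (d c k * g c k)|
      ≤ 2 * E + B * tailMass K η := by
  rw [sum_cellWeight_mul, ← mul_sub, ← Finset.sum_sub_distrib, abs_mul,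
    abs_of_nonneg (by positivity : (0 : ℝ) ≤ 1 / N)]
  have hterm : ∀ i, |D i * W i
      - if η i < K then ∑ c, χ c (site N i) * (d c (η i) * g c (η i)) else 0|
      ≤ 2 * E + B * if K ≤ η i then (η i : ℝ) else 0 := by
    intro i
    by_cases hi : η i < K
    · rw [if_pos hi, if_neg (not_le.2 hi), mul_zero, add_zero, hW i hi, Finset.mul_sum,
        ← Finset.sum_sub_distrib]
      refine le_of_eq_of_le ?_ (h.abs_sum_mul_le (site N i)
        (g := fun c => (D i - d c (η i)) * g c (η i)) fun c hc => ?_)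
      · congr 1
        exact Finset.sum_congr rfl fun c _ => by ring
      · rw [abs_mul, mul_comm]
        exact mul_le_mul (hg _ _) (hd i hi c hc) (abs_nonneg _) zero_le_two
    · rw [if_neg hi, if_pos (not_lt.1 hi), sub_zero]
      linarith [hDW i (not_lt.1 hi)]
  calc (1 / (N : ℝ)) * |∑ i, (D i * W i
        - if η i < K then ∑ c, χ c (site N i) * (d c (η i) * g c (η i)) else 0)|
      ≤ (1 / (N : ℝ)) * ∑ i, (2 * E + B * if K ≤ η i then (η i : ℝ) else 0) :=
        mul_le_mul_of_nonneg_left ((Finset.abs_sum_le_sum_abs _ _).trans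
          (Finset.sum_le_sum fun j _ => hterm j)) (by positivity)
    _ = (1 / (N : ℝ)) * ∑ _j : Fin N, 2 * E + B * tailMass K η := by
        rw [Finset.sum_add_distrib, ← Finset.mul_sum Finset.univ _ B, tailMass]
        ring
    _ ≤ 2 * E + B * tailMass K η := by
        exact add_le_add_left (average_le hN fun _ => le_rfl) _

/-- The generator on linear functions of the cell weights. -/
theorem IsLocalization.abs_generator_linear_sub_le (h : IsLocalization φ C K δ χ a)
    (hφ : BoundedRates φ C) (hN : 1 ≤ N) (hδ : 0 ≤ δ) (η : Fin N → ℕ) {w : ι → ℕ → ℝ}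
    (hw : ∀ c k, |w c k| ≤ 1) (hwK : ∀ c k, K ≤ k → w c k = 0) :
    |(1 / (N : ℝ)) * ∑ i : Fin N, ∑ j ∈ Finset.univ.erase i,
        φ (η i) (η j) (site N i) (site N j) * ((1 / (N : ℝ)) *
          (∑ c, χ c (site N i) * (w c (η i - 1) - w c (η i))
            + ∑ c, χ c (site N j) * (w c (η j + 1) - w c (η j))))
      - cellDrift a K w (cellWeight χ η)|
      ≤ 4 * (δ + C * tailMass K η + C * K / N) + C * tailMass K η := by
  have hC := hφ.const_nonneg
  have hw2 : ∀ c k l, |w c k - w c l| ≤ 2 := fun c k l =>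
    (abs_sub _ _).trans (by linarith [hw c k, hw c l])
  have hE : 0 ≤ δ + C * tailMass K η + C * K / N := by
    have := mul_nonneg hC (tailMass_nonneg K η)
    positivity
  rw [generator_linear η φ (fun i => ∑ c, χ c (site N i) * (w c (η i - 1) - w c (η i)))
    fun j => ∑ c, χ c (site N j) * (w c (η j + 1) - w c (η j)), cellDrift]
  -- At a site with level at least `K` only `w` at level `η i - 1` can be nonzero, namely for a
  -- departure from level `K`. Its rate is at most `C * η i`, whence `B = C`.
  have h1 := h.abs_cell_average_sub_le (η := η) (D := departureAt φ η)
    (W := fun i => ∑ c, χ c (site N i) * (w c (η i - 1) - w c (η i)))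
    (g := fun c k => w c (k - 1) - w c k) (B := C) hN hE (fun c k => hw2 c _ _)
    (fun i hi c hc => h.abs_departureAt_sub_le hφ hN hδ η hi hc) (fun i _ => rfl)
    (fun i hi => by
      have hD := hφ.departureAt_mem hN η i
      rw [abs_mul, abs_of_nonneg hD.1]
      have : |∑ c, χ c (site N i) * (w c (η i - 1) - w c (η i))| ≤ 1 :=
        h.abs_sum_mul_le _ fun c _ => by rw [hwK c _ hi, sub_zero]; exact hw _ _
      nlinarith [abs_nonneg (∑ c, χ c (site N i) * (w c (η i - 1) - w c (η i)))])
  -- An arrival at a site of level at least `K` stays where `w` vanishes, whence `B = 0`.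
  have h2 := h.abs_cell_average_sub_le (η := η) (D := arrivalAt φ η)
    (W := fun i => ∑ c, χ c (site N i) * (w c (η i + 1) - w c (η i)))
    (g := fun c k => w c (k + 1) - w c k) (B := 0) hN hE (fun c k => hw2 c _ _)
    (fun i hi c hc => h.abs_arrivalAt_sub_le hφ hN hδ η hi hc) (fun i _ => rfl)
    (fun i hi => by
      rw [Finset.sum_eq_zero fun c _ => by rw [hwK c _ hi, hwK c _ (hi.trans (Nat.le_succ _)),
        sub_zero, mul_zero]]
      simp)
  rw [abs_le] at h1 h2 ⊢
  constructor <;> linarith [h1.1, h1.2, h2.1, h2.2]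

/-- The smoothed distance of the cell weights from given weights. -/
noncomputable def smoothDist (β : ℝ) (K : ℕ) (χ : ι → C(UnitAddCircle, ℝ)) (y : ι → ℕ → ℝ)
    (η : Fin N → ℕ) : ℝ :=
  ∑ c, ∑ k ∈ Finset.range K, smoothAbs β (cellWeight χ η c k - y c k)

/-- The gradient of `smoothDist` in the cell weights. -/
noncomputable def smoothSign (β : ℝ) (K : ℕ) (χ : ι → C(UnitAddCircle, ℝ)) (y : ι → ℕ → ℝ)
    (η : Fin N → ℕ) (c : ι) (k : ℕ) : ℝ :=
  if k < K then
    (cellWeight χ η c k - y c k) / smoothAbs β (cellWeight χ η c k - y c k) else 0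

omit [Fintype ι] in
theorem abs_smoothSign_le_one {β : ℝ} (hβ : 0 < β) (K : ℕ) (χ : ι → C(UnitAddCircle, ℝ))
    (y : ι → ℕ → ℝ) (η : Fin N → ℕ) (c : ι) (k : ℕ) : |smoothSign β K χ y η c k| ≤ 1 := by
  rw [smoothSign]
  split_ifs
  · exact abs_div_smoothAbs_le_one hβ _
  · simp

omit [Fintype ι] in
theorem smoothSign_eq_zero (β : ℝ) (χ : ι → C(UnitAddCircle, ℝ)) (y : ι → ℕ → ℝ)
    (η : Fin N → ℕ) (c : ι) {k : ℕ} (hk : K ≤ k) : smoothSign β K χ y η c k = 0 :=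
  if_neg (not_lt.2 hk)

omit [Fintype ι] in
theorem cellWeight_moveParticle (χ : ι → C(UnitAddCircle, ℝ)) (η : Fin N → ℕ) {i j : Fin N}
    (hij : j ≠ i) (c : ι) (k : ℕ) :
    cellWeight χ (moveParticle η i j) c k = cellWeight χ η c k + (1 / (N : ℝ)) *
      (χ c (site N i) * ((if η i - 1 = k then 1 else 0) - if η i = k then 1 else 0)
        + χ c (site N j) * ((if η j + 1 = k then 1 else 0) - if η j = k then 1 else 0)) := by
  rw [cellWeight, cellWeight, empirical, empirical,
    sum_comp_moveParticle (fun n l => if n = k then χ c (site N l) else 0) η hij]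
  simp only [mul_sub, mul_ite, mul_one, mul_zero]
  ring

/-- A jump moves the cell weights by `d / N` with `∑ d ^ 2 ≤ 16`, however many cells there are,
because `χ` sums to one. The linear Taylor term pairs `d` with `smoothSign`, and the quadratic one
is `16 / (2 * β * N ^ 2)`. -/
theorem IsLocalization.smoothDist_moveParticle_le (h : IsLocalization φ C K δ χ a) {β : ℝ}
    (hβ : 0 < β) (y : ι → ℕ → ℝ) (η : Fin N → ℕ) {i j : Fin N} (hij : j ≠ i) :
    smoothDist β K χ y (moveParticle η i j) - smoothDist β K χ y η
      ≤ (1 / (N : ℝ)) *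
        (∑ c, χ c (site N i) * (smoothSign β K χ y η c (η i - 1) - smoothSign β K χ y η c (η i))
        + ∑ c, χ c (site N j) * (smoothSign β K χ y η c (η j + 1) - smoothSign β K χ y η c (η j)))
        + 8 / (β * N ^ 2) := by
  set w := smoothSign β K χ y η with hw
  set d : ι → ℕ → ℝ := fun c k =>
    χ c (site N i) * ((if η i - 1 = k then 1 else 0) - if η i = k then 1 else 0)
      + χ c (site N j) * ((if η j + 1 = k then 1 else 0) - if η j = k then 1 else 0) with hd
  have hpick : ∀ c n, ∑ k ∈ Finset.range K, w c k * (if n = k then (1 : ℝ) else 0) = w c n := by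
    intro c n
    simp only [mul_ite, mul_one, mul_zero, Finset.sum_ite_eq, Finset.mem_range]
    split_ifs with hn
    · rfl
    · exact (smoothSign_eq_zero β χ y η c (not_lt.1 hn)).symm
  have hlin : ∑ c, ∑ k ∈ Finset.range K, w c k * d c k
      = ∑ c, χ c (site N i) * (w c (η i - 1) - w c (η i))
        + ∑ c, χ c (site N j) * (w c (η j + 1) - w c (η j)) := by
    rw [← Finset.sum_add_distrib]
    refine Finset.sum_congr rfl fun c _ => ?_
    rw [← hpick c (η i - 1), ← hpick c (η i), ← hpick c (η j + 1), ← hpick c (η j),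
      ← Finset.sum_sub_distrib, ← Finset.sum_sub_distrib, Finset.mul_sum, Finset.mul_sum,
      ← Finset.sum_add_distrib]
    exact Finset.sum_congr rfl fun k _ => by simp only [hd]; ring
  have hχ1 : ∀ c u, χ c u ≤ 1 := fun c u => by
    exact (Finset.single_le_sum (fun c _ => h.nonneg c u) (Finset.mem_univ c)).trans_eq
      (h.sum_eq_one u)
  have hsq : ∀ c k, d c k ^ 2 ≤ 4 *
      (χ c (site N i) * ((if η i - 1 = k then 1 else 0) + if η i = k then 1 else 0)
        + χ c (site N j) * ((if η j + 1 = k then 1 else 0) + if η j = k then 1 else 0)) := by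
    intro c k
    have hb : ∀ p q : Prop, ∀ [Decidable p] [Decidable q], ∀ x : ℝ, 0 ≤ x → x ≤ 1 →
        2 * (x * ((if p then 1 else 0) - if q then 1 else 0)) ^ 2
          ≤ 4 * (x * ((if p then 1 else 0) + if q then 1 else 0)) := by
      intro p q _ _ x hx hx1
      split_ifs <;> nlinarith
    have h1 := hb (η i - 1 = k) (η i = k) _ (h.nonneg c (site N i)) (hχ1 c _)
    have h2 := hb (η j + 1 = k) (η j = k) _ (h.nonneg c (site N j)) (hχ1 c _)
    simp only [hd]
    nlinarith [sq_nonneg (χ c (site N i) * ((if η i - 1 = k then 1 else 0)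
      - if η i = k then 1 else 0) - χ c (site N j) * ((if η j + 1 = k then 1 else 0)
      - if η j = k then 1 else 0))]
  have hsum1 : ∀ n, ∑ k ∈ Finset.range K, (if n = k then (1 : ℝ) else 0) ≤ 1 := fun n => by
    rw [Finset.sum_ite_eq]
    split_ifs <;> simp
  have hsqsum : ∑ c, ∑ k ∈ Finset.range K, d c k ^ 2 ≤ 16 := by
    calc ∑ c, ∑ k ∈ Finset.range K, d c k ^ 2
        ≤ ∑ c, (8 * χ c (site N i) + 8 * χ c (site N j)) := by
          refine Finset.sum_le_sum fun c _ => (Finset.sum_le_sum fun k _ => hsq c k).trans ?_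
          rw [← Finset.mul_sum, Finset.sum_add_distrib, ← Finset.mul_sum, ← Finset.mul_sum,
            Finset.sum_add_distrib, Finset.sum_add_distrib]
          have e1 := mul_le_mul_of_nonneg_left (add_le_add (hsum1 (η i - 1)) (hsum1 (η i)))
            (h.nonneg c (site N i))
          have e2 := mul_le_mul_of_nonneg_left (add_le_add (hsum1 (η j + 1)) (hsum1 (η j)))
            (h.nonneg c (site N j))
          linarith
      _ = 16 := by
          rw [Finset.sum_add_distrib, ← Finset.mul_sum, ← Finset.mul_sum, h.sum_eq_one,
            h.sum_eq_one]
          norm_num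
  have hstep : ∀ c, ∀ k ∈ Finset.range K,
      smoothAbs β (cellWeight χ (moveParticle η i j) c k - y c k)
        - smoothAbs β (cellWeight χ η c k - y c k)
      ≤ (1 / (N : ℝ)) * (w c k * d c k) + 1 / (2 * β * N ^ 2) * d c k ^ 2 := by
    intro c k hk
    have := smoothAbs_add_le hβ (cellWeight χ η c k - y c k) ((1 / (N : ℝ)) * d c k)
    rw [cellWeight_moveParticle χ η hij, add_sub_right_comm]
    have hwk : w c k = (cellWeight χ η c k - y c k) / smoothAbs β (cellWeight χ η c k - y c k) :=
      if_pos (Finset.mem_range.1 hk)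
    rw [← hwk] at this
    have e : ((1 / (N : ℝ)) * d c k) ^ 2 / (2 * β) = 1 / (2 * β * N ^ 2) * d c k ^ 2 := by
      rw [mul_pow, one_div, one_div, mul_inv, inv_pow]
      ring
    rw [e] at this
    linarith
  rw [smoothDist, smoothDist, ← Finset.sum_sub_distrib]
  calc ∑ c, (∑ k ∈ Finset.range K, smoothAbs β (cellWeight χ (moveParticle η i j) c k - y c k)
        - ∑ k ∈ Finset.range K, smoothAbs β (cellWeight χ η c k - y c k))
      ≤ ∑ c, ∑ k ∈ Finset.range K,
          ((1 / (N : ℝ)) * (w c k * d c k) + 1 / (2 * β * N ^ 2) * d c k ^ 2) := by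
        refine Finset.sum_le_sum fun c _ => ?_
        rw [← Finset.sum_sub_distrib]
        exact Finset.sum_le_sum (hstep c)
    _ = (1 / (N : ℝ)) * ∑ c, ∑ k ∈ Finset.range K, w c k * d c k
          + 1 / (2 * β * N ^ 2) * ∑ c, ∑ k ∈ Finset.range K, d c k ^ 2 := by
        simp only [Finset.sum_add_distrib, Finset.mul_sum]
    _ ≤ _ := by
        rw [hlin]
        have e : (8 : ℝ) / (β * N ^ 2) = 1 / (2 * β * N ^ 2) * 16 := by
          rw [mul_assoc 2, one_div, mul_inv]
          ring
        rw [e]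
        gcongr

/-- The generator on the smoothed distance. -/
theorem IsLocalization.generator_smoothDist_le (h : IsLocalization φ C K δ χ a)
    (hφ : BoundedRates φ C) (hN : 1 ≤ N) (hδ : 0 ≤ δ) {β : ℝ} (hβ : 0 < β) (y : ι → ℕ → ℝ)
    {M : ℕ} {η : Fin N → ℕ} (hη : ∑ i, η i ≤ M * N) :
    generator N φ (smoothDist β K χ y) η
      ≤ cellDrift a K (smoothSign β K χ y η) (cellWeight χ η)
        + (4 * (δ + C * tailMass K η + C * K / N) + C * tailMass K η)
        + 8 * C * M / (β * N) := by
  have hC := hφ.const_nonneg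
  have hN' : (0 : ℝ) < N := by exact_mod_cast hN
  set J : Fin N → Fin N → ℝ := fun i j => (1 / (N : ℝ)) *
    (∑ c, χ c (site N i) * (smoothSign β K χ y η c (η i - 1) - smoothSign β K χ y η c (η i))
      + ∑ c, χ c (site N j) * (smoothSign β K χ y η c (η j + 1) - smoothSign β K χ y η c (η j)))
   
  have h1 : (1 / (N : ℝ)) * ∑ i : Fin N, ∑ j ∈ Finset.univ.erase i,
      φ (η i) (η j) (site N i) (site N j) * J i j - _ ≤ _ :=
    (abs_le.1 (h.abs_generator_linear_sub_le hφ hN hδ η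
      (abs_smoothSign_le_one hβ K χ y η) fun c k hk => smoothSign_eq_zero β χ y η c hk)).2
  have h2 : generator N φ (smoothDist β K χ y) η
      ≤ (1 / (N : ℝ)) * ∑ i : Fin N, ∑ j ∈ Finset.univ.erase i,
          φ (η i) (η j) (site N i) (site N j) * (J i j + 8 / (β * N ^ 2)) := by
    rw [generator]
    refine mul_le_mul_of_nonneg_left (Finset.sum_le_sum fun i _ => Finset.sum_le_sum fun j hj =>
      mul_le_mul_of_nonneg_left ?_ (hφ.nonneg _ _ _ _)) (by positivity)
    exact h.smoothDist_moveParticle_le hβ y η (Finset.ne_of_mem_erase hj)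
  -- The total jump rate is at most `C` times the number of particles, hence `C * M * N` on the
  -- block; each jump contributes the second-order error `8 / (β * N ^ 2)`.
  have h3 : (1 / (N : ℝ)) * ∑ i : Fin N, ∑ j ∈ Finset.univ.erase i,
      φ (η i) (η j) (site N i) (site N j) * (8 / (β * N ^ 2)) ≤ 8 * C * M / (β * N) := by
    have h4 : (1 / (N : ℝ)) * ∑ i : Fin N, ∑ j ∈ Finset.univ.erase i,
        φ (η i) (η j) (site N i) (site N j) * (8 / (β * N ^ 2))
        = (∑ i, departureAt φ η i) * (8 / (β * N ^ 2)) := by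
      simp only [departureAt, Finset.sum_mul, Finset.mul_sum, mul_assoc]
    have h5 : ∑ i, departureAt φ η i ≤ C * (M * N) := by
      calc ∑ i, departureAt φ η i ≤ ∑ i, C * (η i : ℝ) :=
            Finset.sum_le_sum fun i _ => (hφ.departureAt_mem hN η i).2
        _ = C * ∑ i, (η i : ℝ) := by rw [Finset.mul_sum]
        _ ≤ C * (M * N) := mul_le_mul_of_nonneg_left (by exact_mod_cast hη) hC
    rw [h4]
    calc (∑ i, departureAt φ η i) * (8 / (β * N ^ 2)) ≤ C * (M * N) * (8 / (β * N ^ 2)) := by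
          gcongr
      _ = 8 * C * M / (β * N) := by field_simp
  simp only [mul_add, Finset.sum_add_distrib] at h2
  linarith

end Particle

end MeanField

namespace MeanField

/-! ### The drift of the cell weights of a solution -/

section Profile

variable {ι : Type} [Fintype ι] {φ : ℕ → ℕ → UnitAddCircle → UnitAddCircle → ℝ} {C δ m τ : ℝ}
  {K : ℕ} {χ : ι → C(UnitAddCircle, ℝ)} {a : ℕ → ℕ → ι → ι → ℝ} {r : ℕ → C(UnitAddCircle, ℝ)}

/-- The weights of the levels `k` in the cells `c`. -/
noncomputable def profileWeight (χ : ι → C(UnitAddCircle, ℝ)) (r : ℕ → C(UnitAddCircle, ℝ))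
    (c : ι) (k : ℕ) : ℝ :=
  ∫ u, χ c u * r k u

theorem sum_profileWeight_mul (χ : ι → C(UnitAddCircle, ℝ)) (r : ℕ → C(UnitAddCircle, ℝ))
    (K : ℕ) (G : ι → ℕ → ℝ) :
    ∑ c, ∑ k ∈ Finset.range K, profileWeight χ r c k * G c k
      = ∫ u, ∑ k ∈ Finset.range K, r k u * ∑ c, χ c u * G c k := by
  rw [integral_finsetSum _ fun k _ => integrable_of_continuous (by fun_prop), Finset.sum_comm]
  refine Finset.sum_congr rfl fun k _ => ?_
  simp only [Finset.mul_sum]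
  rw [integral_finsetSum _ fun c _ => integrable_of_continuous (by fun_prop)]
  refine Finset.sum_congr rfl fun c _ => ?_
  rw [profileWeight, ← integral_mul_const]
  exact integral_congr_ae (Eventually.of_forall fun u => by ring)

theorem IsLocalization.profileWeight_nonneg (h : IsLocalization φ C K δ χ a)
    (hr : IsProfile m r) (c : ι) (k : ℕ) : 0 ≤ profileWeight χ r c k :=
  integral_nonneg fun u => mul_nonneg (h.nonneg c u) (hr.nonneg k u)

theorem abs_integral_sub_le {f g : UnitAddCircle → ℝ} (hf : Continuous f) (hg : Continuous g)
    {b : ℝ} (h : ∀ u, |f u - g u| ≤ b) : |(∫ u, f u) - ∫ u, g u| ≤ b := by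
  rw [← integral_sub (integrable_of_continuous hf) (integrable_of_continuous hg)]
  exact abs_integral_le_integral_abs.trans (integral_le_of_le (hf.sub hg).abs h)

theorem IsLocalization.sum_profileWeight_le (h : IsLocalization φ C K δ χ a)
    (hr : IsProfile m r) : ∑ c, ∑ k ∈ Finset.range K, profileWeight χ r c k ≤ 1 := by
  have := sum_profileWeight_mul χ r K fun _ _ => 1
  simp only [mul_one, h.sum_eq_one] at this
  rw [this]
  exact integral_le_of_le (by fun_prop) fun u => hr.mass_le K u

theorem abs_sum_mul_le_of_mass_le (hr : IsProfile m r) (u : UnitAddCircle) {g : ℕ → ℝ} {b : ℝ}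
    (hb : 0 ≤ b) (hg : ∀ k < K, |g k| ≤ b) : |∑ k ∈ Finset.range K, r k u * g k| ≤ b := by
  refine (Finset.abs_sum_le_sum_abs _ _).trans ?_
  calc ∑ k ∈ Finset.range K, |r k u * g k| ≤ ∑ k ∈ Finset.range K, r k u * b := by
        refine Finset.sum_le_sum fun k hk => ?_
        rw [abs_mul, abs_of_nonneg (hr.nonneg k u)]
        exact mul_le_mul_of_nonneg_left (hg k (Finset.mem_range.1 hk)) (hr.nonneg k u)
    _ = (∑ k ∈ Finset.range K, r k u) * b := by rw [Finset.sum_mul]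
    _ ≤ b := mul_le_of_le_one_left hb (hr.mass_le K u)

theorem IsLocalization.abs_sum_integral_sub_le (h : IsLocalization φ C K δ χ a)
    (hr : IsProfile m r) (hδ : 0 ≤ δ) {q : ℕ → UnitAddCircle → ℝ} {b : ι → ℕ → ℝ}
    (hqc : ∀ l, Continuous (q l)) (hq : ∀ l < K, ∀ c v, χ c v ≠ 0 → |q l v - b c l| ≤ δ) :
    |(∑ l ∈ Finset.range K, ∫ v, q l v * r l v)
      - ∑ c, ∑ l ∈ Finset.range K, profileWeight χ r c l * b c l| ≤ δ := by
  rw [sum_profileWeight_mul, ← integral_finsetSum _ fun l _ =>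
    integrable_of_continuous (f := fun v => q l v * r l v) ((hqc l).mul (r l).continuous)]
  refine abs_integral_sub_le (f := fun v => ∑ l ∈ Finset.range K, q l v * r l v)
    (continuous_finsetSum _ fun l _ => (hqc l).mul (r l).continuous) (by fun_prop) fun v => ?_
  rw [← Finset.sum_sub_distrib]
  refine le_of_eq_of_le ?_ (abs_sum_mul_le_of_mass_le (K := K) hr v
    (g := fun l => q l v - ∑ c, χ c v * b c l) hδ fun l hl => ?_)
  · congr 1
    exact Finset.sum_congr rfl fun l _ => by ring
  · have := h.abs_sum_mul_le v fun c hc => hq l hl c v hc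
    simpa only [mul_sub, Finset.sum_sub_distrib, ← Finset.sum_mul, h.sum_eq_one, one_mul]
      using this

theorem abs_sub_le_of_split_left {x s d e b : ℝ} (hx : 0 ≤ x - s ∧ x - s ≤ e)
    (hs : |s - d| ≤ b) : |x - d| ≤ b + e := by
  rw [abs_le] at hs ⊢
  constructor <;> linarith [hx.1, hx.2, hs.1, hs.2]

theorem IsLocalization.abs_departureRate_sub_le (h : IsLocalization φ C K δ χ a)
    (hφ : BoundedRates φ C) (hr : IsProfile m r) (hτ : TailBound K τ r) (hK : 1 ≤ K)
    (hδ : 0 ≤ δ) {k : ℕ} (hk : k < K) {c : ι} {u : UnitAddCircle} (hc : χ c u ≠ 0) :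
    |departureRate φ r k u - cellDeparture a K (profileWeight χ r) c k| ≤ δ + C * K * τ := by
  have hkK : C * k * τ ≤ C * K * τ :=
    mul_le_mul_of_nonneg_right (mul_le_mul_of_nonneg_left (by exact_mod_cast hk.le)
      hφ.const_nonneg) hτ.nonneg
  exact (abs_sub_le_of_split_left (hφ.departure_split hr hτ hK k u).2
    (h.abs_sum_integral_sub_le hr hδ (fun l => hφ.continuous_right k l u)
      fun _ hl _ _ hv => h.close _ hk _ hl _ _ _ _ hc hv)).trans (by linarith)

theorem IsLocalization.abs_arrivalRate_sub_le (h : IsLocalization φ C K δ χ a)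
    (hφ : BoundedRates φ C) (hr : IsProfile m r) (hτ : TailBound K τ r)
    (hδ : 0 ≤ δ) {k : ℕ} (hk : k < K) {c : ι} {u : UnitAddCircle} (hc : χ c u ≠ 0) :
    |arrivalRate φ r k u - cellArrival a K (profileWeight χ r) c k| ≤ δ + C * τ :=
  abs_sub_le_of_split_left (hφ.arrival_split hr hτ k u)
    (h.abs_sum_integral_sub_le hr hδ (fun l => hφ.continuous_left l k u)
      fun _ hl _ _ hv => h.close _ hl _ hk _ _ _ _ hv hc)

/-- The time derivative of linear functions of the cell weights of a solution. -/
theorem IsLocalization.abs_sum_meanFieldRHS_sub_le (h : IsLocalization φ C K δ χ a)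
    (hφ : BoundedRates φ C) (hr : IsProfile m r) (hτ : TailBound K τ r) (hK : 1 ≤ K)
    (hδ : 0 ≤ δ) {R : ℕ → C(UnitAddCircle, ℝ)} (hR : ∀ k u, R k u = meanFieldRHS φ r k u)
    {w : ι → ℕ → ℝ} (hw : ∀ c k, |w c k| ≤ 1) (hwK : ∀ c k, K ≤ k → w c k = 0) :
    |(∑ c, ∑ k ∈ Finset.range K, profileWeight χ R c k * w c k)
      - cellDrift a K w (profileWeight χ r)|
      ≤ 2 * (δ + C * K * τ) + 2 * (δ + C * τ) + C * τ := by
  have hC := hφ.const_nonneg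
  have hτ0 := hτ.nonneg
  have hw2 : ∀ c k l, |w c k - w c l| ≤ 2 := fun c k l =>
    (abs_sub _ _).trans (by linarith [hw c k, hw c l])
  rw [cellDrift, sum_profileWeight_mul, sum_profileWeight_mul, sum_profileWeight_mul,
    ← integral_add (integrable_of_continuous (by fun_prop))
      (integrable_of_continuous (by fun_prop))]
  refine abs_integral_sub_le (by fun_prop) (by fun_prop) fun u => ?_
  -- With `K = n + 1` the arrival flux out of level `n` is multiplied by `w` at level `K`, which is
  -- zero. The departure flux out of level `K` remains and is bounded in `h3` by the tail.
  obtain ⟨n, rfl⟩ : ∃ n, K = n + 1 := ⟨K - 1, by omega⟩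
  have hparts := hφ.sum_mul_meanFieldRHS (r := r) (fun k => ∑ c, χ c u * w c k) n u
  have hzero : ∑ c, χ c u * w c (n + 1) = 0 :=
    Finset.sum_eq_zero fun c _ => by rw [hwK c _ le_rfl, mul_zero]
  rw [hzero, zero_mul, sub_zero] at hparts
  have hG : ∑ k ∈ Finset.range (n + 1), R k u * ∑ c, χ c u * w c k
      = ∑ k ∈ Finset.range (n + 1), (∑ c, χ c u * w c k) * meanFieldRHS φ r k u :=
    Finset.sum_congr rfl fun k _ => by rw [hR, mul_comm]
  rw [hG, hparts]
  have hpart : ∀ (D : ℕ → ℝ) (d g : ι → ℕ → ℝ) (v : ℕ → ℝ) (E : ℝ), 0 ≤ E →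
      (∀ c k, |g c k| ≤ 2) →
      (∀ k < n + 1, ∀ c, χ c u ≠ 0 → |D k - d c k| ≤ E) →
      (∀ k, v k = ∑ c, χ c u * g c k) →
      |∑ k ∈ Finset.range (n + 1), r k u * D k * v k
        - ∑ k ∈ Finset.range (n + 1), r k u * ∑ c, χ c u * (d c k * g c k)| ≤ 2 * E := by
    intro D d g v E hE hg hd hv
    rw [← Finset.sum_sub_distrib]
    refine le_of_eq_of_le ?_ (abs_sum_mul_le_of_mass_le hr u (K := n + 1)
      (g := fun k => ∑ c, χ c u * ((D k - d c k) * g c k)) (by positivity) fun k hk => ?_)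
    · congr 1
      refine Finset.sum_congr rfl fun k _ => ?_
      rw [hv, mul_assoc, ← mul_sub, Finset.mul_sum, ← Finset.sum_sub_distrib]
      congr 1
      exact Finset.sum_congr rfl fun c _ => by ring
    · refine h.abs_sum_mul_le u fun c hc => ?_
      rw [abs_mul, mul_comm]
      exact mul_le_mul (hg _ _) (hd k hk c hc) (abs_nonneg _) zero_le_two
  have h1 := hpart (fun k => departureRate φ r k u)
    (cellDeparture a (n + 1) (profileWeight χ r)) (fun c k => w c (k - 1) - w c k)
    (fun k => ∑ c, χ c u * w c (k - 1) - ∑ c, χ c u * w c k) (δ + C * (n + 1 : ℕ) * τ)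
    (by positivity) (fun c k => hw2 c _ _)
    (fun k hk c hc => h.abs_departureRate_sub_le hφ hr hτ hK hδ hk hc)
    (fun k => by rw [← Finset.sum_sub_distrib]; simp only [mul_sub])
  have h2 := hpart (fun k => arrivalRate φ r k u)
    (cellArrival a (n + 1) (profileWeight χ r)) (fun c k => w c (k + 1) - w c k)
    (fun k => ∑ c, χ c u * w c (k + 1) - ∑ c, χ c u * w c k) (δ + C * τ)
    (by positivity) (fun c k => hw2 c _ _)
    (fun k hk c hc => h.abs_arrivalRate_sub_le hφ hr hτ hδ hk hc)
    (fun k => by rw [← Finset.sum_sub_distrib]; simp only [mul_sub])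
  have h3 : |(∑ c, χ c u * w c n) * (r (n + 1) u * departureRate φ r (n + 1) u)| ≤ C * τ := by
    have hD := hφ.departure_mem hr (n + 1) u
    have hr0 := hr.nonneg (n + 1) u
    rw [abs_mul, abs_of_nonneg (mul_nonneg hr0 hD.1)]
    calc |∑ c, χ c u * w c n| * (r (n + 1) u * departureRate φ r (n + 1) u)
        ≤ 1 * (r (n + 1) u * (C * (n + 1 : ℕ))) :=
          mul_le_mul (h.abs_sum_mul_le u fun c _ => hw c n)
            (mul_le_mul_of_nonneg_left hD.2 hr0) (mul_nonneg hr0 hD.1) zero_le_one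
      _ = C * ((n + 1 : ℕ) * r (n + 1) u) := by ring
      _ ≤ C * τ := mul_le_mul_of_nonneg_left (hτ.level_le u) hC
  rw [abs_le] at h1 h2 h3 ⊢
  constructor <;> linarith [h1.1, h1.2, h2.1, h2.2, h3.1, h3.2]

end Profile

/-! ### Exponential moments of the particle system -/

section ExpMean

variable {N : ℕ} {φ : ℕ → ℕ → UnitAddCircle → UnitAddCircle → ℝ} {C : ℝ}

/-- The average of `exp (θ η(i))` over the positions. -/
noncomputable def expMean (θ : ℝ) (η : Fin N → ℕ) : ℝ :=
  (1 / (N : ℝ)) * ∑ i, Real.exp (θ * η i)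

theorem tailMass_le_expMean {θ : ℝ} (hθ : 1 ≤ θ) (K : ℕ) (η : Fin N → ℕ) :
    tailMass K η ≤ Real.exp (-(θ - 1) * K) * expMean θ η := by
  rw [tailMass, expMean, mul_left_comm]
  refine mul_le_mul_of_nonneg_left ?_ (by positivity)
  rw [Finset.mul_sum]
  refine Finset.sum_le_sum fun i _ => ?_
  split_ifs with hi
  · exact natCast_le_exp_mul hθ hi
  · positivity

/-- The particle counterpart of the exponential moment bound: departures only lower the mean, while
arrivals multiply `exp (θ * η j)` by `exp θ` at a rate at most `C` times the density, hence at most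
`C * M` on the block. -/
theorem generator_expMean_le (hφ : BoundedRates φ C) (hN : 1 ≤ N) {θ : ℝ} (hθ : 0 ≤ θ) {M : ℕ}
    {η : Fin N → ℕ} (hη : ∑ i, η i ≤ M * N) :
    generator N φ (expMean θ) η ≤ C * M * (Real.exp θ - 1) * expMean θ η := by
  have hN' : (0 : ℝ) < N := by exact_mod_cast hN
  have hjump : ∀ i, ∀ j ∈ Finset.univ.erase i,
      expMean θ (moveParticle η i j) - expMean θ η
        ≤ (1 / (N : ℝ)) * (0 + (Real.exp θ - 1) * Real.exp (θ * η j)) := by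
    intro i j hj
    rw [expMean, expMean, ← mul_sub]
    refine mul_le_mul_of_nonneg_left ?_ (by positivity)
    rw [sum_comp_moveParticle (fun n _ => Real.exp (θ * n)) η (Finset.ne_of_mem_erase hj)]
    have h1 : Real.exp (θ * (η i - 1 : ℕ)) ≤ Real.exp (θ * η i) :=
      Real.exp_le_exp.2 (mul_le_mul_of_nonneg_left (by exact_mod_cast Nat.sub_le _ _) hθ)
    have h2 : Real.exp (θ * (η j + 1 : ℕ)) = Real.exp θ * Real.exp (θ * η j) := by
      rw [← Real.exp_add]
      congr 1
      push_cast
      ring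
    rw [h2]
    linarith
  calc generator N φ (expMean θ) η
      ≤ (1 / (N : ℝ)) * ∑ i : Fin N, ∑ j ∈ Finset.univ.erase i,
          φ (η i) (η j) (site N i) (site N j) *
            ((1 / (N : ℝ)) * (0 + (Real.exp θ - 1) * Real.exp (θ * η j))) :=
        mul_le_mul_of_nonneg_left (Finset.sum_le_sum fun i _ => Finset.sum_le_sum fun j hj =>
          mul_le_mul_of_nonneg_left (hjump i j hj) (hφ.nonneg _ _ _ _)) (by positivity)
    _ = (1 / (N : ℝ)) * ∑ j, arrivalAt φ η j * ((Real.exp θ - 1) * Real.exp (θ * η j)) := by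
        rw [generator_linear η φ (fun _ => (0 : ℝ))]
        simp
    _ ≤ (1 / (N : ℝ)) * ∑ j, C * M * ((Real.exp θ - 1) * Real.exp (θ * η j)) := by
        refine mul_le_mul_of_nonneg_left (Finset.sum_le_sum fun j _ =>
          mul_le_mul_of_nonneg_right ?_ (mul_nonneg ?_ (Real.exp_pos _).le)) (by positivity)
        · calc arrivalAt φ η j ≤ (1 / (N : ℝ)) * ∑ i, C * (η i : ℝ) := by
                refine mul_le_mul_of_nonneg_left ((Finset.sum_le_sum_of_subset_of_nonneg
                  (Finset.erase_subset _ _) fun i _ _ => hφ.nonneg _ _ _ _).trans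
                  (Finset.sum_le_sum fun i _ => hφ.le _ _ _ _)) (by positivity)
            _ = C * ((1 / (N : ℝ)) * ∑ i, (η i : ℝ)) := by rw [← Finset.mul_sum]; ring
            _ ≤ C * M := by
                refine mul_le_mul_of_nonneg_left ?_ hφ.const_nonneg
                rw [one_div, inv_mul_le_iff₀ hN', mul_comm]
                exact_mod_cast hη
        · linarith [Real.one_le_exp hθ]
    _ = C * M * (Real.exp θ - 1) * expMean θ η := by
        rw [expMean, ← Finset.mul_sum, ← Finset.mul_sum]
        ring

end ExpMean

/-! ### The Gronwall estimate -/

section Gronwall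

variable {Ω : Type*} [MeasurableSpace Ω] {P : Measure Ω} [IsProbabilityMeasure P] {N : ℕ}
  {φ : ℕ → ℕ → UnitAddCircle → UnitAddCircle → ℝ} {C : ℝ} {X : ℝ≥0 → Ω → (Fin N → ℕ)}

theorem IsMarkovProcess.blockExp_expMean_le (hφ : BoundedRates φ C)
    (h : IsMarkovProcess P N φ X) (hN : 1 ≤ N) {θ : ℝ} (hθ : 0 ≤ θ) (M : ℕ) {T t : ℝ}
    (ht : t ∈ Set.Icc 0 T) :
    blockExp P X (M * N) (expMean θ) t
      ≤ blockExp P X (M * N) (expMean θ) 0 * Real.exp (C * M * (Real.exp θ - 1) * t) := by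
  have hα : 0 ≤ C * M * (Real.exp θ - 1) :=
    mul_nonneg (mul_nonneg hφ.const_nonneg M.cast_nonneg) (by linarith [Real.one_le_exp hθ])
  have := le_of_deriv_right_le_linear (T := T) (f := blockExp P X (M * N) (expMean θ))
    (f' := blockExp P X (M * N) (generator N φ (expMean θ))) hα (le_refl 0)
    (h.continuous_blockExp hφ.toIsRateFamily _ _).continuousOn
    (fun s hs => (h.hasDerivWithinAt_blockExp hφ.toIsRateFamily _ _ hs.1).mono
      (Set.Ici_subset_Ici.2 hs.1))
    (fun s _ => by
      rw [add_zero, ← blockExp_const_mul]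
      exact h.blockExp_mono (fun η hη => generator_expMean_le hφ hN hθ hη) s) t ht
  simpa using this

variable {ι : Type} [Fintype ι] {χ : ι → C(UnitAddCircle, ℝ)} {a : ℕ → ℕ → ι → ι → ℝ}
  {K : ℕ} {δ : ℝ} {r₀ : ℕ → C(UnitAddCircle, ℝ)} {ρ R : ℝ≥0 → ℕ → C(UnitAddCircle, ℝ)}

theorem hasDerivWithinAt_smoothDist {β : ℝ} (hβ : 0 < β) (χ : ι → C(UnitAddCircle, ℝ)) (K : ℕ)
    (hρ : ∀ (t : ℝ≥0) (k : ℕ),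
      HasDerivWithinAt (fun s : ℝ => ρ s.toNNReal k) (R t k) (Set.Ici 0) t)
    (η : Fin N → ℕ) {t : ℝ} (ht : 0 ≤ t) :
    HasDerivWithinAt (fun s : ℝ => smoothDist β K χ (profileWeight χ (ρ s.toNNReal)) η)
      (-∑ c, ∑ k ∈ Finset.range K, profileWeight χ (R t.toNNReal) c k
        * smoothSign β K χ (profileWeight χ (ρ t.toNNReal)) η c k) (Set.Ici 0) t := by
  have hweight : ∀ c k, HasDerivWithinAt (fun s : ℝ => profileWeight χ (ρ s.toNNReal) c k)
      (profileWeight χ (R t.toNNReal) c k) (Set.Ici 0) t := fun c k => by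
    have h1 := hρ t.toNNReal k
    rw [Real.coe_toNNReal t ht] at h1
    have h2 := (integralAgainst (χ c)).hasFDerivAt.comp_hasDerivWithinAt t h1
    simp only [Function.comp_def, integralAgainst_apply] at h2
    exact h2
  have h2 : HasDerivWithinAt (fun s : ℝ => smoothDist β K χ (profileWeight χ (ρ s.toNNReal)) η)
      (∑ c, ∑ k ∈ Finset.range K,
        (cellWeight χ η c k - profileWeight χ (ρ t.toNNReal) c k)
          / smoothAbs β (cellWeight χ η c k - profileWeight χ (ρ t.toNNReal) c k)
          * -profileWeight χ (R t.toNNReal) c k) (Set.Ici 0) t :=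
    HasDerivWithinAt.fun_sum fun c _ => HasDerivWithinAt.fun_sum fun k _ =>
      (hasDerivAt_smoothAbs hβ _).comp_hasDerivWithinAt t ((hweight c k).const_sub _)
  convert h2 using 1
  rw [← Finset.sum_neg_distrib]
  refine Finset.sum_congr rfl fun c _ => ?_
  rw [← Finset.sum_neg_distrib]
  refine Finset.sum_congr rfl fun k hk => ?_
  rw [smoothSign, if_pos (Finset.mem_range.1 hk)]
  ring

theorem sum_abs_le_smoothDist (β : ℝ) (K : ℕ) (χ : ι → C(UnitAddCircle, ℝ)) (y : ι → ℕ → ℝ)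
    (η : Fin N → ℕ) :
    ∑ c, ∑ k ∈ Finset.range K, |cellWeight χ η c k - y c k| ≤ smoothDist β K χ y η :=
  Finset.sum_le_sum fun _ _ => Finset.sum_le_sum fun _ _ => abs_le_smoothAbs _ _

/-- On a block with bounded density, the cell weights of the particle system stay close to those
of the solution. -/
theorem IsRegularSolution.blockExp_smoothDist_le (hρ : IsRegularSolution φ r₀ ρ R)
    (hφ : BoundedRates φ C) (hX : IsMarkovProcess P N φ X) (hN : 1 ≤ N)
    (h : IsLocalization φ C K δ χ a) (hK : 1 ≤ K) (hδ : 0 ≤ δ) {β : ℝ} (hβ : 0 < β) {M : ℕ}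
    {T : ℝ≥0} {Λ Λ₁ Λ' θ : ℝ} (hθ : 1 ≤ θ) (hΛ₁ : ∀ t ≤ T, ExpMomentBound 1 Λ₁ (ρ t))
    (hΛ : ∀ t ≤ T, ExpMomentBound θ Λ (ρ t))
    (hΛ' : ∀ t ∈ Set.Icc (0 : ℝ) T, blockExp P X (M * N) (expMean θ) t ≤ Λ') :
    blockExp P X (M * N) (smoothDist β K χ (profileWeight χ (ρ T))) T
      ≤ (blockExp P X (M * N) (smoothDist β K χ (profileWeight χ (ρ 0))) 0
        + (8 * δ + 4 * C * K / N + 8 * C * M / (β * N)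
          + Real.exp (-(θ - 1) * K) * (C * (2 * K + 3) * Λ + 5 * C * Λ')) * T)
        * Real.exp (8 * (C * K) * T) := by
  have hC := hφ.const_nonneg
  have hΛ0 : 0 ≤ Λ := (hΛ 0 (zero_le (a := T))).nonneg
  have hΛ'0 : 0 ≤ Λ' := by
    refine le_trans ?_ (hΛ' 0 ⟨le_rfl, T.coe_nonneg⟩)
    refine integral_nonneg fun ω => ?_
    rw [cutoff]
    split_ifs
    · exact mul_nonneg (by positivity) (Finset.sum_nonneg fun i _ => (Real.exp_pos _).le)
    · exact le_rfl
  set q := Real.exp (-(θ - 1) * K) with hq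
  have hq0 : 0 ≤ q := (Real.exp_pos _).le
  set E := 8 * δ + 4 * C * K / N + 8 * C * M / (β * N)
    + q * (C * (2 * K + 3) * Λ + 5 * C * Λ') with hE
  set E₀ := 8 * δ + 4 * C * K / N + 8 * C * M / (β * N) + C * (2 * K + 3) * (q * Λ) with hE₀
  have hE0 : 0 ≤ E := by positivity
  have hE₀0 : 0 ≤ E₀ := by positivity
  set F : ℝ → (Fin N → ℕ) → ℝ := fun s => smoothDist β K χ (profileWeight χ (ρ s.toNNReal)) with hF
  set F' : ℝ → (Fin N → ℕ) → ℝ := fun t η => -∑ c, ∑ k ∈ Finset.range K,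
    profileWeight χ (R t.toNNReal) c k
      * smoothSign β K χ (profileWeight χ (ρ t.toNNReal)) η c k with hF'
  have hderiv : ∀ t : ℝ, 0 ≤ t → HasDerivWithinAt (fun s => blockExp P X (M * N) (F s) s)
      (blockExp P X (M * N) (fun η => F' t η + generator N φ (F t) η) t) (Set.Ici 0) t :=
    fun t ht => hX.hasDerivWithinAt_blockExp_time hφ.toIsRateFamily _ ht fun η =>
      hasDerivWithinAt_smoothDist hβ χ K hρ.hasDeriv η ht
  -- The generator and the time derivative of `ρ` are both compared with `cellDrift` for the same
  -- test weights `smoothSign`. Their difference is then the drift at two sets of weights, at most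
  -- `8 * C * K` times the distance. The random tail mass is kept separately as a multiple of
  -- `expMean`, to be averaged with `hΛ'`.
  have hpoint : ∀ t ∈ Set.Ico (0 : ℝ) T, ∀ η : Fin N → ℕ, ∑ i, η i ≤ M * N →
      F' t η + generator N φ (F t) η ≤ (8 * (C * K) * F t η + E₀) + 5 * C * q * expMean θ η := by
    intro t ht η hη
    have htT : t.toNNReal ≤ T := by
      rw [← Real.toNNReal_coe (r := T)]
      exact Real.toNNReal_le_toNNReal ht.2.le
    have hr : IsProfile Λ₁ (ρ t.toNNReal) := (hΛ₁ _ htT).isProfile (hρ.nonneg _)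
      fun n u => sum_le_hasSum _ (fun k _ => hρ.nonneg _ k u) (hρ.mass _ u)
    have hτ := (hΛ _ htT).tailBound hθ (hρ.nonneg _) K
    rw [← hq] at hτ
    have hs1 := abs_smoothSign_le_one hβ K χ (profileWeight χ (ρ t.toNNReal)) η
    have h1 := h.generator_smoothDist_le hφ hN hδ hβ (profileWeight χ (ρ t.toNNReal)) hη
    have h2 := (abs_le.1 (h.abs_sum_meanFieldRHS_sub_le hφ hr hτ hK hδ (hρ.rhs _) hs1
      fun c k hk => smoothSign_eq_zero β χ _ η c hk)).1
    have h3 := (abs_le.1 (abs_cellDrift_sub_le (mul_nonneg hC K.cast_nonneg) h.abs_le_mul hs1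
      (h.cellWeight_nonneg η) (h.profileWeight_nonneg hr) (h.sum_cellWeight_le hN η)
      (h.sum_profileWeight_le hr))).2
    have h4 : 8 * (C * K) * ∑ c, ∑ k ∈ Finset.range K,
        |cellWeight χ η c k - profileWeight χ (ρ t.toNNReal) c k| ≤ 8 * (C * K) * F t η :=
      mul_le_mul_of_nonneg_left (sum_abs_le_smoothDist _ _ _ _ _) (by positivity)
    have h5 : 5 * C * tailMass K η ≤ 5 * C * (q * expMean θ η) :=
      mul_le_mul_of_nonneg_left (tailMass_le_expMean hθ K η) (by positivity)
    simp only [hF', hF, hE₀] at h4 ⊢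
    have h6 : 4 * (C * K / N) = 4 * C * K / N := by ring
    nlinarith
  have hmain := le_of_deriv_right_le_linear (T := (T : ℝ))
    (f := fun s => blockExp P X (M * N) (F s) s)
    (f' := fun t => blockExp P X (M * N) (fun η => F' t η + generator N φ (F t) η) t)
    (by positivity : 0 ≤ 8 * (C * K)) hE0
    (fun t ht => ((hderiv t ht.1).continuousWithinAt).mono Set.Icc_subset_Ici_self)
    (fun t ht => (hderiv t ht.1).mono (Set.Ici_subset_Ici.2 ht.1))
    (fun t ht => by
      refine (hX.blockExp_mono (hpoint t ht) t).trans ?_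
      rw [hX.blockExp_add, hX.blockExp_add, blockExp_const_mul, blockExp_const_mul]
      have h1 := hX.blockExp_const_le (M * N) hE₀0 t
      have h2 := mul_le_mul_of_nonneg_left (hΛ' t ⟨ht.1, ht.2.le⟩)
        (by positivity : 0 ≤ 5 * C * q)
      have h3 : E = E₀ + 5 * C * q * Λ' := by rw [hE, hE₀]; ring
      rw [h3]
      linarith) T ⟨T.coe_nonneg, le_rfl⟩
  simpa [hF] using hmain

end Gronwall

end MeanField

namespace MeanField

/-! ### Riemann sums on the torus -/

theorem dist_coe_unitAddCircle_le (x y : ℝ) :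
    dist (x : UnitAddCircle) (y : UnitAddCircle) ≤ |x - y| := by
  rw [dist_eq_norm, ← AddCircle.coe_sub]
  exact QuotientAddGroup.norm_mk_le_norm

theorem tendsto_average_site (g : C(UnitAddCircle, ℝ)) :
    Tendsto (fun N : ℕ => (1 / (N : ℝ)) * ∑ i : Fin N, g (site N i)) atTop (𝓝 (∫ u, g u)) := by
  rw [Metric.tendsto_atTop]
  intro ε hε
  obtain ⟨r, hr, huc⟩ := Metric.uniformContinuous_iff.1
    (CompactSpace.uniformContinuous_of_continuous g.continuous) (ε / 2) (half_pos hε)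
  obtain ⟨N₀, hN₀⟩ := exists_nat_one_div_lt hr
  refine ⟨N₀ + 1, fun N hN => ?_⟩
  have hN' : (0 : ℝ) < N := by exact_mod_cast (Nat.succ_pos _).trans_le hN
  have hNr : 1 / (N : ℝ) < r := by
    refine lt_of_le_of_lt ?_ hN₀
    exact one_div_le_one_div_of_le (by positivity) (by exact_mod_cast hN)
  have hgc : Continuous fun x : ℝ => g (x : UnitAddCircle) :=
    g.continuous.comp (AddCircle.continuous_mk' 1)
  have hint : ∀ a b : ℝ, IntervalIntegrable (fun x : ℝ => g (x : UnitAddCircle)) volume a b :=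
    fun a b => hgc.intervalIntegrable a b
  have hsplit : ∫ u, g u = ∑ i : Fin N, ∫ x in ((i : ℕ) / N : ℝ)..(((i : ℕ) + 1 : ℝ) / N),
      g (x : UnitAddCircle) := by
    have h1 := intervalIntegral.sum_integral_adjacent_intervals (μ := volume)
      (f := fun x : ℝ => g (x : UnitAddCircle)) (a := fun i : ℕ => (i : ℝ) / N) (n := N)
      fun k _ => hint _ _
    have h2 := AddCircle.intervalIntegral_preimage 1 0 g
    simp only [Nat.cast_zero, zero_div, div_self hN'.ne', Nat.cast_add, Nat.cast_one] at h1
    rw [zero_add] at h2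
    rw [← h2, ← h1, Finset.sum_range]
  have hcell : ∀ i : Fin N, |1 / (N : ℝ) * g (site N i)
      - ∫ x in ((i : ℕ) / N : ℝ)..(((i : ℕ) + 1 : ℝ) / N), g (x : UnitAddCircle)|
      ≤ ε / 2 * (1 / N) := by
    intro i
    have hlen : ((i : ℕ) + 1 : ℝ) / N - (i : ℕ) / N = 1 / N := by rw [← sub_div]; ring
    have h3 : 1 / (N : ℝ) * g (site N i)
        = ∫ _x in ((i : ℕ) / N : ℝ)..(((i : ℕ) + 1 : ℝ) / N), g (site N i) := by
      rw [intervalIntegral.integral_const, hlen, smul_eq_mul]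
    rw [h3, ← intervalIntegral.integral_sub intervalIntegrable_const (hint _ _),
      ← Real.norm_eq_abs]
    refine (intervalIntegral.norm_integral_le_of_norm_le_const (C := ε / 2)
      fun x hx => ?_).trans_eq ?_
    · rw [Set.uIoc_of_le (by gcongr; linarith)] at hx
      refine (huc (lt_of_le_of_lt (dist_coe_unitAddCircle_le _ _) ?_)).le
      rw [abs_of_nonneg (by linarith [hx.2])]
      linarith [hx.1]
    · rw [hlen, abs_of_pos (by positivity)]
  rw [Real.dist_eq, hsplit, Finset.mul_sum, ← Finset.sum_sub_distrib]
  refine ((Finset.abs_sum_le_sum_abs _ _).trans (Finset.sum_le_sum fun i _ => hcell i)).trans_lt ?_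
  rw [Finset.sum_const, Finset.card_univ, Fintype.card_fin, nsmul_eq_mul]
  have : (N : ℝ) * (ε / 2 * (1 / N)) = ε / 2 := by field_simp
  linarith

/-! ### The initial law -/

/-- Integrates `|z| ≤ s / 2 + z ^ 2 / (2 * s)`. The free parameter `s` replaces the square root of
the variance. -/
theorem integral_abs_sub_integral_le {α : Type*} [MeasurableSpace α] {μ : Measure α}
    [IsProbabilityMeasure μ] {Y : α → ℝ} (hY : MemLp Y 2 μ) {s : ℝ} (hs : 0 < s) :
    ∫ x, |Y x - ∫ z, Y z ∂μ| ∂μ ≤ (s + Var[Y; μ] / s) / 2 := by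
  have hc : MemLp (fun x => Y x - ∫ z, Y z ∂μ) 2 μ := hY.sub (memLp_const _)
  have hsq := hc.integrable_sq
  calc ∫ x, |Y x - ∫ z, Y z ∂μ| ∂μ ≤ ∫ x, (s / 2 + (Y x - ∫ z, Y z ∂μ) ^ 2 * (1 / (2 * s))) ∂μ := by
        refine integral_mono (hc.integrable one_le_two).abs
          ((integrable_const _).add (hsq.mul_const _)) fun x => ?_
        set z := Y x - ∫ z, Y z ∂μ
        have h1 : s / 2 + z ^ 2 * (1 / (2 * s)) = (s ^ 2 + |z| ^ 2) / (2 * s) := by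
          rw [sq_abs]
          field_simp
        change |z| ≤ s / 2 + z ^ 2 * (1 / (2 * s))
        rw [h1, le_div_iff₀ (by positivity)]
        nlinarith [sq_nonneg (s - |z|)]
    _ = (s + Var[Y; μ] / s) / 2 := by
        rw [integral_add (integrable_const _) (hsq.mul_const _), integral_mul_const,
          variance_eq_integral hY.aemeasurable]
        simp
        ring

section InitialLaw

variable {N : ℕ} {ψ : UnitAddCircle → ℝ}

instance isProbabilityMeasure_productPoisson (N : ℕ) (ψ : UnitAddCircle → ℝ) :
    IsProbabilityMeasure (productPoisson N ψ) := by
  unfold productPoisson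
  infer_instance

theorem integrable_of_abs_le {μ : Measure (Fin N → ℕ)} [IsProbabilityMeasure μ]
    {G : (Fin N → ℕ) → ℝ} {B : ℝ} (hG : ∀ η, |G η| ≤ B) : Integrable G μ :=
  Integrable.of_bound (Measurable.of_discrete (f := G)).aestronglyMeasurable B
    (Eventually.of_forall hG)

theorem abs_empirical_le (hN : 1 ≤ N) (g : C(UnitAddCircle, ℝ)) (η : Fin N → ℕ) (k : ℕ) :
    |empirical η k g| ≤ ‖g‖ := by
  rw [empirical, abs_mul, abs_of_nonneg (by positivity : (0 : ℝ) ≤ 1 / N)]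
  refine (mul_le_mul_of_nonneg_left (Finset.abs_sum_le_sum_abs _ _) (by positivity)).trans
    (average_le hN fun i => ?_)
  split_ifs
  · exact g.norm_coe_le_norm _
  · simp

theorem integral_productPoisson_comp_eval (hψ : Continuous ψ) (hψ0 : ∀ u, 0 < ψ u) (i : Fin N)
    (G : ℕ → ℝ) :
    ∫ η, G (η i) ∂productPoisson N ψ = ∑' n, poissonProfile hψ n (site N i) * G n := by
  rw [productPoisson]
  refine (integral_comp_eval (μ := fun i : Fin N => poissonMeasure (ψ (site N i)).toNNReal)
    (i := i) (f := G) (Measurable.of_discrete (f := G)).aestronglyMeasurable).trans ?_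
  rw [integral_poissonMeasure]
  refine tsum_congr fun n => ?_
  rw [Real.coe_toNNReal _ (hψ0 _).le, poissonProfile_apply, smul_eq_mul]

theorem integral_empirical_productPoisson (hψ : Continuous ψ) (hψ0 : ∀ u, 0 < ψ u)
    (g : C(UnitAddCircle, ℝ)) (k : ℕ) :
    ∫ η, empirical η k g ∂productPoisson N ψ
      = (1 / (N : ℝ)) * ∑ i, (g * poissonProfile hψ k) (site N i) := by
  simp only [empirical]
  rw [integral_const_mul, integral_finsetSum _ fun i _ => integrable_of_abs_le (B := ‖g‖) fun η => by
    split_ifs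
    · exact g.norm_coe_le_norm _
    · simp]
  congr 1
  refine Finset.sum_congr rfl fun i _ => ?_
  rw [integral_productPoisson_comp_eval hψ hψ0 i fun n => if n = k then g (site N i) else 0,
    tsum_eq_single k fun n hn => by rw [if_neg hn, mul_zero], if_pos rfl, mul_comm]
  rfl

/-- By independence the variances add, and each summand takes values in `[-‖g‖, ‖g‖]`, so has
variance at most `‖g‖ ^ 2`. -/
theorem variance_empirical_le (hN : 1 ≤ N) (ψ : UnitAddCircle → ℝ) (g : C(UnitAddCircle, ℝ))
    (k : ℕ) : Var[fun η => empirical η k g; productPoisson N ψ] ≤ ‖g‖ ^ 2 / N := by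
  have hN' : (0 : ℝ) < N := by exact_mod_cast hN
  have hmem : ∀ i : Fin N, ∀ n : ℕ, (if n = k then g (site N i) else 0) ∈ Set.Icc (-‖g‖) ‖g‖ :=
    fun i n => by
      split_ifs
      · exact abs_le.1 (g.norm_coe_le_norm _)
      · simp
  have hsum : (fun η : Fin N → ℕ => ∑ i, if η i = k then g (site N i) else 0)
      = ∑ i, fun η : Fin N → ℕ => (fun n : ℕ => if n = k then g (site N i) else 0) (η i) := by
    funext η
    simp
  simp only [empirical]
  rw [variance_const_mul, hsum, productPoisson, variance_sum_pi
    (X := fun i n => if n = k then g (site N i) else 0) fun i => MemLp.of_bound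
      Measurable.of_discrete.aestronglyMeasurable ‖g‖
      (Eventually.of_forall fun n => abs_le.2 (hmem i n))]
  have h1 : ∀ i : Fin N, Var[fun n : ℕ => if n = k then g (site N i) else 0;
      poissonMeasure (ψ (site N i)).toNNReal] ≤ ‖g‖ ^ 2 := fun i =>
    (variance_le_sq_of_bounded (Eventually.of_forall (hmem i))
      Measurable.of_discrete.aemeasurable).trans_eq (by ring)
  calc (1 / (N : ℝ)) ^ 2 * ∑ i : Fin N, Var[fun n : ℕ => if n = k then g (site N i) else 0;
        poissonMeasure (ψ (site N i)).toNNReal]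
      ≤ (1 / (N : ℝ)) ^ 2 * ∑ _i : Fin N, ‖g‖ ^ 2 := by
        gcongr with i
        exact h1 i
    _ = ‖g‖ ^ 2 / N := by
        rw [Finset.sum_const, Finset.card_univ, Fintype.card_fin, nsmul_eq_mul]
        field_simp

/-- The law of large numbers for the initial configuration. -/
theorem tendsto_integral_abs_empirical_sub (hψ : Continuous ψ) (hψ0 : ∀ u, 0 < ψ u)
    (g : C(UnitAddCircle, ℝ)) (k : ℕ) :
    Tendsto (fun N : ℕ => ∫ η, |empirical η k g - ∫ u, g u * poissonProfile hψ k u|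
      ∂productPoisson N ψ) atTop (𝓝 0) := by
  set p := ∫ u, g u * poissonProfile hψ k u with hp
  have hmean := tendsto_average_site (g * poissonProfile hψ k)
  have hbound : Tendsto (fun N : ℕ => (1 + ‖g‖ ^ 2) / 2 * Real.sqrt (1 / (N : ℝ))
      + |(1 / (N : ℝ)) * ∑ i : Fin N, (g * poissonProfile hψ k) (site N i) - p|) atTop (𝓝 0) := by
    have h1 : Tendsto (fun N : ℕ => Real.sqrt (1 / (N : ℝ))) atTop (𝓝 0) := by
      have := (Real.continuous_sqrt.tendsto 0).comp (tendsto_one_div_atTop_nhds_zero_nat (𝕜 := ℝ))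
      rwa [Real.sqrt_zero] at this
    have h2 := (hmean.sub_const p).abs
    have h3 : |(∫ u, (g * poissonProfile hψ k) u) - p| = 0 := by
      rw [hp]
      simp
    rw [h3] at h2
    simpa using (h1.const_mul ((1 + ‖g‖ ^ 2) / 2)).add h2
  refine tendsto_of_tendsto_of_tendsto_of_le_of_le' tendsto_const_nhds hbound
    (Eventually.of_forall fun N => integral_nonneg fun η => abs_nonneg _) ?_
  filter_upwards [eventually_ge_atTop 1] with N hN
  have hN' : (0 : ℝ) < N := by exact_mod_cast hN
  -- The choice `s = √(1 / N)` balances `s` against the variance, of order `1 / N`, divided by `s`.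
  have hs : 0 < Real.sqrt (1 / (N : ℝ)) := Real.sqrt_pos.2 (by positivity)
  have hint : ∀ a : ℝ, Integrable (fun η => |empirical η k g - a|) (productPoisson N ψ) :=
    fun a => integrable_of_abs_le (B := ‖g‖ + |a|) fun η => by
      rw [abs_abs]
      exact (abs_sub _ _).trans (by linarith [abs_empirical_le hN g η k])
  have hLp : MemLp (fun η => empirical η k g) 2 (productPoisson N ψ) :=
    MemLp.of_bound Measurable.of_discrete.aestronglyMeasurable ‖g‖
      (Eventually.of_forall fun η => abs_empirical_le hN g η k)
  have h1 := integral_abs_sub_integral_le hLp hs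
  have h2 : Var[fun η => empirical η k g; productPoisson N ψ] / Real.sqrt (1 / (N : ℝ))
      ≤ ‖g‖ ^ 2 * Real.sqrt (1 / (N : ℝ)) := by
    rw [div_le_iff₀ hs, mul_assoc, Real.mul_self_sqrt (by positivity), mul_one_div]
    exact variance_empirical_le hN ψ g k
  rw [integral_empirical_productPoisson hψ hψ0] at h1
  set b := (1 / (N : ℝ)) * ∑ i : Fin N, (g * poissonProfile hψ k) (site N i)
  calc ∫ η, |empirical η k g - p| ∂productPoisson N ψ
      ≤ ∫ η, (|empirical η k g - b| + |b - p|) ∂productPoisson N ψ :=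
        integral_mono (hint p) ((hint b).add (integrable_const _)) fun η => abs_sub_le _ _ _
    _ = ∫ η, |empirical η k g - b| ∂productPoisson N ψ + |b - p| := by
        rw [integral_add (hint b) (integrable_const _)]
        simp
    _ ≤ _ := by linarith

theorem expMean_productPoisson (hψ : Continuous ψ) (hψ0 : ∀ u, 0 < ψ u) {θ Λ : ℝ} (hN : 1 ≤ N)
    (hΛ : ExpMomentBound θ Λ (poissonProfile hψ)) :
    Integrable (expMean θ) (productPoisson N ψ) ∧
      ∫ η, expMean θ η ∂productPoisson N ψ ≤ Λ := by
  have hnn : ∀ (i : Fin N) (n : ℕ), 0 ≤ poissonProfile hψ n (site N i) * Real.exp (θ * n) :=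
    fun i n => mul_nonneg (poissonProfile_nonneg hψ hψ0 _ _) (Real.exp_pos _).le
  have hle : ∀ (i : Fin N) (m : ℕ),
      ∑ n ∈ Finset.range m, poissonProfile hψ n (site N i) * Real.exp (θ * n) ≤ Λ := fun i m => by
    simpa only [mul_comm] using hΛ m (site N i)
  have hint : ∀ i : Fin N, Integrable (fun η : Fin N → ℕ => Real.exp (θ * η i))
      (productPoisson N ψ) := by
    intro i
    have h1 : Integrable (fun n : ℕ => Real.exp (θ * n))
        (poissonMeasure (ψ (site N i)).toNNReal) := by
      rw [integrable_poissonMeasure_iff]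
      refine (summable_of_sum_range_le (hnn i) (hle i)).congr fun n => ?_
      rw [Real.coe_toNNReal _ (hψ0 _).le, poissonProfile_apply, Real.norm_eq_abs,
        abs_of_pos (Real.exp_pos _)]
    exact (measurePreserving_eval (fun i : Fin N => poissonMeasure (ψ (site N i)).toNNReal)
      i).integrable_comp_of_integrable h1
  refine ⟨(integrable_finsetSum _ fun i _ => hint i).const_mul _, ?_⟩
  simp only [expMean]
  rw [integral_const_mul, integral_finsetSum _ fun i _ => hint i]
  refine average_le hN fun i => ?_
  rw [integral_productPoisson_comp_eval hψ hψ0 i fun n => Real.exp (θ * n)]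
  exact Real.tsum_le_of_sum_range_le (hnn i) (hle i)

end InitialLaw

end MeanField

namespace MeanField

/-! ### Convergence of the empirical measures -/

section Observable

variable {N : ℕ} {ι : Type} [Fintype ι] {φ : ℕ → ℕ → UnitAddCircle → UnitAddCircle → ℝ}
  {C δ m : ℝ} {K : ℕ} {χ : ι → C(UnitAddCircle, ℝ)} {a : ℕ → ℕ → ι → ι → ℝ}
  {r : ℕ → C(UnitAddCircle, ℝ)}

/-- Replacing `f` on each cell by its value at `p c` costs `δ` for the particles and `δ` for the
profile. What remains is linear in the cell weights with coefficients at most `‖f‖`. -/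
theorem IsLocalization.abs_empirical_sub_le (h : IsLocalization φ C K δ χ a) (hN : 1 ≤ N)
    (hδ : 0 ≤ δ) (hr : IsProfile m r) {f : C(UnitAddCircle, ℝ)} {p : ι → UnitAddCircle}
    (hp : ∀ c u, χ c u ≠ 0 → |f u - f (p c)| ≤ δ) {k : ℕ} (hk : k < K) {β : ℝ} (η : Fin N → ℕ) :
    |empirical η k f - ∫ u, r k u * f u|
      ≤ ‖f‖ * smoothDist β K χ (profileWeight χ r) η + 2 * δ := by
  set q : ℕ → UnitAddCircle → ℝ := fun l v => if l = k then f v else 0 with hq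
  set b : ι → ℕ → ℝ := fun c l => if l = k then f (p c) else 0 with hb
  have hqb : ∀ l < K, ∀ c v, χ c v ≠ 0 → |q l v - b c l| ≤ δ := fun l _ c v hv => by
    simp only [hq, hb]
    split_ifs
    · exact hp c v hv
    · simpa using hδ
  have h1 := h.abs_average_sub_le hN hδ (B := 0) hqb (fun l hl v => by
    simp only [hq]
    rw [if_neg (by omega)]
    simp) η
  have h2 := h.abs_sum_integral_sub_le hr hδ (fun l => by
    simp only [hq]
    split_ifs
    · exact f.continuous
    · exact continuous_const) hqb
  have h3 := abs_cell_sum_sub_le (K := K) (q := b) (B := ‖f‖) (fun c l _ => by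
    simp only [hb]
    split_ifs
    · exact f.norm_coe_le_norm _
    · simp) (cellWeight χ η) (profileWeight χ r)
  have h4 := mul_le_mul_of_nonneg_left
    (sum_abs_le_smoothDist β K χ (profileWeight χ r) η) (norm_nonneg f)
  have h5 : ∑ l ∈ Finset.range K, ∫ v, q l v * r l v = ∫ u, r k u * f u := by
    rw [Finset.sum_eq_single k (fun l _ hl => by simp [hq, hl])
      (fun hk' => absurd (Finset.mem_range.2 hk) hk')]
    simp [hq, mul_comm]
  have h6 : (1 / (N : ℝ)) * ∑ j, q (η j) (site N j) = empirical η k f := rfl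
  rw [h5] at h2
  rw [h6, zero_mul, add_zero] at h1
  rw [abs_le] at h1 h2 h3 ⊢
  constructor <;> linarith [h1.1, h1.2, h2.1, h2.2, h3.1, h3.2]

end Observable

/-! ### Initial configurations, conservation of particles and deviations. -/

section Initial

variable {Ω : Type*} [MeasurableSpace Ω] {P : Measure Ω} [IsProbabilityMeasure P] {N : ℕ}
  {φ : ℕ → ℕ → UnitAddCircle → UnitAddCircle → ℝ} {C : ℝ} {X : ℝ≥0 → Ω → (Fin N → ℕ)}
  {ψ : UnitAddCircle → ℝ}

omit [IsProbabilityMeasure P] in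
theorem IsMarkovProcess.blockExp_zero_le (hX : IsMarkovProcess P N φ X)
    (h0 : P.map (X 0) = productPoisson N ψ) (L : ℕ) {G : (Fin N → ℕ) → ℝ} (hG0 : ∀ η, 0 ≤ G η)
    (hG : Integrable G (productPoisson N ψ)) :
    blockExp P X L G 0 ≤ ∫ η, G η ∂productPoisson N ψ := by
  obtain ⟨B, hB⟩ := exists_abs_cutoff_le L G
  have h1 : blockExp P X L G 0 = ∫ η, cutoff L G η ∂productPoisson N ψ := by
    rw [← h0, integral_map (hX.measurable 0).aemeasurable
      (Measurable.of_discrete (f := cutoff L G)).aestronglyMeasurable, blockExp,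
      Real.toNNReal_zero]
  rw [h1]
  refine integral_mono (integrable_of_abs_le hB) hG fun η => ?_
  rw [cutoff]
  split_ifs
  · exact le_rfl
  · exact hG0 η

omit [IsProbabilityMeasure P] in
theorem blockExp_one (hX : IsMarkovProcess P N φ X) (L : ℕ) (t : ℝ≥0) :
    blockExp P X L (fun _ => 1) t = P.real {ω | ∑ i, X t ω i ≤ L} := by
  have hmeas : MeasurableSet {ω | ∑ i, X t ω i ≤ L} :=
    hX.measurable t (MeasurableSet.of_discrete (s := {η : Fin N → ℕ | ∑ i, η i ≤ L}))
  rw [← integral_indicator_one hmeas, blockExp, Real.toNNReal_coe]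
  refine integral_congr_ae (Eventually.of_forall fun ω => ?_)
  simp [cutoff, Set.indicator_apply]

/-- The number of particles is conserved. -/
theorem IsMarkovProcess.measureReal_block_eq (hφ : IsRateFamily φ) (hX : IsMarkovProcess P N φ X)
    (L : ℕ) (t : ℝ≥0) :
    P.real {ω | ∑ i, X t ω i ≤ L} = P.real {ω | ∑ i, X 0 ω i ≤ L} := by
  rw [← blockExp_one hX, ← blockExp_one hX, hX.blockExp_eq hφ L _ t.coe_nonneg]
  have : generator N φ (fun _ => (1 : ℝ)) = fun _ => 0 := by
    funext η
    simp [generator]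
  simp [this, blockExp, cutoff]

/-- Conservation of particles moves the event to time zero, where Markov's inequality applies to
`expMean 1`, which dominates the density; the bound is uniform in `N`. -/
theorem IsMarkovProcess.measureReal_compl_block_le (hφ : IsRateFamily φ)
    (hX : IsMarkovProcess P N φ X) (h0 : P.map (X 0) = productPoisson N ψ)
    (hψ : Continuous ψ) (hψ0 : ∀ u, 0 < ψ u) (hN : 1 ≤ N) {Λ : ℝ}
    (hΛ : ExpMomentBound 1 Λ (poissonProfile hψ)) {M : ℕ} (hM : 1 ≤ M) (t : ℝ≥0) :
    P.real {ω | ¬ ∑ i, X t ω i ≤ M * N} ≤ Λ / M := by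
  have hM' : (0 : ℝ) < M := by exact_mod_cast hM
  have hN' : (0 : ℝ) < N := by exact_mod_cast hN
  have hmeas : ∀ s, MeasurableSet {ω | ∑ i, X s ω i ≤ M * N} := fun s =>
    hX.measurable s (MeasurableSet.of_discrete (s := {η : Fin N → ℕ | ∑ i, η i ≤ M * N}))
  have hcompl : ∀ s, P.real {ω | ¬ ∑ i, X s ω i ≤ M * N}
      = 1 - P.real {ω | ∑ i, X s ω i ≤ M * N} := fun s => by
    rw [← probReal_compl_eq_one_sub (hmeas s)]
    rfl
  obtain ⟨hint, hle⟩ := expMean_productPoisson hψ hψ0 hN hΛ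
  rw [hcompl, hX.measureReal_block_eq hφ, ← hcompl, le_div_iff₀ hM', mul_comm]
  have hset : P.real {ω | ¬ ∑ i, X 0 ω i ≤ M * N}
      = (productPoisson N ψ).real {η | ¬ ∑ i, η i ≤ M * N} := by
    rw [← h0, map_measureReal_apply (hX.measurable 0) MeasurableSet.of_discrete]
    rfl
  rw [hset]
  refine le_trans ?_ ((mul_meas_ge_le_integral_of_nonneg (Eventually.of_forall fun η => ?_)
    hint (M : ℝ)).trans hle)
  · refine mul_le_mul_of_nonneg_left (measureReal_mono fun η hη => ?_) hM'.le
    have h1 : (M : ℝ) * N ≤ ∑ i, (η i : ℝ) := by exact_mod_cast (not_le.1 hη).le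
    change (M : ℝ) ≤ expMean 1 η
    rw [expMean, one_div, le_inv_mul_iff₀ hN', mul_comm]
    refine h1.trans (Finset.sum_le_sum fun i _ => ?_)
    rw [one_mul]
    exact natCast_le_exp _
  · exact mul_nonneg (by positivity) (Finset.sum_nonneg fun i _ => (Real.exp_pos _).le)

theorem IsMarkovProcess.blockExp_smoothDist_zero_le {ι : Type} [Fintype ι]
    (hX : IsMarkovProcess P N φ X) (h0 : P.map (X 0) = productPoisson N ψ)
    (hψ : Continuous ψ) (hN : 1 ≤ N) {β : ℝ} (hβ : 0 < β) (K L : ℕ)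
    (χ : ι → C(UnitAddCircle, ℝ)) :
    blockExp P X L (smoothDist β K χ (profileWeight χ (poissonProfile hψ))) 0
      ≤ ∑ c, ∑ k ∈ Finset.range K, (∫ η, |empirical η k (χ c)
        - ∫ u, χ c u * poissonProfile hψ k u| ∂productPoisson N ψ + β) := by
  have hint' : ∀ c k, Integrable (fun η : Fin N → ℕ => |empirical η k (χ c)
      - ∫ u, χ c u * poissonProfile hψ k u|) (productPoisson N ψ) := fun c k =>
    integrable_of_abs_le (B := ‖χ c‖ + |∫ u, χ c u * poissonProfile hψ k u|) fun η => by
      rw [abs_abs]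
      exact (abs_sub _ _).trans (add_le_add_left (abs_empirical_le hN (χ c) η k) _)
  have hint : ∀ c k, Integrable (fun η : Fin N → ℕ => |empirical η k (χ c)
      - ∫ u, χ c u * poissonProfile hψ k u| + β) (productPoisson N ψ) := fun c k =>
    (hint' c k).add (integrable_const _)
  set G : (Fin N → ℕ) → ℝ := fun η => ∑ c, ∑ k ∈ Finset.range K,
    (|empirical η k (χ c) - ∫ u, χ c u * poissonProfile hψ k u| + β) with hG
  have h1 : ∫ η, G η ∂productPoisson N ψ = ∑ c, ∑ k ∈ Finset.range K, (∫ η, |empirical η k (χ c)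
        - ∫ u, χ c u * poissonProfile hψ k u| ∂productPoisson N ψ + β) := by
    simp only [hG]
    rw [integral_finsetSum _ fun c _ => integrable_finsetSum _ fun k _ => hint c k]
    refine Finset.sum_congr rfl fun c _ => ?_
    rw [integral_finsetSum _ fun k _ => hint c k]
    refine Finset.sum_congr rfl fun k _ => ?_
    rw [integral_add (hint' c k) (integrable_const _)]
    simp
  rw [← h1]
  refine (hX.blockExp_mono (fun η _ => ?_) 0).trans (hX.blockExp_zero_le h0 L (fun η => ?_)
    (integrable_finsetSum _ fun c _ => integrable_finsetSum _ fun k _ => hint c k))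
  · exact Finset.sum_le_sum fun c _ => Finset.sum_le_sum fun k _ => smoothAbs_le hβ _
  · exact Finset.sum_nonneg fun c _ => Finset.sum_nonneg fun k _ => by positivity

/-- A deviation of the empirical measure is unlikely if the expected smoothed distance is
small. -/
theorem IsMarkovProcess.measureReal_deviation_le {ι : Type} [Fintype ι] {δ m β ε : ℝ} {K k L : ℕ}
    {χ : ι → C(UnitAddCircle, ℝ)} {a : ℕ → ℕ → ι → ι → ℝ} {r : ℕ → C(UnitAddCircle, ℝ)}
    (hX : IsMarkovProcess P N φ X) (h : IsLocalization φ C K δ χ a) (hN : 1 ≤ N)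
    (hδ : 0 ≤ δ) (hr : IsProfile m r) {f : C(UnitAddCircle, ℝ)} {p : ι → UnitAddCircle}
    (hp : ∀ c u, χ c u ≠ 0 → |f u - f (p c)| ≤ δ) (hk : k < K) (hε : 4 * δ ≤ ε) (t : ℝ≥0) :
    ε / 2 * P.real {ω | ε ≤ |empirical (X t ω) k f - ∫ u, r k u * f u|}
      ≤ ‖f‖ * blockExp P X L (smoothDist β K χ (profileWeight χ r)) t
        + ε / 2 * P.real {ω | ¬ ∑ i, X t ω i ≤ L} := by
  have hmeas : ∀ S : Set (Fin N → ℕ), MeasurableSet {ω | X t ω ∈ S} := fun S =>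
    hX.measurable t MeasurableSet.of_discrete
  set A : Set (Fin N → ℕ) := {η | ε ≤ |empirical η k f - ∫ u, r k u * f u|} with hA
  set B : Set (Fin N → ℕ) := {η | ¬ ∑ i, η i ≤ L} with hB
  change ε / 2 * P.real {ω | X t ω ∈ A} ≤ _ + ε / 2 * P.real {ω | X t ω ∈ B}
  have hi : ∀ S : Set (Fin N → ℕ),
      Integrable ({ω | X t ω ∈ S}.indicator fun _ => ε / 2) P :=
    fun S => (integrable_const _).indicator (hmeas S)
  have heq : ∀ S : Set (Fin N → ℕ),
      ∫ ω, ({ω | X t ω ∈ S}.indicator fun _ => ε / 2) ω ∂P = ε / 2 * P.real {ω | X t ω ∈ S} :=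
    fun S => by rw [integral_indicator_const _ (hmeas S), smul_eq_mul, mul_comm]
  rw [← heq, ← heq, blockExp, Real.toNNReal_coe, ← integral_const_mul,
    ← integral_add ((hX.integrable_cutoff L _ t).const_mul _) (hi B)]
  refine integral_mono (hi A) (((hX.integrable_cutoff L _ t).const_mul _).add (hi B)) fun ω => ?_
  have hdist : 0 ≤ smoothDist β K χ (profileWeight χ r) (X t ω) :=
    Finset.sum_nonneg fun _ _ => Finset.sum_nonneg fun _ _ => Real.sqrt_nonneg _
  have hε0 : 0 ≤ ε := by linarith
  simp only [Set.indicator_apply, Set.mem_ofPred_eq, hB, cutoff]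
  -- On the block a deviation of at least `ε` forces `‖f‖` times the smoothed distance to be at
  -- least `ε - 2 * δ ≥ ε / 2`; off the block the indicator of the exceptional event suffices.
  by_cases hω : ∑ i, X t ω i ≤ L
  · rw [if_pos hω, if_neg (not_not.2 hω), add_zero]
    split_ifs with hωA
    · have h1 := h.abs_empirical_sub_le hN hδ hr hp hk (β := β) (X t ω)
      have h2 : ε ≤ |empirical (X t ω) k f - ∫ u, r k u * f u| := hωA
      linarith
    · positivity
  · rw [if_neg hω, if_pos hω, mul_zero, zero_add]
    split_ifs
    · exact le_rfl
    · positivity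

end Initial

/-! ### Choice of parameters and convergence in probability. -/

section Limit

variable {φ : ℕ → ℕ → UnitAddCircle → UnitAddCircle → ℝ} {C : ℝ} {ψ : UnitAddCircle → ℝ}
  {ρ R : ℝ≥0 → ℕ → C(UnitAddCircle, ℝ)}
  {Ω : ℕ → Type*} [∀ N, MeasurableSpace (Ω N)] {P : ∀ N, Measure (Ω N)}
  [∀ N, IsProbabilityMeasure (P N)] {X : ∀ N, ℝ≥0 → Ω N → (Fin N → ℕ)}

/-- In the exponent `D' = 8 * (D * T) + 3` the first summand cancels the Gronwall factor. The
product of the exponentials is then `exp (-2 * K)`, half of which absorbs the linear prefactor in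
`K`. -/
theorem exp_neg_mul_exp_mul_le {D D' Λ Λ' T : ℝ} (hD : 0 ≤ D) (hΛ : 0 ≤ Λ) (hΛ' : 0 ≤ Λ')
    (hT : 0 ≤ T) (hθ : D' = 8 * (D * T) + 3) (K : ℕ) :
    Real.exp (-(D' - 1) * K) * (D * (2 * K + 3) * Λ + 5 * D * Λ') * T
        * Real.exp (8 * (D * K) * T)
      ≤ 5 * D * (Λ + Λ') * T * Real.exp (-(K : ℝ)) := by
  have h1 : Real.exp (-(D' - 1) * K) * Real.exp (8 * (D * K) * T)
      = Real.exp (-(K : ℝ)) * Real.exp (-(K : ℝ)) := by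
    rw [← Real.exp_add, ← Real.exp_add, hθ]
    congr 1
    ring
  have h2 : D * (2 * K + 3) * Λ + 5 * D * Λ' ≤ 5 * D * (Λ + Λ') * Real.exp K := by
    have hK := natCast_le_exp K
    have h1' : 1 ≤ Real.exp K := Real.one_le_exp K.cast_nonneg
    have h3 : D * Λ * (2 * K + 3) ≤ D * Λ * (5 * Real.exp K) :=
      mul_le_mul_of_nonneg_left (by linarith) (by positivity)
    have h4 : D * Λ' * 1 ≤ D * Λ' * Real.exp K := mul_le_mul_of_nonneg_left h1' (by positivity)
    linarith
  calc Real.exp (-(D' - 1) * K) * (D * (2 * K + 3) * Λ + 5 * D * Λ') * T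
        * Real.exp (8 * (D * K) * T)
      = (Real.exp (-(D' - 1) * K) * Real.exp (8 * (D * K) * T))
          * ((D * (2 * K + 3) * Λ + 5 * D * Λ') * T) := by ring
    _ ≤ (Real.exp (-(K : ℝ)) * Real.exp (-(K : ℝ))) * (5 * D * (Λ + Λ') * Real.exp K * T) := by
        rw [h1]
        gcongr
    _ = 5 * D * (Λ + Λ') * T * Real.exp (-(K : ℝ)) * (Real.exp (-(K : ℝ)) * Real.exp K) := by ring
    _ = 5 * D * (Λ + Λ') * T * Real.exp (-(K : ℝ)) := by
        rw [← Real.exp_add, neg_add_cancel, Real.exp_zero, mul_one]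

/-- On blocks with bounded density, the expected smoothed distance can be made arbitrarily
small. -/
theorem IsRegularSolution.exists_eventually_blockExp_le (hφ : BoundedRates φ C)
    (hψ : Continuous ψ) (hψ0 : ∀ u, 0 < ψ u) (hρ : IsRegularSolution φ (poissonProfile hψ) ρ R)
    (hX : ∀ N, 1 ≤ N → IsMarkovProcess (P N) N φ (X N))
    (h0 : ∀ N, 1 ≤ N → (P N).map (X N 0) = productPoisson N ψ) (M : ℕ) (T : ℝ≥0) (k : ℕ)
    (f : C(UnitAddCircle, ℝ)) {κ : ℝ} (hκ : 0 < κ) :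
    ∃ (ι : Type) (_ : Fintype ι) (χ : ι → C(UnitAddCircle, ℝ)) (a : ℕ → ℕ → ι → ι → ℝ)
      (p : ι → UnitAddCircle) (K : ℕ) (δ : ℝ) (β : ℕ → ℝ), k < K ∧ 0 ≤ δ ∧ δ ≤ κ ∧
      IsLocalization φ C K δ χ a ∧ (∀ c u, χ c u ≠ 0 → |f u - f (p c)| ≤ δ) ∧
      ∀ᶠ N in atTop,
        blockExp (P N) (X N) (M * N) (smoothDist (β N) K χ (profileWeight χ (ρ T))) T ≤ κ := by
  have hC := hφ.const_nonneg
  set θ := 8 * (C * T) + 3 with hθ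
  have hθ1 : 1 ≤ θ := by
    have : 0 ≤ C * T := mul_nonneg hC T.coe_nonneg
    linarith
  obtain ⟨Λ₁, hΛ₁⟩ := hρ.expMoment T 1
  obtain ⟨Λ, hΛ⟩ := hρ.expMoment T θ
  obtain ⟨Λ₀, hΛ₀⟩ := exists_expMomentBound_poissonProfile hψ hψ0 θ
  have hΛ0 : 0 ≤ Λ := (hΛ 0 (zero_le (a := T))).nonneg
  have hα : 0 ≤ C * M * (Real.exp θ - 1) :=
    mul_nonneg (by positivity) (by linarith [Real.one_le_exp (zero_le_one.trans hθ1)])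
  set Λ' := Λ₀ * Real.exp (C * M * (Real.exp θ - 1) * T) with hΛ'
  have hΛ'0 : 0 ≤ Λ' := mul_nonneg hΛ₀.nonneg (Real.exp_pos _).le
  -- The cutoff is fixed first: it makes the tail error small even after multiplication by the
  -- Gronwall factor. Only then is `δ` chosen, depending on that factor.
  obtain ⟨K, hKκ, hkK⟩ := (((tendsto_const_mul_exp_neg (5 * C * (Λ + Λ') * T)).eventually
    (gt_mem_nhds (half_pos hκ))).and (eventually_gt_atTop k)).exists
  set Q := Real.exp (8 * (C * K) * T) with hQ
  have hQ0 : 0 < Q := Real.exp_pos _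
  have htail := (exp_neg_mul_exp_mul_le hC hΛ0 hΛ'0 T.coe_nonneg hθ K).trans_lt hKκ
  set δ := min κ (κ / (4 * (8 * T * Q + 1))) with hδ
  have hδ0 : 0 < δ := lt_min hκ (by positivity)
  have hδκ : 8 * δ * T * Q ≤ κ / 4 := by
    have h1 : δ ≤ κ / (4 * (8 * T * Q + 1)) := min_le_right _ _
    rw [le_div_iff₀ (by positivity)] at h1
    nlinarith
  obtain ⟨ι, hι, χ, a, p, hloc, hp⟩ := exists_isLocalization hφ K f hδ0
  -- The smoothing costs `β` and the curvature costs `1 / (β * N)`; both equal `1 / √N` for this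
  -- choice.
  set β : ℕ → ℝ := fun N => (Real.sqrt N)⁻¹ with hβ
  have hβ0 : Tendsto β atTop (𝓝 0) :=
    (Real.tendsto_sqrt_atTop.comp tendsto_natCast_atTop_atTop).inv_tendsto_atTop
  refine ⟨ι, hι, χ, a, p, K, δ, β, hkK, hδ0.le, min_le_left _ _, hloc, hp, ?_⟩
  set I : ι → ℕ → ℕ → ℝ := fun c l N => ∫ η, |empirical η l (χ c)
    - ∫ u, χ c u * poissonProfile hψ l u| ∂productPoisson N ψ with hI
  set q := Real.exp (-(θ - 1) * K) * (C * (2 * K + 3) * Λ + 5 * C * Λ') with hq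
  have hlim : Tendsto (fun N : ℕ => ((∑ c, ∑ l ∈ Finset.range K, (I c l N + β N))
      + (8 * δ + 4 * C * K * (1 / (N : ℝ)) + 8 * C * M * β N + q) * T) * Q) atTop
      (𝓝 (((∑ _c : ι, ∑ _l ∈ Finset.range K, ((0 : ℝ) + 0))
        + (8 * δ + 4 * C * K * 0 + 8 * C * M * 0 + q) * T) * Q)) := by
    refine Tendsto.mul_const _ (Tendsto.add (tendsto_finsetSum _ fun c _ =>
      tendsto_finsetSum _ fun l _ => (tendsto_integral_abs_empirical_sub hψ hψ0 (χ c) l).add hβ0)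
      (Tendsto.mul_const _ (((tendsto_const_nhds.add
        (tendsto_one_div_atTop_nhds_zero_nat.const_mul _)).add
        (hβ0.const_mul _)).add_const _)))
  have hlt : ((∑ _c : ι, ∑ _l ∈ Finset.range K, ((0 : ℝ) + 0))
      + (8 * δ + 4 * C * K * 0 + 8 * C * M * 0 + q) * T) * Q < κ := by
    simp only [add_zero, Finset.sum_const_zero, mul_zero, zero_add]
    have : (8 * δ + q) * T * Q = 8 * δ * T * Q + q * T * Q := by ring
    rw [this]
    linarith
  filter_upwards [hlim.eventually (gt_mem_nhds hlt), eventually_ge_atTop 1] with N hN hN1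
  refine le_trans ?_ hN.le
  have hN' : (0 : ℝ) < N := by exact_mod_cast hN1
  have hβN : 0 < β N := inv_pos.2 (Real.sqrt_pos.2 hN')
  have hmean : blockExp (P N) (X N) (M * N) (expMean θ) 0 ≤ Λ₀ :=
    ((hX N hN1).blockExp_zero_le (h0 N hN1) _ (fun η => mul_nonneg (by positivity)
      (Finset.sum_nonneg fun i _ => (Real.exp_pos _).le))
      (expMean_productPoisson hψ hψ0 hN1 hΛ₀).1).trans
      (expMean_productPoisson hψ hψ0 hN1 hΛ₀).2
  have h1 := hρ.blockExp_smoothDist_le hφ (hX N hN1) hN1 hloc (Nat.one_le_of_lt hkK) hδ0.le hβN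
    (M := M) hθ1 hΛ₁ hΛ (Λ' := Λ') fun t ht => by
      refine ((hX N hN1).blockExp_expMean_le hφ hN1 (zero_le_one.trans hθ1) M ht).trans ?_
      refine mul_le_mul hmean (Real.exp_le_exp.2 (mul_le_mul_of_nonneg_left ht.2 hα))
        (Real.exp_pos _).le hΛ₀.nonneg
  refine h1.trans (mul_le_mul_of_nonneg_right (add_le_add ?_ (mul_le_mul_of_nonneg_right ?_
    T.coe_nonneg)) hQ0.le)
  · rw [show ρ 0 = poissonProfile hψ from funext hρ.initial]
    exact (hX N hN1).blockExp_smoothDist_zero_le (h0 N hN1) hψ hN1 hβN K _ χ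
  · have h2 : 8 * C * M / (β N * N) = 8 * C * M * β N := by
      have : β N * N = Real.sqrt N := by
        rw [hβ, inv_mul_eq_div, Real.div_sqrt]
      rw [this, div_eq_mul_inv]
    rw [h2, ← hq, mul_one_div]

/-- The empirical measures converge in probability to the solution. -/
theorem IsRegularSolution.tendsto_measure_deviation (hφ : BoundedRates φ C)
    (hψ : Continuous ψ) (hψ0 : ∀ u, 0 < ψ u) (hρ : IsRegularSolution φ (poissonProfile hψ) ρ R)
    (hX : ∀ N, 1 ≤ N → IsMarkovProcess (P N) N φ (X N))
    (h0 : ∀ N, 1 ≤ N → (P N).map (X N 0) = productPoisson N ψ) (T : ℝ≥0) (k : ℕ)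
    (f : C(UnitAddCircle, ℝ)) {ε : ℝ} (hε : 0 < ε) :
    Tendsto (fun N => P N {ω | ε ≤ |empirical (X N T ω) k f - ∫ u, ρ T k u * f u|})
      atTop (𝓝 0) := by
  rw [← ENNReal.tendsto_toReal_iff (fun N => measure_ne_top _ _) ENNReal.zero_ne_top,
    ENNReal.toReal_zero]
  refine tendsto_order.2 ⟨fun b hb => Eventually.of_forall fun N =>
    hb.trans_le ENNReal.toReal_nonneg, fun b hb => ?_⟩
  obtain ⟨Λ₀, hΛ₀⟩ := exists_expMomentBound_poissonProfile hψ hψ0 1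
  obtain ⟨Λ₁, hΛ₁⟩ := hρ.expMoment T 1
  have hr : IsProfile Λ₁ (ρ T) := (hΛ₁ _ le_rfl).isProfile (hρ.nonneg _)
    fun n u => sum_le_hasSum _ (fun l _ => hρ.nonneg _ l u) (hρ.mass _ u)
  -- The density bound is chosen so that leaving the block has probability at most `b / 2`,
  -- uniformly in `N ≥ 1`.
  obtain ⟨M, hM⟩ := exists_nat_gt (Λ₀ / (b / 2))
  have hM1 : 1 ≤ M + 1 := Nat.le_add_left 1 M
  have hMb : Λ₀ / (M + 1 : ℕ) ≤ b / 2 := by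
    rw [div_le_iff₀ (by positivity)]
    rw [div_lt_iff₀ (by positivity)] at hM
    push_cast
    nlinarith
  -- The first entry gives `4 * δ ≤ ε`. The second gives `‖f‖ * κ ≤ ε * b / 8`, which contributes at
  -- most `b / 4` to the probability, so the total is at most `3 * b / 4 < b`.
  set κ := min (ε / 4) (ε * b / (8 * (‖f‖ + 1))) with hκ
  have hκ0 : 0 < κ := lt_min (by positivity) (by positivity)
  have hκf : ‖f‖ * κ ≤ ε * b / 8 := by
    have h1 : κ ≤ ε * b / (8 * (‖f‖ + 1)) := min_le_right _ _
    rw [le_div_iff₀ (by positivity)] at h1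
    nlinarith
  obtain ⟨ι, _, χ, a, p, K, δ, β, hkK, hδ0, hδκ, hloc, hp, hev⟩ :=
    hρ.exists_eventually_blockExp_le hφ hψ hψ0 hX h0 (M + 1) T k f hκ0
  filter_upwards [hev, eventually_ge_atTop 1] with N hN hN1
  have h1 := (hX N hN1).measureReal_deviation_le (L := (M + 1) * N) (β := β N) hloc hN1 hδ0 hr hp
    hkK (by linarith [min_le_left (ε / 4) (ε * b / (8 * (‖f‖ + 1)))] : 4 * δ ≤ ε) T
  have h2 := ((hX N hN1).measureReal_compl_block_le hφ.toIsRateFamily (h0 N hN1) hψ hψ0 hN1 hΛ₀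
    hM1 T).trans hMb
  have h3 := mul_le_mul_of_nonneg_left hN (norm_nonneg f)
  have h4 := mul_le_mul_of_nonneg_left h2 (half_pos hε).le
  change (P N).real _ < b
  refine lt_of_mul_lt_mul_left (?_ : ε / 2 * _ < ε / 2 * b) (half_pos hε).le
  have : 0 < ε * b := mul_pos hε hb
  linarith

end Limit

end MeanField

theorem theorem2p2
    (φ : ℕ → ℕ → UnitAddCircle → UnitAddCircle → ℝ)
    (hφ : MeanField.IsRateFamily φ)
    (hB : MeanField.LinearGrowth φ)
    (ψ : UnitAddCircle → ℝ)
    (hψ : MeanField.SmoothOnTorus ψ)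
    (hψ_pos : ∀ u, 0 < ψ u) :
    (∃! ρ : ℝ≥0 → ℕ → C(UnitAddCircle, ℝ), MeanField.IsMeanFieldSolution φ ψ ρ) ∧
    ∀ ρ : ℝ≥0 → ℕ → C(UnitAddCircle, ℝ), MeanField.IsMeanFieldSolution φ ψ ρ →
      ∀ (Ω : ℕ → Type*) [∀ N, MeasurableSpace (Ω N)]
        (P : ∀ N, Measure (Ω N)) [∀ N, IsProbabilityMeasure (P N)]
        (η : ∀ N, ℝ≥0 → Ω N → (Fin N → ℕ)),
        (∀ N, 1 ≤ N → MeanField.IsMarkovProcess (P N) N φ (η N)) →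
        (∀ N, 1 ≤ N → (P N).map (η N 0) = MeanField.productPoisson N ψ) →
        ∀ (t : ℝ≥0) (k : ℕ) (f : C(UnitAddCircle, ℝ)) (ε : ℝ), 0 < ε →
          Tendsto
            (fun N => P N {ω | ε ≤ |MeanField.empirical (η N t ω) k f - ∫ u, ρ t k u * f u|})
            atTop (𝓝 0) := by
  obtain ⟨C, hφC⟩ := MeanField.exists_boundedRates hφ hB
  refine ⟨MeanField.existsUnique_isMeanFieldSolution hφC hψ.continuous hψ_pos, ?_⟩
  intro ρ hρ Ω _ P _ η hη hη0 t k f ε hε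
  obtain ⟨R, hR⟩ := hρ.exists_isRegularSolution hφC hψ.continuous hψ_pos
  exact hR.tendsto_measure_deviation hφC hψ.continuous hψ_pos hη hη0 t k f hε
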